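/- A (finite) hypergraph is a pair $\mathcal H=(V,\mathcal E)$ with $V$ a finite set and $\mathcal E$ a finite multiset of subsets of $V$; an orientation $\vec{\mathcal H}$ of $\mathcal H$ chooses in every hyperedge $X$ a head $v\in X$, which turns $X$ into the hyperarc $(X-v,v)$ with tail vertices $X-v$. To reorient a hyperarc means to replace its head by another vertex of the same hyperedge. For $\emptyset\ne X\subsetneq V$ let $d^+(X)$ be the number of hyperarcs whose head lies outside $X$ and which have at least one tail vertex in $X$. The orientation is $k$-hyperarc-connected if $d^+(X)\ge k$ for all $\emptyset\neq X\subsetneq V$, and $\lambda(\vec{\mathcal H})$ is the maximum $k$ for which it is $k$-hyperarc-connected (defined when $|V|\ge 2$). For an integer $k\ge 0$, the hypergraph $\mathcal H$ is $(k,k)$-partition-connected if for every partition $\mathcal P$ of $V$ into at least two non-empty classes, at least $k|\mathcal P|$ hyperedges intersect at least two members of $\mathcal P$. **Theorem.** (i) Let $\mathcal H=(V,\mathcal E)$ be a $(k,k)$-partition-connected hypergraph with $|V|\ge 2$ and let $\vec{\mathcal H}$ be an orientation of $\mathcal H$. Then there is a sequence $\vec{\mathcal H}=\vec{\mathcal H}_0,\vec{\mathcal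 H}_1,\dots,\vec{\mathcal H}_\ell$ of orientations of $\mathcal H$ such that, for $1\le i\le \ell$, the orientation $\vec{\mathcal H}_i$ is obtained from $\vec{\mathcal H}_{i-1}$ by reorienting a single hyperarc and $\lambda(\vec{\mathcal H}_{i-1})\le\lambda(\vec{\mathcal H}_i)$, such that $\lambda(\vec{\mathcal H}_\ell)=\max\{k,\lambda(\vec{\mathcal H})\}$ (so $\lambda(\vec{\mathcal H}_\ell)=k$ whenever $\lambda(\vec{\mathcal H})\le k$), and such that $\ell\le\max\{0,k-\lambda(\vec{\mathcal H})\}\,|V|^3$. (ii) Such a sequence can be computed in polynomial time: there are a single program and a polynomial $T$ such that, for all $\mathcal H$, $\vec{\mathcal H}$ and $k$ as in (i), the program, given $\mathcal H$, $\vec{\mathcal H}$ and $k$, outputs a sequence as in (i) after at most $T(|V|+|\mathcal E|+\sum_{X\in\mathcal E}|X|)$ steps. Here programs are those of a random access machine on natural numbers with unit cost for reading and writing variables and array cells, addition, truncated subtraction and zero tests (and without multiplication). (iii) Consequently, every $(k,k)$-partition-connected hypergraph all of whose hyperedges are non-empty has a $k$-hyperarc-connected orientation. -/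

import Mathlib

/-- A hypergraph on the vertex set `V`: a family of subsets of `V` indexed by `E`, so that the
multiset of hyperedges may contain the same subset several times. -/
structure MultiHypergraph (V E : Type*) where
  edge : E → Finset V

namespace MultiHypergraph

variable {V E : Type*}

/-- An orientation chooses a head vertex in every hyperedge; the hyperarc obtained from the
hyperedge `X` with head `v` is `(X - v, v)`. -/
@[ext]
structure Orientation (H : MultiHypergraph V E) where
  head : E → V
  head_mem : ∀ e, head e ∈ H.edge e

/-- The number of hyperedges that intersect at least two members of the partition `P`. -/
def crossing [Fintype V] [DecidableEq V] [Fintype E] (H : MultiHypergraph V E)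
    (P : Finpartition (Finset.univ : Finset V)) : ℕ :=
  (Finset.univ.filter fun e : E => ∃ A ∈ P.parts, ∃ B ∈ P.parts, A ≠ B ∧
    (H.edge e ∩ A).Nonempty ∧ (H.edge e ∩ B).Nonempty).card

/-- `(k, k)`-partition-connectivity: every partition `P` of `V` into at least two (non-empty)
classes is crossed by at least `k |P|` hyperedges. -/
def IsPartitionConnected [Fintype V] [DecidableEq V] [Fintype E] (H : MultiHypergraph V E)
    (k : ℕ) : Prop :=
  ∀ P : Finpartition (Finset.univ : Finset V), 2 ≤ P.parts.card →
    k * P.parts.card ≤ H.crossing P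

/-- The size of a hypergraph: vertices, hyperedges and incidences. -/
def size [Fintype V] [Fintype E] (H : MultiHypergraph V E) : ℕ :=
  Fintype.card V + Fintype.card E + ∑ e, (H.edge e).card

namespace Orientation

variable {H : MultiHypergraph V E}

/-- The tail vertices of the hyperarc `e`. -/
def tail [DecidableEq V] (O : H.Orientation) (e : E) : Finset V :=
  (H.edge e).erase (O.head e)

/-- The out-degree of `X`: the number of hyperarcs with head outside `X` and at least one tail
vertex in `X`. -/
def outDegree [DecidableEq V] [Fintype E] (O : H.Orientation) (X : Finset V) : ℕ :=
  (Finset.univ.filter fun e : E => O.head e ∉ X ∧ (X ∩ O.tail e).Nonempty).card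

/-- `k`-hyperarc-connectivity. -/
def IsHyperarcConnected [Fintype V] [DecidableEq V] [Fintype E] (O : H.Orientation)
    (k : ℕ) : Prop :=
  ∀ X : Finset V, X.Nonempty → X ≠ Finset.univ → k ≤ O.outDegree X

/-- The hyperarc-connectivity: the maximum `k` such that the orientation is
`k`-hyperarc-connected. The maximum exists as soon as `V` has two vertices, see
`isGreatest_connectivity`. -/
noncomputable def connectivity [Fintype V] [DecidableEq V] [Fintype E] (O : H.Orientation) : ℕ :=
  sSup {k : ℕ | O.IsHyperarcConnected k}

theorem isGreatest_connectivity [Fintype V] [DecidableEq V] [Fintype E] (O : H.Orientation)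
    (hV : 2 ≤ Fintype.card V) :
    IsGreatest {k : ℕ | O.IsHyperarcConnected k} O.connectivity := by
  have hne : {k : ℕ | O.IsHyperarcConnected k}.Nonempty := ⟨0, fun _ _ _ => Nat.zero_le _⟩
  have : Nontrivial V := Fintype.one_lt_card_iff_nontrivial.mp hV
  obtain ⟨a, b, hab⟩ := exists_pair_ne V
  have hbdd : BddAbove {k : ℕ | O.IsHyperarcConnected k} := by
    refine ⟨O.outDegree {a}, fun k hk => hk {a} (Finset.singleton_nonempty a) fun h => hab ?_⟩
    have hb : b ∈ ({a} : Finset V) := h ▸ Finset.mem_univ b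
    exact (Finset.mem_singleton.mp hb).symm
  exact ⟨Nat.sSup_mem hne hbdd, fun k hk => le_csSup hbdd hk⟩

/-- `O'` is obtained from `O` by reorienting exactly one hyperarc `e` towards another vertex of
the same hyperedge. -/
def Reorients (O O' : H.Orientation) : Prop :=
  ∃ e, O'.head e ≠ O.head e ∧ ∀ f, f ≠ e → O'.head f = O.head f

/-- `S 0, S 1, …, S ℓ` is a sequence of orientations that starts in `O`, reorients one hyperarc at
a time, never decreases the hyperarc-connectivity, and ends with hyperarc-connectivity `k` (or with
the initial connectivity, if that exceeds `k`) after at most `(k - λ(O)) |V| ^ 3` steps. The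
subtraction is truncated: if `k ≤ λ(O)`, no step is made. -/
structure IsAugmentation [Fintype V] [DecidableEq V] [Fintype E] (O : H.Orientation) (k : ℕ)
    (ℓ : ℕ) (S : ℕ → H.Orientation) : Prop where
  start : S 0 = O
  step : ∀ i < ℓ, (S i).Reorients (S (i + 1))
  mono : ∀ i < ℓ, (S i).connectivity ≤ (S (i + 1)).connectivity
  final : (S ℓ).connectivity = max k O.connectivity
  length : ℓ ≤ (k - O.connectivity) * Fintype.card V ^ 3

end Orientation

end MultiHypergraph

/-! A random access machine: structured programs over variables and arrays of natural numbers.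
Every operation (reading a constant, a variable or an array cell, addition, truncated subtraction,
an assignment, a test) costs one step. There is no multiplication, so the numbers occurring in the
first `t` steps have `O(t)` bits more than the input and the constants of the program, and
polynomial time is the same as for Turing machines. -/

namespace RAM

/-- A store: the values of the variables, and the cells of the arrays. A program mentions only
finitely many variables and arrays; the arrays are unbounded. -/
structure Store where
  var : ℕ → ℕ
  arr : ℕ → ℕ → ℕ

inductive Expr where
  | const (c : ℕ)
  | var (x : ℕ)
  | get (a : ℕ) (i : Expr)
  | add (u v : Expr)
  | sub (u v : Expr)

/-- The value of an expression. -/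
def Expr.eval (s : Store) : Expr → ℕ
  | .const c => c
  | .var x => s.var x
  | .get a i => s.arr a (i.eval s)
  | .add u v => u.eval s + v.eval s
  | .sub u v => u.eval s - v.eval s

/-- The number of operations needed to evaluate an expression. -/
def Expr.cost : Expr → ℕ
  | .const _ => 1
  | .var _ => 1
  | .get _ i => i.cost + 1
  | .add u v => u.cost + v.cost + 1
  | .sub u v => u.cost + v.cost + 1

inductive Program where
  | skip
  | assign (x : ℕ) (u : Expr)
  | put (a : ℕ) (i u : Expr)
  | seq (p q : Program)
  | cond (u : Expr) (p q : Program)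
  | loop (u : Expr) (p : Program)

/-- The store after the assignment `x := n`. -/
def Store.setVar (s : Store) (x n : ℕ) : Store :=
  { s with var := Function.update s.var x n }

/-- The store after the assignment `a[i] := n`. -/
def Store.setArr (s : Store) (a i n : ℕ) : Store :=
  { s with arr := Function.update s.arr a (Function.update (s.arr a) i n) }

/-- `Runs p s t s'`: started in the store `s`, the program `p` halts after exactly `t` steps in the
store `s'`. A test `u` succeeds if its value is not `0`; `loop u p` is `while u ≠ 0 do p`. -/
inductive Runs : Program → Store → ℕ → Store → Prop where
  | skip (s : Store) : Runs .skip s 1 s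
  | assign (s : Store) (x : ℕ) (u : Expr) :
      Runs (.assign x u) s (u.cost + 1) (s.setVar x (u.eval s))
  | put (s : Store) (a : ℕ) (i u : Expr) :
      Runs (.put a i u) s (i.cost + u.cost + 1) (s.setArr a (i.eval s) (u.eval s))
  | seq {p q : Program} {s s' s'' : Store} {t t' : ℕ} (hp : Runs p s t s') (hq : Runs q s' t' s'') :
      Runs (.seq p q) s (t + t') s''
  | cond_true {u : Expr} {p q : Program} {s s' : Store} {t : ℕ} (hu : u.eval s ≠ 0)
      (hp : Runs p s t s') : Runs (.cond u p q) s (u.cost + 1 + t) s'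
  | cond_false {u : Expr} {p q : Program} {s s' : Store} {t : ℕ} (hu : u.eval s = 0)
      (hq : Runs q s t s') : Runs (.cond u p q) s (u.cost + 1 + t) s'
  | loop_true {u : Expr} {p : Program} {s s' s'' : Store} {t t' : ℕ} (hu : u.eval s ≠ 0)
      (hp : Runs p s t s') (hl : Runs (.loop u p) s' t' s'') :
      Runs (.loop u p) s (u.cost + 1 + t + t') s''
  | loop_false {u : Expr} {p : Program} {s : Store} (hu : u.eval s = 0) :
      Runs (.loop u p) s (u.cost + 1) s

/-- The input: an oriented hypergraph with vertices `0, …, n - 1` and hyperedges `0, …, m - 1`, and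
the number `k`. The variables `0, 1, 2` hold `n, m, k`; the array `0` holds the incidence matrix,
row by row; the array `1` holds the heads. Everything else is `0`. -/
def input {n m : ℕ} {H : MultiHypergraph (Fin n) (Fin m)} (O : H.Orientation) (k : ℕ) : Store where
  var x := if x = 0 then n else if x = 1 then m else if x = 2 then k else 0
  arr a i :=
    if a = 0 then
      if ∃ (e : Fin m) (v : Fin n), i = (e : ℕ) * n + (v : ℕ) ∧ v ∈ H.edge e then 1 else 0
    else if a = 1 then
      if h : i < m then (O.head ⟨i, h⟩ : ℕ) else 0
    else 0

/-- The output: the variable `3` holds the length `ℓ`, and the array `2` holds the heads of the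
orientations `S 0, …, S ℓ`, one orientation after the other. -/
def IsOutput {n m : ℕ} {H : MultiHypergraph (Fin n) (Fin m)} (s : Store) (ℓ : ℕ)
    (S : ℕ → H.Orientation) : Prop :=
  s.var 3 = ℓ ∧ ∀ i ≤ ℓ, ∀ e : Fin m, s.arr 2 (i * m + (e : ℕ)) = ((S i).head e : ℕ)

end RAM

/-!
Let `λ` be the hyperarc-connectivity and `n` the number of vertices. It suffices to raise `λ` from
`k` to `k + 1` in a `(k + 1, k + 1)`-partition-connected hypergraph, by at most `n ^ 3`
reorientations none of which decreases `λ`. As the out-degree of a set is the in-degree of its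
complement, `λ ≥ c` means that all non-empty proper subsets have in-degree at least `c`. Reversing
a hyperpath from `s` to `t` raises the in-degree of the sets that contain `s` but not `t` by one,
lowers it by one on the sets that contain `t` but not `s`, and changes no other in-degree; in fact
in-degrees only depend on how often each vertex is a head (`Orientation.Exchange`).

The target. At most `n (n - 1)` reversals of whole hyperpaths, each of which keeps `λ ≥ k`, lead to
some orientation with `λ ≥ k + 1`. Reorienting the hyperarcs of these paths one at a time may
decrease `λ` in between, so the reversals only serve to find the target. The vertex `0` is taken as
a root. First the sets of in-degree `k` that avoid the root are removed, in the order of their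
maxima, then the sets of out-degree `k`. If `v` is the first maximum of such a deficient set, then
uncrossing, together with partition-connectivity, which bounds the sum of the in-degrees of the
classes of a partition from below (`Orientation.sum_inDegree_ge`), gives `s` and `t` such that the
reversal of a hyperpath from `s` to `t` exists, violates no bound reached before, and makes the
least deficient set with maximum `v` larger, or leaves none (`DegreePair.exists_exchange`). Hence a
lexicographic score, bounded by `n (n - 1) + 1`, increases (`Orientation.exists_score_lt`).

The walk. Let `O` be the current orientation and `O'` the target. Call the reorientation of a
single hyperarc of `O` safe if it keeps `λ ≥ k`. From the vertices that are heads less often in `O`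
than in `O'`, a hyperpath of safe hyperarcs leads to a vertex that is a head more often
(`Orientation.exists_mem_of_safe_closed`). Every proper subset of in-degree `k` that contains the
end of such a path contains all of it, so its hyperarcs can be reoriented one by one, from the end,
with `λ ≥ k` all the time. Each path brings the head counts closer to those of `O'`
(`Orientation.Exchange.headDist_lt`), so that there are at most `n (n - 1)` paths. A single
reorientation changes `λ` by at most one; stopping as soon as `λ = k + 1` gives a monotone sequence.

The algorithm. All conditions are decided by one test: whether every set that contains `B` and
avoids `A` has in-degree at least `c`. This holds if and only if `c` times in succession a hyperpath
from `A` to `B` can be found, and reversed, in a copy of the orientation (`RAM.exec_cut`). The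
program is written in a language of bounded loops (`RAM.Code`), for which termination and polynomial
running time are automatic (`RAM.Code.runs_compile`). It keeps the incidence matrix in the array
`0`, the current heads in `1`, the output in `2`, multiples of `n` in `3` and the target in `4`; the
arrays `5` and `6` hold copies of heads, `10` to `16` marks, tables and head counts, and the triples
from `20` and from `30` the results of searches. The existence statement for arbitrary types of
vertices and hyperedges is deduced from the correctness of the program by relabelling.
-/

namespace MultiHypergraph

/-! ### In-degrees, head counts and exchanges -/

section Degrees

set_option linter.unusedSectionVars false

variable {V E : Type*} [Fintype V] [DecidableEq V] [Fintype E] {H : MultiHypergraph V E}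

theorem compl_nonempty_iff {V : Type*} [Fintype V] [DecidableEq V] (X : Finset V) :
    Xᶜ.Nonempty ↔ X ≠ Finset.univ := by
  rw [Finset.nonempty_iff_ne_empty, Ne, Finset.compl_eq_empty_iff]

namespace Orientation

/-- The in-degree of `X`: the number of hyperarcs with head in `X` and a tail vertex outside. -/
def inDegree (O : H.Orientation) (X : Finset V) : ℕ :=
  (Finset.univ.filter fun e : E => O.head e ∈ X ∧ ¬ H.edge e ⊆ X).card

/-- The number of hyperarcs with head `v`. -/
def headCount (O : H.Orientation) (v : V) : ℕ :=
  (Finset.univ.filter fun e : E => O.head e = v).card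

theorem outDegree_eq (O : H.Orientation) (X : Finset V) : O.outDegree X = O.inDegree Xᶜ := by
  unfold outDegree inDegree
  congr 1
  ext e
  rw [Finset.mem_filter, Finset.mem_filter, Finset.mem_compl, tail]
  refine and_congr_right fun _ => and_congr_right fun h => ?_
  rw [Finset.not_subset]
  constructor
  · rintro ⟨x, hx⟩
    simp only [Finset.mem_inter, Finset.mem_erase] at hx
    exact ⟨x, hx.2.2, by simpa using hx.1⟩
  · rintro ⟨x, hx, hx'⟩
    simp only [Finset.mem_compl, not_not] at hx'
    exact ⟨x, by
      simp only [Finset.mem_inter, Finset.mem_erase]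
      exact ⟨hx', fun h' => h (h' ▸ hx'), hx⟩⟩

theorem inDegree_eq (O : H.Orientation) (X : Finset V) : O.inDegree X = O.outDegree Xᶜ := by
  rw [outDegree_eq, compl_compl]

/-- The in-degree of `X` and the number of hyperedges inside `X` add up to the number of heads in
`X`. Hence in-degrees only depend on the head counts. -/
theorem inDegree_add (O : H.Orientation) (X : Finset V) :
    O.inDegree X + (Finset.univ.filter fun e : E => H.edge e ⊆ X).card
      = ∑ v ∈ X, O.headCount v := by
  classical
  have h1 : ∑ v ∈ X, O.headCount v = (Finset.univ.filter fun e : E => O.head e ∈ X).card := by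
    unfold headCount
    rw [← Finset.card_biUnion]
    · congr 1
      ext e
      simp
    · intro x _ y _ hxy
      rw [Function.onFun, Finset.disjoint_left]
      intro e he he'
      simp only [Finset.mem_filter, Finset.mem_univ, true_and] at he he'
      exact hxy (he.symm.trans he')
  rw [h1, inDegree, ← Finset.card_union_of_disjoint]
  · congr 1
    ext e
    simp only [Finset.mem_union, Finset.mem_filter, Finset.mem_univ, true_and]
    constructor
    · rintro (h | h)
      · exact h.1
      · exact h (O.head_mem e)
    · intro h
      by_cases h' : H.edge e ⊆ X
      · exact Or.inr h'
      · exact Or.inl ⟨h, h'⟩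
  · rw [Finset.disjoint_left]
    intro e he he'
    simp only [Finset.mem_filter, Finset.mem_univ, true_and] at he he'
    exact he.2 he'

theorem inDegree_submod (O : H.Orientation) (X Y : Finset V) :
    O.inDegree (X ∩ Y) + O.inDegree (X ∪ Y) ≤ O.inDegree X + O.inDegree Y := by
  classical
  have h1 := O.inDegree_add X
  have h2 := O.inDegree_add Y
  have h3 := O.inDegree_add (X ∩ Y)
  have h4 := O.inDegree_add (X ∪ Y)
  have h5 := Finset.sum_union_inter (s₁ := X) (s₂ := Y) (f := O.headCount)
  have h6 : (Finset.univ.filter fun e : E => H.edge e ⊆ X).card +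
      (Finset.univ.filter fun e : E => H.edge e ⊆ Y).card ≤
      (Finset.univ.filter fun e : E => H.edge e ⊆ X ∪ Y).card +
      (Finset.univ.filter fun e : E => H.edge e ⊆ X ∩ Y).card := by
    rw [← Finset.card_union_add_card_inter]
    refine Nat.add_le_add (Finset.card_le_card ?_) (Finset.card_le_card ?_)
    · intro e he
      simp only [Finset.mem_union, Finset.mem_filter, Finset.mem_univ, true_and] at he ⊢
      rcases he with h | h
      · exact h.trans Finset.subset_union_left
      · exact h.trans Finset.subset_union_right
    · intro e he
      simp only [Finset.mem_inter, Finset.mem_filter, Finset.mem_univ, true_and] at he ⊢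
      exact Finset.subset_inter he.1 he.2
  omega

theorem outDegree_submod (O : H.Orientation) (X Y : Finset V) :
    O.outDegree (X ∩ Y) + O.outDegree (X ∪ Y) ≤ O.outDegree X + O.outDegree Y := by
  have h := O.inDegree_submod Xᶜ Yᶜ
  simp only [outDegree_eq, Finset.compl_inter, Finset.compl_union]
  omega

/-- Submodularity of the in-degree for `X` and the complement of `Z`. -/
theorem inDegree_outDegree_sdiff (O : H.Orientation) (X Z : Finset V) :
    O.inDegree (X \ Z) + O.outDegree (Z \ X) ≤ O.inDegree X + O.outDegree Z := by
  have h := O.inDegree_submod X Zᶜ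
  have e1 : X ∩ Zᶜ = X \ Z := by ext; simp
  have e2 : X ∪ Zᶜ = (Z \ X)ᶜ := by ext; simp; tauto
  rw [e1, e2] at h
  simpa only [outDegree_eq] using h

theorem isHyperarcConnected_iff (O : H.Orientation) (c : ℕ) :
    O.IsHyperarcConnected c ↔
      ∀ X : Finset V, X.Nonempty → X ≠ Finset.univ → c ≤ O.inDegree X := by
  constructor
  · intro h X hX hX'
    rw [inDegree_eq]
    exact h _ (by rwa [compl_nonempty_iff]) (by simpa using hX.ne_empty)
  · intro h X hX hX'
    rw [outDegree_eq]
    exact h _ (by rwa [compl_nonempty_iff]) (by simpa using hX.ne_empty)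

theorem isHyperarcConnected_iff_le (O : H.Orientation) (hV : 2 ≤ Fintype.card V) (c : ℕ) :
    O.IsHyperarcConnected c ↔ c ≤ O.connectivity := by
  have h := O.isGreatest_connectivity hV
  exact ⟨fun hc => h.2 hc, fun hc X hX hX' => hc.trans (h.1 X hX hX')⟩

/-- Every partition into at least two classes has in-degree sum at least `K` times the number of
classes: a crossing hyperedge enters the class of its head. The partition is given by disjoint
sets and the complement of their union. -/
theorem sum_inDegree_ge (O : H.Orientation) {K : ℕ} (hH : H.IsPartitionConnected K)
    (Q : Finset (Finset V)) (hne : ∀ X ∈ Q, X.Nonempty)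
    (hdis : (Q : Set (Finset V)).PairwiseDisjoint id) (hU : Q.Nonempty)
    (hU' : Q.sup id ≠ Finset.univ) :
    (Q.card + 1) * K ≤ ∑ X ∈ Q, O.inDegree X + O.outDegree (Q.sup id) ∧
    (Q.card + 1) * K ≤ ∑ X ∈ Q, O.outDegree X + O.inDegree (Q.sup id) := by
  classical
  set U := Q.sup id with hUdef
  have hsub : ∀ X ∈ Q, X ⊆ U := fun X hX => Finset.le_sup (f := id) hX
  have hc : Uᶜ.Nonempty := by rwa [compl_nonempty_iff]
  have hnot : Uᶜ ∉ Q := by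
    intro h
    obtain ⟨x, hx⟩ := hc
    exact (Finset.mem_compl.mp hx) (hsub _ h hx)
  let P : Finpartition (Finset.univ : Finset V) :=
    { parts := insert Uᶜ Q
      supIndep := by
        rw [Finset.supIndep_iff_pairwiseDisjoint]
        intro A hA B hB hAB
        simp only [Finset.coe_insert, Set.mem_insert_iff, Finset.mem_coe] at hA hB
        rcases hA with rfl | hA <;> rcases hB with rfl | hB
        · exact absurd rfl hAB
        · rw [Function.onFun, id, id, disjoint_comm]
          exact Finset.disjoint_left.mpr fun x hx hx' => Finset.mem_compl.mp hx' (hsub _ hB hx)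
        · exact Finset.disjoint_left.mpr fun x hx hx' => Finset.mem_compl.mp hx' (hsub _ hA hx)
        · exact hdis hA hB hAB
      sup_parts := by
        rw [Finset.sup_insert, id, ← hUdef, Finset.sup_eq_union, Finset.union_comm,
          Finset.union_compl]
      bot_notMem := by
        simp only [Finset.bot_eq_empty, Finset.mem_insert, not_or]
        refine ⟨fun h => hc.ne_empty h.symm, fun h => ?_⟩
        simpa using hne _ h }
  have hcard : P.parts.card = Q.card + 1 := Finset.card_insert_of_notMem hnot
  have hP := hH P (by rw [hcard]; have := hU.card_pos; omega)
  rw [hcard, mul_comm] at hP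
  constructor
  · refine hP.trans ?_
    have h1 : H.crossing P ≤ ∑ X ∈ P.parts, O.inDegree X := by
      refine le_trans (Finset.card_le_card ?_) Finset.card_biUnion_le
      intro e he
      simp only [Finset.mem_filter, Finset.mem_univ, true_and, Finset.mem_biUnion] at he ⊢
      obtain ⟨A, hA, B, hB, hAB, hAe, hBe⟩ := he
      obtain ⟨C, hC, hxC⟩ := P.exists_mem (Finset.mem_univ (O.head e))
      refine ⟨C, hC, hxC, fun hsub => hAB ?_⟩
      have key : ∀ D ∈ P.parts, (H.edge e ∩ D).Nonempty → D = C := by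
        rintro D hD ⟨x, hx⟩
        rw [Finset.mem_inter] at hx
        exact P.eq_of_mem_parts hD hC hx.2 (hsub hx.1)
      rw [key A hA hAe, key B hB hBe]
    rw [show P.parts = insert Uᶜ Q from rfl, Finset.sum_insert hnot, ← outDegree_eq] at h1
    omega
  · refine hP.trans ?_
    have h1 : H.crossing P ≤ ∑ X ∈ P.parts, O.outDegree X := by
      refine le_trans (Finset.card_le_card ?_) Finset.card_biUnion_le
      intro e he
      simp only [Finset.mem_filter, Finset.mem_univ, true_and, Finset.mem_biUnion] at he ⊢
      obtain ⟨A, hA, B, hB, hAB, hAe, hBe⟩ := he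
      have key : ∀ D ∈ P.parts, (H.edge e ∩ D).Nonempty → O.head e ∉ D →
          ∃ a ∈ P.parts, O.head e ∉ a ∧ (a ∩ O.tail e).Nonempty := by
        rintro D hD ⟨x, hx⟩ hn
        rw [Finset.mem_inter] at hx
        refine ⟨D, hD, hn, x, ?_⟩
        simp only [tail, Finset.mem_inter, Finset.mem_erase]
        exact ⟨hx.2, fun h => hn (h ▸ hx.2), hx.1⟩
      by_cases h : O.head e ∈ A
      · exact key B hB hBe fun h' => hAB (P.eq_of_mem_parts hA hB h h')
      · exact key A hA hAe h
    rw [show P.parts = insert Uᶜ Q from rfl, Finset.sum_insert hnot, ← inDegree_eq] at h1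
    omega

/-- `O'` has the head counts of `O`, except that `s` gains a head and `t` loses one: the effect of
reversing a hyperpath from `s` to `t`. -/
def Exchange (O O' : H.Orientation) (s t : V) : Prop :=
  ∀ v, O'.headCount v + (if v = t then 1 else 0) = O.headCount v + (if v = s then 1 else 0)

theorem Exchange.refl (O : H.Orientation) (s : V) : O.Exchange O s s := fun _ => rfl

theorem Exchange.trans {O O₁ O₂ : H.Orientation} {s u t : V} (h₁ : O.Exchange O₁ u t)
    (h₂ : O₁.Exchange O₂ s u) : O.Exchange O₂ s t := by
  intro v
  have a := h₁ v
  have b := h₂ v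
  omega

theorem Exchange.inDegree {O O' : H.Orientation} {s t : V} (h : O.Exchange O' s t)
    (X : Finset V) :
    O'.inDegree X + (if t ∈ X then 1 else 0) = O.inDegree X + (if s ∈ X then 1 else 0) := by
  have h1 := O.inDegree_add X
  have h2 := O'.inDegree_add X
  have h3 : ∑ v ∈ X, (O'.headCount v + if v = t then 1 else 0)
      = ∑ v ∈ X, (O.headCount v + if v = s then 1 else 0) := Finset.sum_congr rfl fun v _ => h v
  rw [Finset.sum_add_distrib, Finset.sum_add_distrib, Finset.sum_ite_eq', Finset.sum_ite_eq'] at h3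
  omega

theorem Exchange.outDegree {O O' : H.Orientation} {s t : V} (h : O.Exchange O' s t)
    (X : Finset V) :
    O'.outDegree X + (if s ∈ X then 1 else 0) = O.outDegree X + (if t ∈ X then 1 else 0) := by
  have := h.inDegree Xᶜ
  rw [outDegree_eq, outDegree_eq]
  simp only [Finset.mem_compl] at this
  split_ifs at this ⊢ <;> simp_all

/-- The orientation with the head of `e` moved to `u`. -/
def setHead [DecidableEq E] (O : H.Orientation) (e : E) (u : V) (hu : u ∈ H.edge e) :
    H.Orientation where
  head := Function.update O.head e u
  head_mem f := by
    by_cases h : f = e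
    · subst h; simpa using hu
    · rw [Function.update_of_ne h]; exact O.head_mem f

theorem exchange_setHead [DecidableEq E] (O : H.Orientation) (e : E) (u : V)
    (hu : u ∈ H.edge e) : O.Exchange (O.setHead e u hu) u (O.head e) := by
  intro v
  unfold headCount
  have key : ∀ (O' : H.Orientation),
      (Finset.univ.filter fun f : E => O'.head f = v).card
      = (if O'.head e = v then 1 else 0)
        + ((Finset.univ.erase e).filter fun f : E => O'.head f = v).card := by
    intro O'
    rw [← Finset.insert_erase (Finset.mem_univ e), Finset.filter_insert]
    split_ifs with h
    · rw [Finset.card_insert_of_notMem (by simp), add_comm]; simp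
    · simp
  rw [key O, key (O.setHead e u hu)]
  have h2 : ((Finset.univ.erase e).filter fun f : E => (O.setHead e u hu).head f = v)
      = ((Finset.univ.erase e).filter fun f : E => O.head f = v) := by
    refine Finset.filter_congr fun f hf => ?_
    simp only [setHead, Function.update_of_ne (Finset.ne_of_mem_erase hf)]
  rw [h2]
  simp only [setHead, Function.update_self]
  simp only [eq_comm (a := v)]
  omega

theorem Exchange.connectivity_le {O O' : H.Orientation} {s t : V} (h : O.Exchange O' s t)
    (hV : 2 ≤ Fintype.card V) : O'.connectivity ≤ O.connectivity + 1 := by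
  have h' : O'.IsHyperarcConnected O'.connectivity := (O'.isGreatest_connectivity hV).1
  have : O.IsHyperarcConnected (O'.connectivity - 1) := by
    rw [isHyperarcConnected_iff] at h' ⊢
    intro X hX hX'
    have a := h' X hX hX'
    have b := h.inDegree X
    split_ifs at b <;> omega
  have := (O.isHyperarcConnected_iff_le hV _).1 this
  omega

/-- Half of the `ℓ¹`-distance of the head counts. -/
def headDist (O O' : H.Orientation) : ℕ := ∑ v, (O.headCount v - O'.headCount v)

theorem sum_headCount (O : H.Orientation) : ∑ v, O.headCount v = Fintype.card E := by
  have := O.inDegree_add Finset.univ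
  rw [← this]
  simp [Orientation.inDegree]

theorem inDegree_congr {O O' : H.Orientation} (h : ∀ v, O.headCount v = O'.headCount v)
    (X : Finset V) : O.inDegree X = O'.inDegree X := by
  have h1 := O.inDegree_add X
  have h2 := O'.inDegree_add X
  have : ∑ v ∈ X, O.headCount v = ∑ v ∈ X, O'.headCount v := Finset.sum_congr rfl fun v _ => h v
  omega

theorem headDist_eq_zero {O O' : H.Orientation} (h : O.headDist O' = 0) (v : V) :
    O.headCount v = O'.headCount v := by
  have h1 : ∀ v ∈ Finset.univ, O.headCount v ≤ O'.headCount v := by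
    intro v hv
    have := (Finset.sum_eq_zero_iff.mp h) v hv
    omega
  have h2 : ∑ v, O.headCount v = ∑ v, O'.headCount v := by rw [sum_headCount, sum_headCount]
  exact (Finset.sum_eq_sum_iff_of_le h1).mp h2 v (Finset.mem_univ v)

theorem headDist_self (O : H.Orientation) : O.headDist O = 0 := by simp [headDist]

theorem Exchange.headDist_le {O O₁ O₂ : H.Orientation} {s t : V} (h : O₁.Exchange O₂ s t) :
    O.headDist O₂ ≤ O.headDist O₁ + 1 := by
  have : ∀ v ∈ Finset.univ, O.headCount v - O₂.headCount v
      ≤ (O.headCount v - O₁.headCount v) + (if v = t then 1 else 0) := by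
    intro v _
    have := h v
    omega
  refine (Finset.sum_le_sum this).trans ?_
  rw [Finset.sum_add_distrib]
  simp [headDist]

/-- An exchange between a vertex with too few and a vertex with too many heads brings the head
counts closer to those of `O`. -/
theorem Exchange.headDist_lt {O O₁ O₂ : H.Orientation} {s t : V} (h : O₁.Exchange O₂ s t)
    (hs : O₁.headCount s < O.headCount s) (ht : O.headCount t < O₁.headCount t) :
    O₂.headDist O + 1 = O₁.headDist O := by
  have hst : s ≠ t := by rintro rfl; omega
  have : ∀ v ∈ Finset.univ, (O₂.headCount v - O.headCount v) + (if v = t then 1 else 0)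
      = O₁.headCount v - O.headCount v := by
    intro v _
    have := h v
    split_ifs at this ⊢ with h1 h2
    · exact absurd (h2.symm.trans h1) hst
    · subst h1; omega
    · rename_i h2; subst h2; omega
    · omega
  rw [headDist, headDist, ← Finset.sum_congr rfl this, Finset.sum_add_distrib]
  simp

end Orientation

end Degrees

end MultiHypergraph

namespace MultiHypergraph

/-! ### Uncrossing: one improving exchange -/

section Uncrossing

set_option linter.unusedSectionVars false

variable {V : Type*} [Fintype V] [DecidableEq V]

theorem exists_min_card {P : Finset V → Prop} (h : ∃ X, P X) :
    ∃ X, P X ∧ ∀ Y, P Y → X.card ≤ Y.card := by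
  classical
  obtain ⟨X₀, hX₀⟩ := h
  obtain ⟨X, hX, hmin⟩ := Finset.exists_min_image (Finset.univ.filter P) Finset.card
    ⟨X₀, by simpa using hX₀⟩
  exact ⟨X, by simpa using hX, fun Y hY => hmin Y (by simpa using hY)⟩

theorem exists_max_card {P : Finset V → Prop} (h : ∃ X, P X) :
    ∃ X, P X ∧ ∀ Y, P Y → Y.card ≤ X.card := by
  classical
  obtain ⟨X₀, hX₀⟩ := h
  obtain ⟨X, hX, hmin⟩ := Finset.exists_max_image (Finset.univ.filter P) Finset.card
    ⟨X₀, by simpa using hX₀⟩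
  exact ⟨X, by simpa using hX, fun Y hY => hmin Y (by simpa using hY)⟩

/-- If a family is closed under unions of intersecting members, then a set that is covered by
members contained in it is partitioned by its maximal members. -/
theorem exists_partition_of_cover {τ : Finset V → Prop}
    (hτ : ∀ X Y, τ X → τ Y → (X ∩ Y).Nonempty → τ (X ∪ Y)) (U : Finset V)
    (hU : ∀ x ∈ U, ∃ X, τ X ∧ X ⊆ U ∧ x ∈ X) :
    ∃ Q : Finset (Finset V), (∀ X ∈ Q, τ X ∧ X.Nonempty) ∧
      (Q : Set (Finset V)).PairwiseDisjoint id ∧ Q.sup id = U := by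
  classical
  refine ⟨Finset.univ.filter fun X => (τ X ∧ X.Nonempty) ∧ X ⊆ U ∧
    ∀ Y, τ Y → Y ⊆ U → X ⊆ Y → Y = X, ?_, ?_, ?_⟩
  · intro X hX
    exact (Finset.mem_filter.mp hX).2.1
  · intro X hX Y hY hXY
    simp only [Finset.coe_filter, Finset.mem_univ, true_and, Set.mem_ofPred_eq] at hX hY
    rw [Function.onFun, id, id, Finset.disjoint_iff_inter_eq_empty]
    by_contra hne
    have hu := hτ X Y hX.1.1 hY.1.1 (Finset.nonempty_iff_ne_empty.mpr hne)
    have hs := Finset.union_subset hX.2.1 hY.2.1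
    exact hXY ((hX.2.2 _ hu hs Finset.subset_union_left).symm.trans
      (hY.2.2 _ hu hs Finset.subset_union_right))
  · refine le_antisymm (Finset.sup_le fun X hX => (Finset.mem_filter.mp hX).2.2.1) ?_
    intro x hx
    obtain ⟨X, ⟨hX, hXU, hxX⟩, hmax⟩ := exists_max_card (hU x hx)
    have hmem : X ∈ Finset.univ.filter fun X => (τ X ∧ X.Nonempty) ∧ X ⊆ U ∧
        ∀ Y, τ Y → Y ⊆ U → X ⊆ Y → Y = X := by
      simp only [Finset.mem_filter, Finset.mem_univ, true_and]
      exact ⟨⟨hX, x, hxX⟩, hXU, fun Y hY hYU hXY =>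
        (Finset.eq_of_subset_of_card_le hXY (hmax Y ⟨hY, hYU, hXY hxX⟩)).symm⟩
    exact Finset.le_sup (f := id) hmem hxX

/-- The properties of the pair (in-degree, out-degree) of an orientation of a
`(K, K)`-partition-connected hypergraph that the uncrossing argument needs. They are symmetric, so
that a statement on raising in-degrees is also one on raising out-degrees. -/
structure DegreePair (f g : Finset V → ℕ) (K : ℕ) : Prop where
  submod_left : ∀ X Y, f (X ∩ Y) + f (X ∪ Y) ≤ f X + f Y
  submod_right : ∀ X Y, g (X ∩ Y) + g (X ∪ Y) ≤ g X + g Y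
  cross : ∀ X Z, f (X \ Z) + g (Z \ X) ≤ f X + g Z
  sum_left : ∀ Q : Finset (Finset V), (∀ X ∈ Q, X.Nonempty) →
    (Q : Set (Finset V)).PairwiseDisjoint id → Q.Nonempty → Q.sup id ≠ Finset.univ →
    (Q.card + 1) * K ≤ ∑ X ∈ Q, f X + g (Q.sup id)
  sum_right : ∀ Q : Finset (Finset V), (∀ X ∈ Q, X.Nonempty) →
    (Q : Set (Finset V)).PairwiseDisjoint id → Q.Nonempty → Q.sup id ≠ Finset.univ →
    (Q.card + 1) * K ≤ ∑ X ∈ Q, g X + f (Q.sup id)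

theorem DegreePair.symm {f g : Finset V → ℕ} {K : ℕ} (h : DegreePair f g K) :
    DegreePair g f K where
  submod_left := h.submod_right
  submod_right := h.submod_left
  cross X Z := by have := h.cross Z X; omega
  sum_left := h.sum_right
  sum_right := h.sum_left

theorem Orientation.degreePair {E : Type*} [Fintype E] {H : MultiHypergraph V E}
    (O : H.Orientation) {K : ℕ} (hH : H.IsPartitionConnected K) :
    DegreePair O.inDegree O.outDegree K where
  submod_left := O.inDegree_submod
  submod_right := O.outDegree_submod
  cross := O.inDegree_outDegree_sdiff
  sum_left Q h1 h2 h3 h4 := (O.sum_inDegree_ge hH Q h1 h2 h3 h4).1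
  sum_right Q h1 h2 h3 h4 := (O.sum_inDegree_ge hH Q h1 h2 h3 h4).2

/-- The sets avoiding the root `r` satisfy `f ≥ k` and `g ≥ b`, those inside `L` even
`f ≥ K = k + 1`, and some set `X` with `v ∈ X ⊆ L + v` has `f X = k`. Then there are `s` and `t`
such that raising `f` by one on the sets containing `s` but not `t`, and lowering it on the sets
containing `t` but not `s`, keeps all these bounds, creates no new `X` of value `k`, and makes the
least such `X` strictly larger or leaves none. -/
theorem DegreePair.exists_exchange {f g : Finset V → ℕ} {K : ℕ} (h : DegreePair f g K)
    {r v : V} {L : Finset V} {k b : ℕ} (hK : K = k + 1) (hb : b ≤ K)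
    (hf : ∀ X : Finset V, X.Nonempty → r ∉ X → k ≤ f X)
    (hg : ∀ X : Finset V, X.Nonempty → r ∉ X → b ≤ g X)
    (hL : ∀ X ⊆ L, X.Nonempty → K ≤ f X) (hr : r ∉ L) (hvr : v ≠ r)
    (hviol : ∃ X, v ∈ X ∧ X ⊆ insert v L ∧ f X = k) :
    ∃ s t,
      (∀ Y, r ∉ Y → t ∈ Y → s ∉ Y → k + 1 ≤ f Y ∧ (Y ⊆ L → K + 1 ≤ f Y)) ∧
      (∀ Z, r ∉ Z → s ∈ Z → t ∉ Z → b + 1 ≤ g Z) ∧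
      (∀ X, v ∈ X → X ⊆ insert v L → t ∈ X → s ∉ X → K + 1 ≤ f X) ∧
      (∀ X, v ∈ X → X ⊆ insert v L → f X = k → s ∈ X) ∧
      (∃ X, (v ∈ X ∧ X ⊆ insert v L ∧ f X = k) ∧ t ∉ X) := by
  classical
  have hrL : r ∉ insert v L := by
    rw [Finset.mem_insert]
    rintro (h | h)
    · exact hvr h.symm
    · exact hr h
  have hsplit : ∀ X : Finset V, X ⊆ insert v L → v ∉ X → X ⊆ L := fun X hX hv =>
    (Finset.subset_insert_iff_of_notMem hv).mp hX
  -- `vio X`: the deficient sets at `v`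
  set vio : Finset V → Prop := fun X => v ∈ X ∧ X ⊆ insert v L ∧ f X = k with hvio
  have vio_r : ∀ X, vio X → r ∉ X := fun X hX hrX => hrL (hX.2.1 hrX)
  have hviou : ∀ X Y, vio X → vio Y → vio (X ∩ Y) ∧ vio (X ∪ Y) := by
    intro X Y hX hY
    have h1 := h.submod_left X Y
    have hvI : v ∈ X ∩ Y := Finset.mem_inter.mpr ⟨hX.1, hY.1⟩
    have hvU : v ∈ X ∪ Y := Finset.mem_union_left _ hX.1
    have h2 := hf (X ∩ Y) ⟨v, hvI⟩ fun hh => vio_r X hX (Finset.mem_inter.mp hh).1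
    have hUs : X ∪ Y ⊆ insert v L := Finset.union_subset hX.2.1 hY.2.1
    have h3 := hf (X ∪ Y) ⟨v, hvU⟩ fun hh => hrL (hUs hh)
    have h4 := hX.2.2
    have h5 := hY.2.2
    exact ⟨⟨hvI, Finset.inter_subset_left.trans hX.2.1, by omega⟩, hvU, hUs, by omega⟩
  obtain ⟨X₀, hX₀, hmin⟩ := exists_min_card hviol
  have hX₀le : ∀ X, vio X → X₀ ⊆ X := by
    intro X hX
    have := hmin _ (hviou X₀ X hX₀ hX).1
    have e := Finset.eq_of_subset_of_card_le Finset.inter_subset_left this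
    exact Finset.inter_eq_left.mp e
  have hX₀r := vio_r X₀ hX₀
  have hbal : ∀ X : Finset V, X.Nonempty → r ∉ X → 2 * K ≤ f X + g X := by
    intro X hX hrX
    have := h.sum_left {X} (by simpa using hX) (by simp) (by simp) (by
      intro hu
      rw [Finset.sup_singleton, id] at hu
      exact hrX (hu ▸ Finset.mem_univ r))
    simp at this
    omega
  -- `gt Z`: the tight sets with respect to `g`
  set gt : Finset V → Prop := fun Z => r ∉ Z ∧ g Z = b with hgt
  have hgtu : ∀ X Y, gt X → gt Y → (X ∩ Y).Nonempty → gt (X ∩ Y) ∧ gt (X ∪ Y) := by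
    intro X Y hX hY hne
    have h1 := h.submod_right X Y
    have hrI : r ∉ X ∩ Y := fun hh => hX.1 (Finset.mem_inter.mp hh).1
    have hrU : r ∉ X ∪ Y := by
      intro hh
      rcases Finset.mem_union.mp hh with hh | hh
      exacts [hX.1 hh, hY.1 hh]
    have h2 := hg _ hne hrI
    have h3 := hg (X ∪ Y) (hne.mono (Finset.inter_subset_left.trans Finset.subset_union_left)) hrU
    have h4 := hX.2
    have h5 := hY.2
    exact ⟨⟨hrI, by omega⟩, hrU, by omega⟩
  obtain ⟨s, hs, hsZ⟩ : ∃ s ∈ X₀, ∀ Z, gt Z → Z ⊆ X₀ → s ∉ Z := by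
    by_contra hcon
    push Not at hcon
    obtain ⟨Q, hQ, hdis, hsup⟩ := exists_partition_of_cover (τ := gt)
      (fun X Y hX hY hne => (hgtu X Y hX hY hne).2) X₀
      (fun x hx => by obtain ⟨Z, h1, h2, h3⟩ := hcon x hx; exact ⟨Z, h1, h2, h3⟩)
    have hQne : Q.Nonempty := by
      rw [Finset.nonempty_iff_ne_empty]
      rintro rfl
      have := hX₀.1
      rw [← hsup] at this
      simp at this
    have := h.sum_right Q (fun X hX => (hQ X hX).2) hdis hQne
      (fun hu => hX₀r (hsup ▸ hu ▸ Finset.mem_univ r))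
    rw [hsup, Finset.sum_congr rfl (fun X hX => (hQ X hX).1.2), Finset.sum_const, smul_eq_mul,
      hX₀.2.2] at this
    nlinarith [Nat.mul_le_mul_left Q.card hb]
  have hgs : ∀ Z, gt Z → s ∈ Z → X₀ ⊆ Z := by
    intro Z hZ hsZ'
    by_contra hns
    have hne : (X₀ \ Z).Nonempty := Finset.sdiff_nonempty.mpr hns
    by_cases hZX : Z ⊆ X₀
    · exact hsZ Z hZ hZX hsZ'
    have hne' : (Z \ X₀).Nonempty := Finset.sdiff_nonempty.mpr hZX
    have h1 := h.cross X₀ Z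
    have h2 := hg _ hne' fun hh => hZ.1 (Finset.mem_sdiff.mp hh).1
    have h3 := hf _ hne fun hh => hX₀r (Finset.mem_sdiff.mp hh).1
    have h4 := hX₀.2.2
    have h5 := hZ.2
    by_cases hv : v ∈ X₀ \ Z
    · have : vio (X₀ \ Z) := ⟨hv, Finset.sdiff_subset.trans hX₀.2.1, by omega⟩
      exact (Finset.mem_sdiff.mp (hX₀le _ this hs)).2 hsZ'
    · have := hL _ (hsplit _ (Finset.sdiff_subset.trans hX₀.2.1) hv) hne
      omega
  -- the smallest `g`-tight set containing `s`, or everything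
  obtain ⟨W, hXW, hWcase, hWmin⟩ : ∃ W, X₀ ⊆ W ∧ (gt W ∨ W = Finset.univ) ∧
      ∀ Z, gt Z → s ∈ Z → W ⊆ Z := by
    by_cases hex : ∃ Z, gt Z ∧ s ∈ Z
    · obtain ⟨W, ⟨hW, hsW⟩, hWm⟩ := exists_min_card hex
      refine ⟨W, hgs W hW hsW, Or.inl hW, fun Z hZ hsZ' => ?_⟩
      have hsI : s ∈ W ∩ Z := Finset.mem_inter.mpr ⟨hsW, hsZ'⟩
      have := hWm _ ⟨(hgtu W Z hW hZ ⟨s, hsI⟩).1, hsI⟩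
      exact Finset.inter_eq_left.mp (Finset.eq_of_subset_of_card_le Finset.inter_subset_left this)
    · refine ⟨Finset.univ, Finset.subset_univ _, Or.inr rfl, fun Z hZ hsZ' => ?_⟩
      exact absurd ⟨Z, hZ, hsZ'⟩ hex
  have hsW : s ∈ W := hXW hs
  obtain ⟨X₁, ⟨hX₁, hX₁W⟩, hX₁max⟩ := exists_max_card (P := fun X => vio X ∧ X ⊆ W)
    ⟨X₀, hX₀, hXW⟩
  have hX₁le : ∀ X, vio X → X ⊆ W → X ⊆ X₁ := by
    intro X hX hXW'
    have := hX₁max _ ⟨(hviou X₁ X hX₁ hX).2, Finset.union_subset hX₁W hXW'⟩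
    have e := Finset.eq_of_subset_of_card_le (Finset.subset_union_left (s₂ := X)) this
    exact e ▸ Finset.subset_union_right
  -- a set `Y` avoiding `s` that crosses `W` would cut a smaller `g`-tight set out of `W`
  have hYW : ∀ Y, r ∉ Y → s ∉ Y → (Y ∩ W).Nonempty →
      ((Y \ W).Nonempty → f Y ≤ f (Y \ W)) → Y ⊆ W := by
    intro Y hrY hsY hne hmono
    by_contra hns
    have hne' : (Y \ W).Nonempty := Finset.sdiff_nonempty.mpr hns
    rcases hWcase with hW | hW
    · have h1 := h.cross Y W
      have h2 := hmono hne'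
      have hsm : s ∈ W \ Y := Finset.mem_sdiff.mpr ⟨hsW, hsY⟩
      have hrm : r ∉ W \ Y := fun hh => hW.1 (Finset.mem_sdiff.mp hh).1
      have h3 := hg _ ⟨s, hsm⟩ hrm
      have h4 := hW.2
      have h5 := hWmin (W \ Y) ⟨hrm, by omega⟩ hsm
      obtain ⟨x, hx⟩ := hne
      rw [Finset.mem_inter] at hx
      exact (Finset.mem_sdiff.mp (h5 hx.2)).2 hx.1
    · exact hns (hW ▸ Finset.subset_univ Y)
  -- `ft Y`: the sets on which `f` must not be lowered
  set ft : Finset V → Prop := fun Y => r ∉ Y ∧ s ∉ Y ∧ (f Y = k ∨ (Y ⊆ L ∧ f Y = K)) with hft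
  obtain ⟨t, htW, htX₁, htf⟩ : ∃ t ∈ W, t ∉ X₁ ∧ ∀ Y, ft Y → t ∉ Y := by
    by_cases hrW : r ∈ W
    · exact ⟨r, hrW, vio_r X₁ hX₁, fun Y hY => hY.1⟩
    have hWg : gt W := by
      rcases hWcase with hW | hW
      · exact hW
      · exact absurd (hW ▸ Finset.mem_univ r) hrW
    by_contra hcon
    push Not at hcon
    have hftW : ∀ Y, ft Y → (Y ∩ W).Nonempty → Y ⊆ W := by
      intro Y hY hne
      refine hYW Y hY.1 hY.2.1 hne fun hne' => ?_
      rcases hY.2.2 with hk | ⟨hYL, hk⟩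
      · rw [hk]; exact hf _ hne' fun hh => hY.1 (Finset.mem_sdiff.mp hh).1
      · rw [hk]; exact hL _ (Finset.sdiff_subset.trans hYL) hne'
    have hftX : ∀ Y, ft Y → Y ⊆ W → (Y ∩ X₁).Nonempty → Y ⊆ X₁ := by
      intro Y hY hYW' hne
      have h1 := h.submod_left Y X₁
      have h2 := hX₁.2.2
      have hrU : r ∉ Y ∪ X₁ := by
        intro hh
        rcases Finset.mem_union.mp hh with hh | hh
        exacts [hY.1 hh, vio_r X₁ hX₁ hh]
      have h3 := hf (Y ∪ X₁) (hne.mono (Finset.inter_subset_left.trans Finset.subset_union_left)) hrU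
      have hsub : Y ∩ X₁ ⊆ insert v L := Finset.inter_subset_right.trans hX₁.2.1
      have h4 : K ≤ f (Y ∩ X₁) := by
        by_cases hv : v ∈ Y ∩ X₁
        · by_contra hlt
          have h5 := hf _ hne fun hh => hY.1 (Finset.mem_inter.mp hh).1
          have := hX₀le (Y ∩ X₁) ⟨hv, hsub, by omega⟩ hs
          exact hY.2.1 (Finset.mem_inter.mp this).1
        · exact hL _ (hsplit _ hsub hv) hne
      rcases hY.2.2 with hk | ⟨hYL, hk⟩
      · omega
      · have : vio (Y ∪ X₁) := ⟨Finset.mem_union_right _ hX₁.1,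
          Finset.union_subset (hYL.trans (Finset.subset_insert _ _)) hX₁.2.1, by omega⟩
        exact Finset.subset_union_left.trans
          (hX₁le _ this (Finset.union_subset hYW' hX₁W))
    have hftu : ∀ X Y, ft X → ft Y → (X ∩ Y).Nonempty → ft (X ∪ Y) := by
      intro X Y hX hY hne
      have h1 := h.submod_left X Y
      have hrI : r ∉ X ∩ Y := fun hh => hX.1 (Finset.mem_inter.mp hh).1
      have hrU : r ∉ X ∪ Y := by
        intro hh
        rcases Finset.mem_union.mp hh with hh | hh
        exacts [hX.1 hh, hY.1 hh]
      have hsU : s ∉ X ∪ Y := by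
        intro hh
        rcases Finset.mem_union.mp hh with hh | hh
        exacts [hX.2.1 hh, hY.2.1 hh]
      have hneU : (X ∪ Y).Nonempty :=
        hne.mono (Finset.inter_subset_left.trans Finset.subset_union_left)
      have h2 := hf _ hne hrI
      have h3 := hf _ hneU hrU
      refine ⟨hrU, hsU, ?_⟩
      rcases hX.2.2 with hk | ⟨hXL, hk⟩ <;> rcases hY.2.2 with hk' | ⟨hYL, hk'⟩
      · left; omega
      · have := hL _ (Finset.inter_subset_right.trans hYL) hne
        left; omega
      · have := hL _ (Finset.inter_subset_left.trans hXL) hne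
        left; omega
      · have h4 := hL _ (Finset.inter_subset_left.trans hXL) hne
        have h5 := hL _ (Finset.union_subset hXL hYL) hneU
        exact Or.inr ⟨Finset.union_subset hXL hYL, by omega⟩
    obtain ⟨Q, hQ, hdis, hsup⟩ := exists_partition_of_cover (τ := ft) hftu (W \ X₁) (by
      intro x hx
      rw [Finset.mem_sdiff] at hx
      obtain ⟨Y, hY, hxY⟩ := hcon x hx.1 hx.2
      have hYW' := hftW Y hY ⟨x, Finset.mem_inter.mpr ⟨hxY, hx.1⟩⟩
      refine ⟨Y, hY, fun y hy => Finset.mem_sdiff.mpr ⟨hYW' hy, fun hy' => ?_⟩, hxY⟩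
      exact hx.2 (hftX Y hY hYW' ⟨y, Finset.mem_inter.mpr ⟨hy, hy'⟩⟩ hxY))
    have hXnot : X₁ ∉ Q := by
      intro hXQ
      have : X₁ ⊆ W \ X₁ := hsup ▸ Finset.le_sup (f := id) hXQ
      exact (Finset.mem_sdiff.mp (this hX₁.1)).2 hX₁.1
    have hsup' : (insert X₁ Q).sup id = W := by
      rw [Finset.sup_insert, hsup, id, Finset.sup_eq_union, Finset.union_sdiff_of_subset hX₁W]
    have := h.sum_left (insert X₁ Q) (by
        intro X hX
        rcases Finset.mem_insert.mp hX with rfl | hX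
        · exact ⟨v, hX₁.1⟩
        · exact (hQ X hX).2) (by
        rw [Finset.coe_insert]
        refine hdis.insert fun Y hY _ => ?_
        refine Finset.disjoint_left.mpr fun x hx hx' => ?_
        have : Y ⊆ W \ X₁ := hsup ▸ Finset.le_sup (f := id) hY
        exact (Finset.mem_sdiff.mp (this hx')).2 hx) (Finset.insert_nonempty _ _)
        (by rw [hsup']; rintro rfl; exact hrW (Finset.mem_univ r))
    rw [hsup', Finset.sum_insert hXnot, Finset.card_insert_of_notMem hXnot, hX₁.2.2, hWg.2] at this
    have h2 : ∑ X ∈ Q, f X ≤ Q.card * K := by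
      rw [← smul_eq_mul, ← Finset.sum_const]
      refine Finset.sum_le_sum fun X hX => ?_
      rcases (hQ X hX).1.2.2 with hk | ⟨_, hk⟩ <;> omega
    nlinarith
  have hneY : ∀ {Y : Finset V} {x : V}, x ∈ Y → Y.Nonempty := fun hx => ⟨_, hx⟩
  refine ⟨s, t, ?_, ?_, ?_, ?_, X₀, hX₀, fun hh => htX₁ (hX₁le X₀ hX₀ hXW hh)⟩
  · intro Y hrY htY hsY
    have h1 := hf Y ⟨t, htY⟩ hrY
    have h2 : f Y ≠ k := fun hk => htf Y ⟨hrY, hsY, Or.inl hk⟩ htY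
    refine ⟨by omega, fun hYL => ?_⟩
    have h3 := hL Y hYL ⟨t, htY⟩
    have h4 : f Y ≠ K := fun hk => htf Y ⟨hrY, hsY, Or.inr ⟨hYL, hk⟩⟩ htY
    omega
  · intro Z hrZ hsZ' htZ
    have h1 := hg Z ⟨s, hsZ'⟩ hrZ
    have h2 : g Z ≠ b := fun hk => htZ (hWmin Z ⟨hrZ, hk⟩ hsZ' htW)
    omega
  · intro X hvX hXL htX hsX
    have hrX : r ∉ X := fun hh => hrL (hXL hh)
    have h1 := hf X ⟨t, htX⟩ hrX
    have h2 : f X ≠ k := fun hk => hsX (hX₀le X ⟨hvX, hXL, hk⟩ hs)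
    by_contra hlt
    have h3 : f X = K := by omega
    -- `X ∪ X₀` is deficient, and it leaves `W` because it contains `t ∉ X₁`
    have h4 := h.submod_left X X₀
    have hvI : v ∈ X ∩ X₀ := Finset.mem_inter.mpr ⟨hvX, hX₀.1⟩
    have hIr : r ∉ X ∩ X₀ := fun hh => hrX (Finset.mem_inter.mp hh).1
    have h5 := hf (X ∩ X₀) ⟨v, hvI⟩ hIr
    have h6 : f (X ∩ X₀) ≠ k := fun hk => hsX (Finset.mem_inter.mp
      (hX₀le _ ⟨hvI, Finset.inter_subset_right.trans hX₀.2.1, hk⟩ hs)).1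
    have hUs : X ∪ X₀ ⊆ insert v L := Finset.union_subset hXL hX₀.2.1
    have h7 := hf (X ∪ X₀) ⟨v, Finset.mem_union_left _ hvX⟩ fun hh => hrL (hUs hh)
    have h8 := hX₀.2.2
    have hvioU : vio (X ∪ X₀) := ⟨Finset.mem_union_left _ hvX, hUs, by omega⟩
    refine htX₁ (hX₁le _ hvioU (Finset.union_subset ?_ hXW) (Finset.mem_union_left _ htX))
    refine hYW X hrX hsX ⟨t, Finset.mem_inter.mpr ⟨htX, htW⟩⟩ fun hne' => ?_
    rw [h3]
    refine hL _ (hsplit _ (Finset.sdiff_subset.trans hXL) ?_) hne'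
    exact fun hh => (Finset.mem_sdiff.mp hh).2 (hXW hX₀.1)
  · exact fun X h1 h2 h3 => hX₀le X ⟨h1, h2, h3⟩ hs

end Uncrossing

end MultiHypergraph

namespace MultiHypergraph

/-! ### Cuts and safe reversals -/

section Cuts

set_option linter.unusedSectionVars false

variable {V E : Type*} [Fintype V] [DecidableEq V] [Fintype E] {H : MultiHypergraph V E}

namespace Orientation

/-- Every set that contains `B` and avoids `A` has in-degree at least `c`. -/
def CutGE (O : H.Orientation) (A B : Finset V) (c : ℕ) : Prop :=
  ∀ Y : Finset V, B ⊆ Y → Disjoint A Y → c ≤ O.inDegree Y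

theorem cutGE_zero (O : H.Orientation) (A B : Finset V) : O.CutGE A B 0 :=
  fun _ _ _ => Nat.zero_le _

/-- Reversing a hyperpath from `A` to `B` lowers the in-degree of every set separating `A` from
`B` by exactly one: this is why path reversals compute minimum cuts. -/
theorem Exchange.cutGE {O O' : H.Orientation} {s t : V} (h : O.Exchange O' s t) {A B : Finset V}
    (hs : s ∈ A) (ht : t ∈ B) (c : ℕ) : O.CutGE A B (c + 1) ↔ O'.CutGE A B c := by
  refine forall_congr' fun Y => forall_congr' fun hB => forall_congr' fun hA => ?_
  have h1 := h.inDegree Y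
  rw [if_pos (hB ht), if_neg (Finset.disjoint_left.mp hA hs)] at h1
  omega

/-- If no hyperpath leads from `A` to `B`, then the complement of a set `R` of reached vertices has
in-degree `0`. -/
theorem not_cutGE_of_closed (O : H.Orientation) {A B R : Finset V} (hA : A ⊆ R)
    (hB : Disjoint B R) (hR : ∀ e u, u ∈ H.edge e → u ∈ R → O.head e ∈ R) (c : ℕ) :
    ¬ O.CutGE A B (c + 1) := by
  intro h
  have h1 := h Rᶜ (fun x hx => Finset.mem_compl.mpr (Finset.disjoint_left.mp hB hx))
    (Finset.disjoint_left.mpr fun x hx hx' => Finset.mem_compl.mp hx' (hA hx))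
  have h2 : O.inDegree Rᶜ = 0 := by
    rw [inDegree, Finset.card_eq_zero, Finset.filter_eq_empty_iff]
    rintro e - ⟨h3, h4⟩
    obtain ⟨x, hx, hx'⟩ := Finset.not_subset.mp h4
    exact Finset.mem_compl.mp h3 (hR e x hx (by simpa using hx'))
  omega

theorem isHyperarcConnected_iff_cutGE (O : H.Orientation) (c : ℕ) :
    O.IsHyperarcConnected c ↔ ∀ s t, O.CutGE {s} {t} c := by
  rw [isHyperarcConnected_iff]
  constructor
  · intro h s t Y ht hs
    refine h Y ⟨t, ht (Finset.mem_singleton_self t)⟩ ?_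
    rintro rfl
    exact Finset.disjoint_left.mp hs (Finset.mem_singleton_self s) (Finset.mem_univ s)
  · intro h X ⟨t, ht⟩ hX
    obtain ⟨s, hs⟩ := (compl_nonempty_iff X).mpr hX
    exact h s t X (by simpa using ht) (by simpa using hs)

/-- A safe hyperarc with head in a proper subset `W` of in-degree `k` also has its tail in `W`. -/
theorem tight_of_isHyperarcConnected_setHead [DecidableEq E] {O : H.Orientation} {k : ℕ} {e : E}
    {u : V} {hu : u ∈ H.edge e} (h : (O.setHead e u hu).IsHyperarcConnected k) {W : Finset V}
    (hW' : W ≠ Finset.univ) (hWk : O.inDegree W = k)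
    (hW : O.head e ∈ W) : u ∈ W := by
  rw [isHyperarcConnected_iff] at h
  have h1 := h W ⟨_, hW⟩ hW'
  have h2 := (O.exchange_setHead e u hu).inDegree W
  rw [if_pos hW] at h2
  by_contra hn
  rw [if_neg hn] at h2
  omega

theorem Exchange.isHyperarcConnected {O O' : H.Orientation} {s t : V} {k : ℕ}
    (h : O.Exchange O' s t) (hO : O.IsHyperarcConnected k)
    (hst : ∀ W : Finset V, W ≠ Finset.univ → O.inDegree W = k → t ∈ W → s ∈ W) :
    O'.IsHyperarcConnected k := by
  rw [isHyperarcConnected_iff] at hO ⊢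
  intro X hX hX'
  have h1 := hO X hX hX'
  have h2 := h.inDegree X
  have h3 := hst X hX'
  by_cases ht : t ∈ X
  · by_cases hs : s ∈ X
    · simp only [ht, hs, if_true] at h2; omega
    · have : O.inDegree X ≠ k := fun hk => hs (h3 hk ht)
      simp only [ht, hs, if_true, if_false] at h2
      omega
  · simp only [ht, if_false] at h2
    omega

/-- Let `O` be `k`- and `O'` be `(k + 1)`-hyperarc-connected, with different head counts. A set
that contains all vertices with too few heads in `O` and is closed under the safe reorientations
contains a vertex with too many heads. The reason is that a minimal obstruction - a tight set
leaving `Y`, or the complement of a tight set meeting `Y` - can be uncrossed with the tight set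
that blocks a hyperarc leaving `Y` inside it. -/
theorem exists_mem_of_safe_closed [DecidableEq E] {O O' : H.Orientation} {k : ℕ}
    (hO : O.IsHyperarcConnected k) (hO' : O'.IsHyperarcConnected (k + 1))
    (hne : O.headDist O' ≠ 0) {Y : Finset V}
    (hS : ∀ v, O.headCount v < O'.headCount v → v ∈ Y)
    (hY : ∀ e u (hu : u ∈ H.edge e), u ∈ Y → (O.setHead e u hu).IsHyperarcConnected k →
      O.head e ∈ Y) :
    ∃ v ∈ Y, O'.headCount v < O.headCount v := by
  by_contra hT
  push Not at hT
  rw [isHyperarcConnected_iff] at hO hO'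
  have hcmp : ∀ X : Finset V, (∀ v ∈ X, O'.headCount v ≤ O.headCount v) →
      O'.inDegree X ≤ O.inDegree X := by
    intro X hX
    have h1 := O.inDegree_add X
    have h2 := O'.inDegree_add X
    have := Finset.sum_le_sum hX
    omega
  have hcmp' : ∀ X : Finset V, (∀ v ∈ X, O.headCount v ≤ O'.headCount v) →
      O'.outDegree X ≤ O.outDegree X := by
    intro X hX
    have h1 := O.inDegree_add Xᶜ
    have h2 := O'.inDegree_add Xᶜ
    have h3 := Finset.sum_le_sum hX
    have h4 := Finset.sum_add_sum_compl X O.headCount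
    have h5 := Finset.sum_add_sum_compl X O'.headCount
    rw [sum_headCount] at h4 h5
    rw [outDegree_eq, outDegree_eq]
    omega
  -- `tight W`: the sets whose in-degree is as small as possible
  set tight : Finset V → Prop := fun W => W.Nonempty ∧ W ≠ Finset.univ ∧ O.inDegree W = k
    with htight
  have huncross : ∀ X X', tight X → tight X' → (X ∩ X').Nonempty → X ∪ X' ≠ Finset.univ →
      tight (X ∩ X') ∧ tight (X ∪ X') := by
    intro X X' hX hX' hn hu
    have h1 := O.inDegree_submod X X'
    have hnu : X ∩ X' ≠ Finset.univ := fun hh =>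
      hX.2.1 (Finset.eq_univ_iff_forall.mpr fun x =>
        (Finset.mem_inter.mp (hh ▸ Finset.mem_univ x)).1)
    have h2 := hO _ hn hnu
    have hun := hn.mono (Finset.inter_subset_left.trans (Finset.subset_union_left (s₁ := X) (s₂ := X')))
    have h3 := hO _ hun hu
    have h4 := hX.2.2
    have h5 := hX'.2.2
    exact ⟨⟨hn, hnu, by omega⟩, hun, hu, by omega⟩
  have hblock : ∀ e u, u ∈ H.edge e → u ∈ Y → O.head e ∉ Y →
      ∃ W, tight W ∧ O.head e ∈ W ∧ u ∉ W := by
    intro e u hu huY heY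
    have : ¬ (O.setHead e u hu).IsHyperarcConnected k := fun h => heY (hY e u hu huY h)
    rw [isHyperarcConnected_iff] at this
    push Not at this
    obtain ⟨X, hX, hX', hlt⟩ := this
    have h1 := hO X hX hX'
    have h2 := (O.exchange_setHead e u hu).inDegree X
    have h3 : O.head e ∈ X := by
      by_contra hn
      rw [if_neg hn] at h2
      omega
    rw [if_pos h3] at h2
    have h4 : u ∉ X := by
      intro hn
      rw [if_pos hn] at h2
      omega
    rw [if_neg h4] at h2
    exact ⟨X, ⟨hX, hX', by omega⟩, h3, h4⟩
  -- no in-tight set leaves `Y`, and no complement of an in-tight set meets `Y`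
  have hW : ∀ W, ¬ ((tight W ∧ (W \ Y).Nonempty) ∨ (tight Wᶜ ∧ (W ∩ Y).Nonempty)) := by
    by_contra! hex
    obtain ⟨W, hW, hmin⟩ := exists_min_card hex
    have hlt : ∀ W' : Finset V, ((tight W' ∧ (W' \ Y).Nonempty) ∨
        (tight W'ᶜ ∧ (W' ∩ Y).Nonempty)) → W' ⊆ W → W ⊆ W' := by
      intro W' hW' hs
      exact (Finset.eq_of_subset_of_card_le hs (hmin W' hW')).ge
    rcases hW with ⟨hW, hne'⟩ | ⟨hW, hne'⟩
    · have h1 : O'.inDegree (W \ Y) ≤ O.inDegree (W \ Y) := hcmp _ fun v hv => by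
        by_contra hlt'
        exact (Finset.mem_sdiff.mp hv).2 (hS v (by omega))
      have h2 := hO' _ hne' fun hh => hW.2.1 (Finset.eq_univ_iff_forall.mpr fun x =>
        (Finset.mem_sdiff.mp (hh ▸ Finset.mem_univ x)).1)
      have h3 : O.inDegree W < O.inDegree (W \ Y) := by have := hW.2.2; omega
      obtain ⟨e, he, he'⟩ := Finset.exists_mem_notMem_of_card_lt_card h3
      simp only [Finset.mem_filter, Finset.mem_univ, true_and] at he he'
      obtain ⟨hh, hsub⟩ := he
      rw [Finset.mem_sdiff] at hh
      have heW : H.edge e ⊆ W := by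
        by_contra hc
        exact he' ⟨hh.1, hc⟩
      obtain ⟨u, hu, huY⟩ := Finset.not_subset.mp hsub
      have huW := heW hu
      have huY : u ∈ Y := by
        by_contra hc
        exact huY (Finset.mem_sdiff.mpr ⟨huW, hc⟩)
      obtain ⟨W', hW', hhW', huW'⟩ := hblock e u hu huY hh.2
      by_cases hun : W ∪ W' = Finset.univ
      · have : W'ᶜ ⊆ W := fun x hx => by
          have : x ∈ W ∪ W' := hun ▸ Finset.mem_univ x
          rcases Finset.mem_union.mp this with h | h
          · exact h
          · exact absurd h (Finset.mem_compl.mp hx)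
        have := hlt W'ᶜ (Or.inr ⟨by rwa [compl_compl], u, by simp [huW', huY]⟩) this hh.1
        exact Finset.mem_compl.mp this hhW'
      · have hI : O.head e ∈ W ∩ W' := Finset.mem_inter.mpr ⟨hh.1, hhW'⟩
        have := hlt (W ∩ W') (Or.inl ⟨(huncross W W' hW hW' ⟨_, hI⟩ hun).1, O.head e,
          Finset.mem_sdiff.mpr ⟨hI, hh.2⟩⟩) Finset.inter_subset_left huW
        exact huW' (Finset.mem_inter.mp this).2
    · have hWu : W ≠ Finset.univ := by
        rintro rfl
        have := hW.1
        simp at this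
      have h1 : O'.outDegree (W ∩ Y) ≤ O.outDegree (W ∩ Y) := hcmp' _ fun v hv =>
        hT v (Finset.mem_inter.mp hv).2
      have h2 : k + 1 ≤ O'.outDegree (W ∩ Y) := by
        rw [outDegree_eq]
        refine hO' _ ?_ ?_
        · rw [compl_nonempty_iff]
          exact fun hh => hWu (Finset.eq_univ_iff_forall.mpr fun x =>
            (Finset.mem_inter.mp (hh ▸ Finset.mem_univ x)).1)
        · intro hh
          rw [Finset.compl_eq_univ_iff] at hh
          exact hne'.ne_empty hh
      have h3 : O.outDegree W < O.outDegree (W ∩ Y) := by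
        have := hW.2.2; rw [← outDegree_eq] at this; omega
      obtain ⟨e, he, he'⟩ := Finset.exists_mem_notMem_of_card_lt_card h3
      simp only [Finset.mem_filter, Finset.mem_univ, true_and] at he he'
      obtain ⟨hh, u, hu⟩ := he
      simp only [Finset.mem_inter, tail, Finset.mem_erase] at hu
      obtain ⟨⟨huW, huY⟩, hune, hue⟩ := hu
      have hhW : O.head e ∈ W := by
        by_contra hc
        exact he' ⟨hc, u, by simp [tail, huW, hune, hue]⟩
      have hhY : O.head e ∉ Y := fun hc => hh (Finset.mem_inter.mpr ⟨hhW, hc⟩)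
      obtain ⟨W', hW', hhW', huW'⟩ := hblock e u hue huY hhY
      by_cases hun : W ∪ W'ᶜ = Finset.univ
      · have : W' ⊆ W := fun x hx => by
          have : x ∈ W ∪ W'ᶜ := hun ▸ Finset.mem_univ x
          rcases Finset.mem_union.mp this with h | h
          · exact h
          · exact absurd hx (Finset.mem_compl.mp h)
        have := hlt W' (Or.inl ⟨hW', O.head e, Finset.mem_sdiff.mpr ⟨hhW', hhY⟩⟩) this huW
        exact huW' this
      · have hI : u ∈ W ∩ W'ᶜ := Finset.mem_inter.mpr ⟨huW, Finset.mem_compl.mpr huW'⟩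
        have hc1 : (Wᶜ ∩ W').Nonempty := by
          obtain ⟨x, hx⟩ := (compl_nonempty_iff _).mpr hun
          exact ⟨x, by simpa [Finset.mem_inter] using hx⟩
        have hc2 : Wᶜ ∪ W' ≠ Finset.univ := by
          rw [← compl_nonempty_iff]
          exact ⟨u, by simp [huW, huW']⟩
        have := hlt (W ∩ W'ᶜ) (Or.inr ⟨by
            have := (huncross Wᶜ W' hW hW' hc1 hc2).2
            rwa [Finset.compl_inter, compl_compl], u, Finset.mem_inter.mpr ⟨hI, huY⟩⟩)
          Finset.inter_subset_left hhW
        exact Finset.mem_compl.mp (Finset.mem_inter.mp this).2 hhW'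
  have hsum : ∑ v, O.headCount v = ∑ v, O'.headCount v := by rw [sum_headCount, sum_headCount]
  have hex1 : ∃ v, O'.headCount v < O.headCount v := by
    by_contra! hc
    exact hne (Finset.sum_eq_zero fun v _ => by have := hc v; omega)
  have hex2 : ∃ v, O.headCount v < O'.headCount v := by
    by_contra! hc
    have := (Finset.sum_eq_sum_iff_of_le (fun v (_ : v ∈ Finset.univ) => hc v)).mp hsum.symm
    obtain ⟨v, hv⟩ := hex1
    have := this v (Finset.mem_univ v)
    omega
  obtain ⟨t, ht⟩ := hex1
  obtain ⟨s, hs⟩ := hex2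
  have htY : t ∉ Y := fun h => absurd (hT t h) (by omega)
  have hout : k + 1 ≤ O.outDegree Y := by
    refine le_trans ?_ (hcmp' Y hT)
    rw [outDegree_eq]
    refine hO' _ ⟨t, Finset.mem_compl.mpr htY⟩ fun hh => ?_
    rw [Finset.compl_eq_univ_iff] at hh
    exact absurd (hS s hs) (by simp [hh])
  obtain ⟨e, he⟩ : (Finset.univ.filter fun e : E => O.head e ∉ Y ∧ (Y ∩ O.tail e).Nonempty).Nonempty :=
    Finset.card_pos.mp (by unfold outDegree at hout; omega)
  simp only [Finset.mem_filter, Finset.mem_univ, true_and] at he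
  obtain ⟨hh, u, hu⟩ := he
  simp only [Finset.mem_inter, tail, Finset.mem_erase] at hu
  obtain ⟨W', hW', hhW', -⟩ := hblock e u hu.2.2 hu.1 hh
  exact hW W' (Or.inl ⟨hW', O.head e, Finset.mem_sdiff.mpr ⟨hhW', hh⟩⟩)

end Orientation

end Cuts

end MultiHypergraph

namespace MultiHypergraph

/-! ### The score of an orientation -/

section Score

variable {n : ℕ}

/-- All sets `Y ∌ x` of positive vertices with maximum `v` satisfy `f Y ≥ K`. -/
def LowTest (f : Finset (Fin n) → ℕ) (K v x : ℕ) : Prop :=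
  ∀ Y : Finset (Fin n), (∃ y ∈ Y, (y : ℕ) = v) →
    (∀ y ∈ Y, 0 < (y : ℕ) ∧ (y : ℕ) ≤ v ∧ (y : ℕ) ≠ x) → K ≤ f Y

open Classical in
/-- The number of `x < v` that pass the test `LowTest`. All of them do if and only if no set of
positive vertices with maximum `v` is deficient, because `x = 0` excludes no set; otherwise those
counted are the elements other than `v` common to all deficient sets. -/
noncomputable def lowCount (f : Finset (Fin n) → ℕ) (K v : ℕ) : ℕ :=
  ((Finset.range v).filter fun x => LowTest f K v x).card

/-- The sum of the values `φ v` up to the first `v` with `φ v ≠ v`. -/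
def stageScore (φ : ℕ → ℕ) (N : ℕ) : ℕ :=
  ∑ v ∈ Finset.range N, if ∀ w < v, φ w = w then φ v else 0

open Classical in
/-- A measure of progress from `k`- to `(k + 1)`-hyperarc-connectivity: first the in-degrees of the
sets avoiding the vertex `0` are raised, in the order of their maxima, and then the out-degrees. -/
noncomputable def score {m : ℕ} {H : MultiHypergraph (Fin n) (Fin m)} (O : H.Orientation)
    (k : ℕ) : ℕ :=
  if O.IsHyperarcConnected k then
    1 + stageScore (lowCount O.inDegree (k + 1)) n +
      if ∀ w < n, lowCount O.inDegree (k + 1) w = w then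
        stageScore (lowCount O.outDegree (k + 1)) n else 0
  else 0

theorem lowCount_le (f : Finset (Fin n) → ℕ) (K v : ℕ) : lowCount f K v ≤ v := by
  classical
  unfold lowCount
  exact (Finset.card_filter_le _ _).trans (by simp)

theorem lowCount_eq_iff (f : Finset (Fin n) → ℕ) (K v : ℕ) :
    lowCount f K v = v ↔ ∀ x < v, LowTest f K v x := by
  classical
  unfold lowCount
  constructor
  · intro h x hx
    have := Finset.eq_of_subset_of_card_le (Finset.filter_subset (LowTest f K v) (Finset.range v))
      (by rw [Finset.card_range]; convert h.ge)
    exact (Finset.mem_filter.mp (this ▸ Finset.mem_range.mpr hx)).2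
  · intro h
    rw [Finset.filter_true_of_mem fun x hx => h x (Finset.mem_range.mp hx), Finset.card_range]

theorem lowCount_full_iff (f : Finset (Fin n) → ℕ) (K v : ℕ) :
    (∀ w < v, lowCount f K w = w) ↔ ∀ X : Finset (Fin n), X.Nonempty →
      (∀ y ∈ X, 0 < (y : ℕ) ∧ (y : ℕ) < v) → K ≤ f X := by
  constructor
  · intro h X hX hXv
    obtain ⟨y, hy, hmax⟩ := Finset.exists_max_image X (fun y => (y : ℕ)) hX
    have h1 := (lowCount_eq_iff f K y).mp (h y (hXv y hy).2) 0 (hXv y hy).1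
    exact h1 X ⟨y, hy, rfl⟩ fun z hz => ⟨(hXv z hz).1, hmax z hz, (hXv z hz).1.ne'⟩
  · intro h w hw
    rw [lowCount_eq_iff]
    rintro x hx Y ⟨y, hy, -⟩ hY
    exact h Y ⟨y, hy⟩ fun z hz => ⟨(hY z hz).1, (hY z hz).2.1.trans_lt hw⟩

theorem stageScore_lt {φ φ' : ℕ → ℕ} {v N : ℕ} (hv : v < N) (h : ∀ w < v, φ w = w)
    (hne : φ v ≠ v) (h' : ∀ w < v, φ' w = w) (hlt : φ v < φ' v) :
    stageScore φ N < stageScore φ' N := by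
  refine Finset.sum_lt_sum (fun i _ => ?_) ⟨v, Finset.mem_range.mpr hv, ?_⟩
  · rcases lt_trichotomy i v with hi | rfl | hi
    · rw [if_pos fun w hw => h w (hw.trans hi), if_pos fun w hw => h' w (hw.trans hi), h i hi, h' i hi]
    · rw [if_pos h, if_pos h']; exact hlt.le
    · rw [if_neg fun hc => hne (hc v hi)]; exact Nat.zero_le _
  · rw [if_pos h, if_pos h']; exact hlt

theorem stageScore_le {φ : ℕ → ℕ} (h : ∀ v, φ v ≤ v) (N : ℕ) :
    2 * stageScore φ N ≤ N * (N - 1) := by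
  rw [← Finset.sum_range_id_mul_two, mul_comm]
  refine Nat.mul_le_mul_right 2 (Finset.sum_le_sum fun v _ => ?_)
  split_ifs
  · exact h v
  · exact Nat.zero_le _

theorem score_le {m : ℕ} {H : MultiHypergraph (Fin n) (Fin m)} (O : H.Orientation) (k : ℕ) :
    score O k ≤ 1 + n * (n - 1) := by
  have h1 := stageScore_le (lowCount_le O.inDegree (k + 1)) n
  have h2 := stageScore_le (lowCount_le O.outDegree (k + 1)) n
  unfold score
  split_ifs <;> omega

/-- For the first `v` such that a set with maximum `v` is deficient, some exchange keeps the sets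
with smaller maxima from being deficient and increases the count at `v`. -/
theorem DegreePair.exists_lowCount_lt {f g : Finset (Fin n) → ℕ} {k b v : ℕ}
    (h : DegreePair f g (k + 1)) (hb : b ≤ k + 1) (r : Fin n) (hr : (r : ℕ) = 0)
    (hf : ∀ X : Finset (Fin n), X.Nonempty → r ∉ X → k ≤ f X)
    (hg : ∀ X : Finset (Fin n), X.Nonempty → r ∉ X → b ≤ g X)
    (hvn : v < n) (hlow : ∀ w < v, lowCount f (k + 1) w = w) (hv : lowCount f (k + 1) v ≠ v) :
    ∃ s t : Fin n, (∀ Y, r ∉ Y → t ∈ Y → s ∉ Y → k + 1 ≤ f Y) ∧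
      (∀ Z, r ∉ Z → s ∈ Z → t ∉ Z → b + 1 ≤ g Z) ∧
      ∀ f' : Finset (Fin n) → ℕ,
        (∀ X, f' X + (if t ∈ X then 1 else 0) = f X + (if s ∈ X then 1 else 0)) →
        (∀ w < v, lowCount f' (k + 1) w = w) ∧ lowCount f (k + 1) v < lowCount f' (k + 1) v := by
  classical
  have hv0 : 0 < v := by
    rcases Nat.eq_zero_or_pos v with rfl | h0
    · exact absurd (Nat.le_zero.mp (lowCount_le f (k + 1) 0)) hv
    · exact h0
  rw [lowCount_full_iff] at hlow
  set L : Finset (Fin n) := Finset.univ.filter fun y => 0 < (y : ℕ) ∧ (y : ℕ) < v with hL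
  set vF : Fin n := ⟨v, hvn⟩ with hvF
  have hins : ∀ Y : Finset (Fin n), Y ⊆ insert vF L ↔ ∀ y ∈ Y, 0 < (y : ℕ) ∧ (y : ℕ) ≤ v := by
    intro Y
    refine forall_congr' fun y => forall_congr' fun hy => ?_
    simp only [Finset.mem_insert, hL, Finset.mem_filter, Finset.mem_univ, true_and, hvF, Fin.ext_iff]
    omega
  have hr0 : ∀ y : Fin n, r = y ↔ (y : ℕ) = 0 := by
    intro y; rw [Fin.ext_iff, hr, eq_comm]
  have hviol : ∃ X, vF ∈ X ∧ X ⊆ insert vF L ∧ f X = k := by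
    rw [Ne, lowCount_eq_iff] at hv
    unfold LowTest at hv
    push Not at hv
    obtain ⟨x, hx, Y, ⟨y, hy, hyv⟩, hY, hlt⟩ := hv
    have hyF : y = vF := Fin.ext hyv
    have := hf Y ⟨y, hy⟩ fun hrY => by have := (hY r hrY).1; omega
    exact ⟨Y, hyF ▸ hy, (hins Y).mpr fun z hz => ⟨(hY z hz).1, (hY z hz).2.1⟩, by omega⟩
  obtain ⟨s, t, hA, hB, hC, hD, X₀, hX₀, htX₀⟩ := h.exists_exchange (r := r) (v := vF) (L := L)
    (k := k) (b := b) rfl hb hf hg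
    (fun X hX hne => hlow X hne fun y hy => by
      have := hX hy
      simpa [hL] using this)
    (by simp [hL, hr]) (by intro hh; rw [Fin.ext_iff, hr] at hh; simp only [hvF] at hh; omega) hviol
  have hvFv : (vF : ℕ) = v := rfl
  refine ⟨s, t, fun Y h1 h2 h3 => (hA Y h1 h2 h3).1, hB, fun f' hf' => ⟨?_, ?_⟩⟩
  · rw [lowCount_full_iff]
    intro X hX hXv
    have h1 := hlow X hX hXv
    have h2 := hf' X
    by_cases ht : t ∈ X
    · by_cases hs : s ∈ X
      · simp only [ht, hs, if_true] at h2; omega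
      · have := (hA X (fun hrX => by have := (hXv r hrX).1; omega) ht hs).2 (fun y hy => by
          simpa [hL] using hXv y hy)
        simp only [ht, hs, if_true, if_false] at h2
        omega
    · simp only [ht, if_false] at h2
      omega
  · -- the vertex `t`, or `0` if no set under consideration contains `t`, passes the test newly
    set x : ℕ := if (t : ℕ) < v then (t : ℕ) else 0 with hx
    have htv : (t : ℕ) ≠ v := fun hh => htX₀ ((Fin.ext hh : t = vF) ▸ hX₀.1)
    have hX₀' := (hins X₀).mp hX₀.2.1
    unfold lowCount
    refine Finset.card_lt_card (Finset.ssubset_iff_of_subset ?_ |>.mpr ⟨x, ?_, ?_⟩)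
    · intro z hz
      rw [Finset.mem_filter] at hz ⊢
      refine ⟨hz.1, fun Y hY1 hY2 => ?_⟩
      have h1 := hz.2 Y hY1 hY2
      have h2 := hf' Y
      obtain ⟨y, hy, hyv⟩ := hY1
      have hyF : y = vF := Fin.ext hyv
      by_cases ht : t ∈ Y
      · by_cases hs : s ∈ Y
        · simp only [ht, hs, if_true] at h2; omega
        · have := hC Y (hyF ▸ hy) ((hins Y).mpr fun z hz => ⟨(hY2 z hz).1, (hY2 z hz).2.1⟩) ht hs
          simp only [ht, hs, if_true, if_false] at h2
          omega
      · simp only [ht, if_false] at h2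
        omega
    · rw [Finset.mem_filter, Finset.mem_range]
      refine ⟨by rw [hx]; split_ifs <;> omega, ?_⟩
      rintro Y ⟨y, hy, hyv⟩ hY
      have hyF : y = vF := Fin.ext hyv
      have htY : t ∉ Y := by
        intro ht
        have := hY t ht
        rw [hx] at this
        split_ifs at this <;> omega
      have h2 := hf' Y
      have h3 := hf Y ⟨y, hy⟩ fun hrY => by have := (hY r hrY).1; omega
      rw [if_neg htY] at h2
      by_cases hk : f Y = k
      · have := hD Y (hyF ▸ hy) ((hins Y).mpr fun z hz => ⟨(hY z hz).1, (hY z hz).2.1⟩) hk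
        rw [if_pos this] at h2
        omega
      · omega
    · rw [Finset.mem_filter]
      rintro ⟨-, hT⟩
      have := hT X₀ ⟨vF, hX₀.1, rfl⟩ fun y hy => ⟨(hX₀' y hy).1, (hX₀' y hy).2, ?_⟩
      · have := hX₀.2.2; omega
      · rw [hx]
        split_ifs
        · intro hh
          exact htX₀ ((Fin.ext hh : y = t) ▸ hy)
        · exact (hX₀' y hy).1.ne'

end Score

section Improve

variable {n m : ℕ} {H : MultiHypergraph (Fin n) (Fin m)}

namespace Orientation

theorem isHyperarcConnected_iff_root (O : H.Orientation) (r : Fin n) (c : ℕ) :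
    O.IsHyperarcConnected c ↔ ∀ X : Finset (Fin n), X.Nonempty → r ∉ X →
      c ≤ O.inDegree X ∧ c ≤ O.outDegree X := by
  constructor
  · intro h X hX hr
    have hu : X ≠ Finset.univ := fun hh => hr (hh ▸ Finset.mem_univ r)
    exact ⟨(O.isHyperarcConnected_iff c).mp h X hX hu, h X hX hu⟩
  · intro h X hX hu
    by_cases hr : r ∈ X
    · have := (h Xᶜ ((compl_nonempty_iff X).mpr hu) (by simpa using hr)).1
      rwa [inDegree_eq, compl_compl] at this
    · exact (h X hX hr).2

theorem score_of_isHyperarcConnected {k : ℕ} {O : H.Orientation}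
    (hO : O.IsHyperarcConnected (k + 1)) : score O k = 1 + n * (n - 1) := by
  have hX : ∀ X : Finset (Fin n), X.Nonempty → (∀ y ∈ X, 0 < (y : ℕ) ∧ (y : ℕ) < n) →
      X ≠ Finset.univ := by
    rintro X ⟨x, hx⟩ h rfl
    exact lt_irrefl 0 (h ⟨0, x.pos⟩ (Finset.mem_univ _)).1
  have hin : ∀ w < n, lowCount O.inDegree (k + 1) w = w :=
    (lowCount_full_iff _ _ n).mpr fun X h1 h2 =>
      (O.isHyperarcConnected_iff _).mp hO X h1 (hX X h1 h2)
  have hout : ∀ w < n, lowCount O.outDegree (k + 1) w = w :=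
    (lowCount_full_iff _ _ n).mpr fun X h1 h2 => hO X h1 (hX X h1 h2)
  have key : ∀ φ : ℕ → ℕ, (∀ w < n, φ w = w) → stageScore φ n = ∑ v ∈ Finset.range n, v :=
    fun φ h => Finset.sum_congr rfl fun v hv => by
      have hv' := Finset.mem_range.mp hv
      rw [if_pos fun w hw => h w (hw.trans hv'), h v hv']
  have := Finset.sum_range_id_mul_two n
  have hk : O.IsHyperarcConnected k := fun X h1 h2 => (Nat.le_succ k).trans (hO X h1 h2)
  rw [score, if_pos hk, if_pos hin, key _ hin,
    key _ hout]
  omega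

/-- As long as the orientation is not `(k + 1)`-hyperarc-connected, reversing a suitable hyperpath
increases the score. -/
theorem exists_score_lt {k : ℕ} (hH : H.IsPartitionConnected (k + 1)) (hn : 0 < n)
    {O : H.Orientation} (hO : O.IsHyperarcConnected k) (hO' : ¬ O.IsHyperarcConnected (k + 1)) :
    ∃ s t : Fin n,
      (∀ R : Finset (Fin n), s ∈ R →
        (∀ e u, u ∈ H.edge e → u ∈ R → O.head e ∈ R) → t ∈ R) ∧
      ∀ O₁ : H.Orientation, O.Exchange O₁ s t → score O k < score O₁ k := by
  classical
  set r : Fin n := ⟨0, hn⟩ with hrdef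
  have hdp := O.degreePair hH
  have hb := (O.isHyperarcConnected_iff_root r k).mp hO
  have hr0 : (r : ℕ) = 0 := rfl
  have hpos : ∀ (X : Finset (Fin n)), r ∉ X → ∀ y ∈ X, 0 < (y : ℕ) ∧ (y : ℕ) < n := by
    intro X hr y hy
    refine ⟨Nat.pos_of_ne_zero fun h0 => hr ?_, y.2⟩
    rwa [show r = y from Fin.ext h0.symm]
  have hclosed : ∀ R : Finset (Fin n), (∀ e u, u ∈ H.edge e → u ∈ R → O.head e ∈ R) →
      O.inDegree Rᶜ = 0 := by
    intro R hR
    rw [Orientation.inDegree, Finset.card_eq_zero, Finset.filter_eq_empty_iff]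
    rintro e - ⟨h3, h4⟩
    obtain ⟨x, hx, hx'⟩ := Finset.not_subset.mp h4
    exact Finset.mem_compl.mp h3 (hR e x hx (by simpa using hx'))
  by_cases hfull : ∀ w < n, lowCount O.inDegree (k + 1) w = w
  · have hin : ∀ X : Finset (Fin n), X.Nonempty → r ∉ X → k + 1 ≤ O.inDegree X :=
      fun X hX hr => (lowCount_full_iff _ _ n).mp hfull X hX (hpos X hr)
    have hex : ∃ v, v < n ∧ lowCount O.outDegree (k + 1) v ≠ v := by
      by_contra! hc
      refine hO' ((O.isHyperarcConnected_iff_root r _).mpr fun X hX hr => ⟨hin X hX hr, ?_⟩)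
      exact (lowCount_full_iff _ _ n).mp hc X hX (hpos X hr)
    obtain ⟨v, ⟨hvn, hv⟩, hmin⟩ : ∃ v, (v < n ∧ lowCount O.outDegree (k + 1) v ≠ v) ∧
        ∀ w < v, ¬ (w < n ∧ lowCount O.outDegree (k + 1) w ≠ w) :=
      ⟨Nat.find hex, Nat.find_spec hex, fun w hw => Nat.find_min hex hw⟩
    have hlow : ∀ w < v, lowCount O.outDegree (k + 1) w = w := by
      intro w hw
      by_contra hc
      exact hmin w hw ⟨hw.trans hvn, hc⟩
    obtain ⟨t, s, hA, hB, hC⟩ := hdp.symm.exists_lowCount_lt (b := k + 1) le_rfl r hr0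
      (fun X hX hr => (hb X hX hr).2) hin hvn hlow hv
    refine ⟨s, t, fun R hs hR => ?_, fun O₁ hex₁ => ?_⟩
    · by_contra ht
      have h0 := hclosed R hR
      by_cases hrR : r ∈ Rᶜ
      · have := hA R (by simpa using hrR) hs ht
        rw [outDegree_eq] at this
        omega
      · have := hB Rᶜ hrR (by simpa using ht) (by simpa using hs)
        omega
    · have hd := hex₁.outDegree
      have hd' := hex₁.inDegree
      obtain ⟨hC1, hC2⟩ := hC O₁.outDegree hd
      have hin₁ : ∀ X : Finset (Fin n), X.Nonempty → r ∉ X → k + 1 ≤ O₁.inDegree X := by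
        intro X hX hr
        have h1 := hin X hX hr
        have h2 := hd' X
        have h3 := hB X hr
        by_cases ht : t ∈ X <;> by_cases hs : s ∈ X <;>
          simp only [ht, hs, if_true, if_false] at h2 <;> simp only [ht, hs, not_true,
            not_false_eq_true, forall_true_left] at h3 <;> omega
      have hk₁ : O₁.IsHyperarcConnected k := by
        rw [O₁.isHyperarcConnected_iff_root r]
        intro X hX hr
        refine ⟨by have := hin₁ X hX hr; omega, ?_⟩
        have h1 := (hb X hX hr).2
        have h2 := hd X
        have h3 := hA X hr
        by_cases ht : t ∈ X <;> by_cases hs : s ∈ X <;>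
          simp only [ht, hs, if_true, if_false] at h2 <;> simp only [ht, hs, not_true,
            not_false_eq_true, forall_true_left] at h3 <;> omega
      have hfull₁ : ∀ w < n, lowCount O₁.inDegree (k + 1) w = w :=
        (lowCount_full_iff _ _ n).mpr fun X hX hXn => hin₁ X hX fun hr => by
          have := (hXn r hr).1; omega
      have hss : stageScore (lowCount O.inDegree (k + 1)) n
          = stageScore (lowCount O₁.inDegree (k + 1)) n := by
        refine Finset.sum_congr rfl fun v hv => ?_
        have hvn' := Finset.mem_range.mp hv
        rw [if_pos fun w hw => hfull w (hw.trans hvn'), if_pos fun w hw => hfull₁ w (hw.trans hvn'),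
          hfull v hvn', hfull₁ v hvn']
      have := stageScore_lt hvn hlow hv hC1 hC2
      rw [score, score, if_pos hO, if_pos hk₁, if_pos hfull, if_pos hfull₁, hss]
      omega
  · have hex : ∃ v, v < n ∧ lowCount O.inDegree (k + 1) v ≠ v := by
      push Not at hfull
      exact hfull
    obtain ⟨v, ⟨hvn, hv⟩, hmin⟩ : ∃ v, (v < n ∧ lowCount O.inDegree (k + 1) v ≠ v) ∧
        ∀ w < v, ¬ (w < n ∧ lowCount O.inDegree (k + 1) w ≠ w) :=
      ⟨Nat.find hex, Nat.find_spec hex, fun w hw => Nat.find_min hex hw⟩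
    have hlow : ∀ w < v, lowCount O.inDegree (k + 1) w = w := by
      intro w hw
      by_contra hc
      exact hmin w hw ⟨hw.trans hvn, hc⟩
    obtain ⟨s, t, hA, hB, hC⟩ := hdp.exists_lowCount_lt (b := k) (Nat.le_succ k) r hr0
      (fun X hX hr => (hb X hX hr).1) (fun X hX hr => (hb X hX hr).2) hvn hlow hv
    refine ⟨s, t, fun R hs hR => ?_, fun O₁ hex₁ => ?_⟩
    · by_contra ht
      have h0 := hclosed R hR
      by_cases hrR : r ∈ Rᶜ
      · have := hB R (by simpa using hrR) hs ht
        rw [outDegree_eq] at this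
        omega
      · have := hA Rᶜ hrR (by simpa using ht) (by simpa using hs)
        omega
    · have hd := hex₁.outDegree
      have hd' := hex₁.inDegree
      obtain ⟨hC1, hC2⟩ := hC O₁.inDegree hd'
      have hk₁ : O₁.IsHyperarcConnected k := by
        rw [O₁.isHyperarcConnected_iff_root r]
        intro X hX hr
        have h1 := hb X hX hr
        have h2 := hd X
        have h2' := hd' X
        have h3 := hA X hr
        have h4 := hB X hr
        by_cases ht : t ∈ X <;> by_cases hs : s ∈ X <;>
          simp only [ht, hs, if_true, if_false] at h2 h2' <;> simp only [ht, hs, not_true,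
            not_false_eq_true, forall_true_left] at h3 h4 <;> omega
      have := stageScore_lt hvn hlow hv hC1 hC2
      rw [score, score, if_pos hO, if_pos hk₁, if_neg hfull]
      omega

end Orientation

end Improve

end MultiHypergraph

namespace RAM

/-! ### Programs with bounded loops -/

/-- Programs whose only loops are `for i < x`, where the loop variable starts at `0`, is
incremented after each round, and the bound `x` is a variable. -/
inductive Code where
  | skip
  | assign (x : ℕ) (u : Expr)
  | put (a : ℕ) (i u : Expr)
  | seq (p q : Code)
  | ite (u : Expr) (p q : Code)
  | rep (i x : ℕ) (p : Code)

namespace Code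

/-- Iterates `step` for `b` rounds, with the loop variable `i` incremented after every round. -/
def iterate (i : ℕ) (step : Store → Store) : ℕ → Store → Store
  | 0, s => s
  | b + 1, s => iterate i step b ((step s).setVar i ((step s).var i + 1))

/-- The store after the execution of a bounded program. -/
def exec : Code → Store → Store
  | skip, s => s
  | assign x u, s => s.setVar x (u.eval s)
  | put a i u, s => s.setArr a (i.eval s) (u.eval s)
  | seq p q, s => q.exec (p.exec s)
  | ite u p q, s => if u.eval s ≠ 0 then p.exec s else q.exec s
  | rep i x p, s => iterate i p.exec (s.var x) (s.setVar i 0)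

theorem exec_ite_pos {u : Expr} {p q : Code} {s : Store} (h : u.eval s ≠ 0) :
    (ite u p q).exec s = p.exec s := if_pos h

theorem exec_ite_neg {u : Expr} {p q : Code} {s : Store} (h : ¬ u.eval s ≠ 0) :
    (ite u p q).exec s = q.exec s := if_neg h

/-- The program with its bounded loops replaced by while-loops. -/
def compile : Code → Program
  | skip => .skip
  | assign x u => .assign x u
  | put a i u => .put a i u
  | seq p q => .seq p.compile q.compile
  | ite u p q => .cond u p.compile q.compile
  | rep i x p => .seq (.assign i (.const 0)) (.loop (.sub (.var x) (.var i))
      (.seq p.compile (.assign i (.add (.var i) (.const 1)))))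

/-- Whether the program may write the variable `y`. -/
def writesVar (y : ℕ) : Code → Bool
  | skip => false
  | assign x _ => x == y
  | put _ _ _ => false
  | seq p q => p.writesVar y || q.writesVar y
  | ite _ p q => p.writesVar y || q.writesVar y
  | rep i _ p => i == y || p.writesVar y

/-- Whether the program may write the array `b`. -/
def writesArr (b : ℕ) : Code → Bool
  | skip => false
  | assign _ _ => false
  | put a _ _ => a == b
  | seq p q => p.writesArr b || q.writesArr b
  | ite _ p q => p.writesArr b || q.writesArr b
  | rep _ _ p => p.writesArr b

/-- The loop bounds are among the variables `0, 1, 2`, and these are never written; the body of a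
loop does not write the loop variable. -/
def wf : Code → Bool
  | skip => true
  | assign x _ => 3 ≤ x
  | put _ _ _ => true
  | seq p q => p.wf && q.wf
  | ite _ p q => p.wf && q.wf
  | rep i x p => x < 3 && 3 ≤ i && !p.writesVar i && p.wf

/-- A bound on the number of steps, as a polynomial in a bound on the variables `0, 1, 2`. -/
noncomputable def time : Code → Polynomial ℕ
  | skip => 1
  | assign _ u => (u.cost + 1 : ℕ)
  | put _ i u => (i.cost + u.cost + 1 : ℕ)
  | seq p q => p.time + q.time
  | ite u p q => (u.cost + 1 : ℕ) + (p.time + q.time)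
  | rep _ _ p => 6 + Polynomial.X * (p.time + 8)

/-- The variables and arrays that a program may not write are unchanged. -/
def Frame (p : Code) (s s' : Store) : Prop :=
  (∀ y, p.writesVar y = false → s'.var y = s.var y) ∧
  (∀ b, p.writesArr b = false → s'.arr b = s.arr b)

end Code

section Store

variable (s : Store) (x y a b i j v : ℕ)

@[simp] theorem Store.setVar_var : (s.setVar x v).var y = if y = x then v else s.var y := by
  simp [Store.setVar, Function.update_apply]

@[simp] theorem Store.setVar_arr : (s.setVar x v).arr = s.arr := rfl

@[simp] theorem Store.setArr_var : (s.setArr a i v).var = s.var := rfl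

theorem Store.setArr_arr_of_ne (h : b ≠ a) : (s.setArr a i v).arr b = s.arr b := by
  simp [Store.setArr, h]

@[simp] theorem Store.setArr_arr :
    (s.setArr a i v).arr b j = if b = a ∧ j = i then v else s.arr b j := by
  by_cases h1 : b = a
  · subst h1
    simp [Store.setArr, Function.update_apply]
  · simp [Store.setArr, h1]

end Store

namespace Code

theorem frame_iterate {i : ℕ} {p : Code} (hp : ∀ s, p.Frame s (p.exec s)) (b : ℕ) :
    ∀ s, (rep i 0 p).Frame s (iterate i p.exec b s) := by
  induction b with
  | zero => exact fun s => ⟨fun _ _ => rfl, fun _ _ => rfl⟩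
  | succ b ih =>
    intro s
    have h1 := ih ((p.exec s).setVar i ((p.exec s).var i + 1))
    have h2 := hp s
    refine ⟨fun y hy => ?_, fun a ha => ?_⟩
    · have h3 := hy
      simp only [writesVar, Bool.or_eq_false_iff, beq_eq_false_iff_ne] at h3
      rw [iterate, h1.1 y hy, Store.setVar_var, if_neg (Ne.symm h3.1), h2.1 y h3.2]
    · have h3 := ha
      simp only [writesArr] at h3
      rw [iterate, h1.2 a ha, Store.setVar_arr, h2.2 a h3]

theorem frame_exec (p : Code) : ∀ s, p.Frame s (p.exec s) := by
  induction p with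
  | skip => exact fun s => ⟨fun _ _ => rfl, fun _ _ => rfl⟩
  | assign x u =>
    refine fun s => ⟨fun y hy => ?_, fun a _ => rfl⟩
    simp only [writesVar, beq_eq_false_iff_ne] at hy
    rw [exec, Store.setVar_var, if_neg (Ne.symm hy)]
  | put a i u =>
    refine fun s => ⟨fun y _ => rfl, fun b hb => ?_⟩
    simp only [writesArr, beq_eq_false_iff_ne] at hb
    exact Store.setArr_arr_of_ne _ _ _ _ _ (Ne.symm hb)
  | seq p q hp hq =>
    refine fun s => ⟨fun y hy => ?_, fun b hb => ?_⟩
    · simp only [writesVar, Bool.or_eq_false_iff] at hy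
      rw [exec, (hq _).1 y hy.2, (hp s).1 y hy.1]
    · simp only [writesArr, Bool.or_eq_false_iff] at hb
      rw [exec, (hq _).2 b hb.2, (hp s).2 b hb.1]
  | ite u p q hp hq =>
    refine fun s => ⟨fun y hy => ?_, fun b hb => ?_⟩
    · simp only [writesVar, Bool.or_eq_false_iff] at hy
      rw [exec]
      split_ifs
      exacts [(hp s).1 y hy.1, (hq s).1 y hy.2]
    · simp only [writesArr, Bool.or_eq_false_iff] at hb
      rw [exec]
      split_ifs
      exacts [(hp s).2 b hb.1, (hq s).2 b hb.2]
  | rep i x p hp =>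
    refine fun s => ⟨fun y hy => ?_, fun b hb => ?_⟩
    · rw [exec, (frame_iterate hp _ _).1 y hy]
      simp only [writesVar, Bool.or_eq_false_iff, beq_eq_false_iff_ne] at hy
      rw [Store.setVar_var, if_neg (Ne.symm hy.1)]
    · rw [exec, (frame_iterate hp _ _).2 b hb]
      rfl

theorem writesVar_of_wf {p : Code} (hp : p.wf = true) {y : ℕ} (hy : y < 3) :
    p.writesVar y = false := by
  induction p with
  | skip => rfl
  | assign x u =>
    simp only [wf, decide_eq_true_eq] at hp
    simp only [writesVar, beq_eq_false_iff_ne]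
    omega
  | put a i u => rfl
  | seq p q hp' hq' =>
    simp only [wf, Bool.and_eq_true] at hp
    simp [writesVar, hp' hp.1, hq' hp.2]
  | ite u p q hp' hq' =>
    simp only [wf, Bool.and_eq_true] at hp
    simp [writesVar, hp' hp.1, hq' hp.2]
  | rep i x p hp' =>
    simp only [wf, Bool.and_eq_true, decide_eq_true_eq] at hp
    simp only [writesVar, hp' hp.2, Bool.or_false, beq_eq_false_iff_ne]
    omega

/-- The compiled program halts in the store computed by `exec`, in polynomial time. -/
theorem runs_compile (p : Code) (hp : p.wf = true) (N : ℕ) :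
    ∀ s : Store, (∀ y < 3, s.var y ≤ N) →
      ∃ t, Runs p.compile s t (p.exec s) ∧ t ≤ p.time.eval N := by
  induction p with
  | skip => exact fun s _ => ⟨1, .skip s, by simp [time]⟩
  | assign x u => exact fun s _ => ⟨_, .assign s x u, by simp [time]⟩
  | put a i u => exact fun s _ => ⟨_, .put s a i u, by simp [time]⟩
  | seq p q hp' hq' =>
    intro s hs
    simp only [wf, Bool.and_eq_true] at hp
    obtain ⟨t, ht, htN⟩ := hp' hp.1 s hs
    obtain ⟨t', ht', htN'⟩ := hq' hp.2 (p.exec s) fun y hy => by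
      rw [(frame_exec p s).1 y (writesVar_of_wf hp.1 hy)]; exact hs y hy
    exact ⟨_, .seq ht ht', by rw [time, Polynomial.eval_add]; omega⟩
  | ite u p q hp' hq' =>
    intro s hs
    simp only [wf, Bool.and_eq_true] at hp
    by_cases hu : u.eval s = 0
    · obtain ⟨t', ht', htN'⟩ := hq' hp.2 s hs
      rw [exec, if_neg (not_not.mpr hu)]
      refine ⟨_, .cond_false hu ht', ?_⟩
      simp only [time, Polynomial.eval_add, Polynomial.eval_natCast]
      push_cast
      omega
    · obtain ⟨t, ht, htN⟩ := hp' hp.1 s hs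
      rw [exec, if_pos hu]
      refine ⟨_, .cond_true hu ht, ?_⟩
      simp only [time, Polynomial.eval_add, Polynomial.eval_natCast]
      push_cast
      omega
  | rep i x p hp' =>
    intro s hs
    simp only [wf, Bool.and_eq_true, decide_eq_true_eq, Bool.not_eq_true'] at hp
    obtain ⟨⟨⟨hx, hi⟩, hpi⟩, hpwf⟩ := hp
    have loop : ∀ b s', (∀ y < 3, s'.var y ≤ N) → s'.var x = s'.var i + b →
        ∃ t, Runs (.loop (.sub (.var x) (.var i))
          (.seq p.compile (.assign i (.add (.var i) (.const 1))))) s' t (iterate i p.exec b s') ∧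
          t ≤ 4 + b * (p.time.eval N + 8) := by
      intro b
      induction b with
      | zero =>
        intro s' _ hb
        exact ⟨_, .loop_false (by simp [Expr.eval, hb]), by simp [Expr.cost]⟩
      | succ b ih =>
        intro s' hs' hb
        obtain ⟨t, ht, htN⟩ := hp' hpwf s' hs'
        have hF := frame_exec p s'
        obtain ⟨t', ht', htN'⟩ := ih ((p.exec s').setVar i ((p.exec s').var i + 1))
          (fun y hy => by
            rw [Store.setVar_var, if_neg (by omega), hF.1 y (writesVar_of_wf hpwf hy)]
            exact hs' y hy)
          (by
            rw [Store.setVar_var, Store.setVar_var, if_neg (by omega), if_pos rfl,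
              hF.1 x (writesVar_of_wf hpwf hx), hF.1 i hpi]
            omega)
        refine ⟨_, .loop_true (by simp [Expr.eval, hb]) (.seq ht (.assign _ _ _)) ht', ?_⟩
        simp only [Expr.cost]
        nlinarith
    obtain ⟨t, ht, htN⟩ := loop (s.var x) (s.setVar i 0) (fun y hy => by
        rw [Store.setVar_var, if_neg (by omega)]; exact hs y hy) (by
        rw [Store.setVar_var, Store.setVar_var, if_neg (by omega), if_pos rfl, zero_add])
    refine ⟨_, .seq (.assign _ _ _) ht, ?_⟩
    simp only [time, Expr.cost, Polynomial.eval_add, Polynomial.eval_mul, Polynomial.eval_X,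
      Polynomial.eval_ofNat]
    have := Nat.mul_le_mul_right (p.time.eval N + 8) (hs x hx)
    omega

/-- The invariant rule for bounded loops: the invariant `I j` holds at the start of round `j`. -/
theorem exec_rep {i x : ℕ} {p : Code} (s : Store) (I : ℕ → Store → Prop)
    (hpi : p.writesVar i = false)
    (h0 : I 0 (s.setVar i 0))
    (hstep : ∀ j s', j < s.var x → s'.var i = j → (rep i x p).Frame s s' → I j s' →
      I (j + 1) ((p.exec s').setVar i (j + 1))) :
    I (s.var x) ((rep i x p).exec s) := by
  have key : ∀ b j s', j + b = s.var x → s'.var i = j → (rep i x p).Frame s s' → I j s' →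
      I (s.var x) (iterate i p.exec b s') := by
    intro b
    induction b with
    | zero => intro j s' hj _ _ hI; rw [add_zero] at hj; exact hj ▸ hI
    | succ b ih =>
      intro j s' hj hi hF hI
      have hFp := frame_exec p s'
      have hi' : (p.exec s').var i = j := by rw [hFp.1 i hpi, hi]
      rw [iterate, hi']
      refine ih (j + 1) _ (by omega) (by simp) ⟨fun y hy => ?_, fun a ha => ?_⟩
        (hstep j s' (by omega) hi hF hI)
      · have h3 := hy
        simp only [writesVar, Bool.or_eq_false_iff, beq_eq_false_iff_ne] at h3
        rw [Store.setVar_var, if_neg (Ne.symm h3.1), hFp.1 y h3.2, hF.1 y hy]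
      · have h3 := ha
        simp only [writesArr] at h3
        rw [Store.setVar_arr, hFp.2 a h3, hF.2 a ha]
  refine key (s.var x) 0 _ (zero_add _) (by simp) ⟨fun y hy => ?_, fun a _ => rfl⟩ h0
  simp only [writesVar, Bool.or_eq_false_iff, beq_eq_false_iff_ne] at hy
  rw [Store.setVar_var, if_neg (Ne.symm hy.1)]

end Code

end RAM

namespace RAM

open MultiHypergraph

/-! ### Searching for hyperpaths -/

infixr:60 " ;; " => Code.seq

/-- A test for `u ≠ v`. -/
def Expr.neq (u v : Expr) : Expr := .add (.sub u v) (.sub v u)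

section Context

variable {n m : ℕ} (H : MultiHypergraph (Fin n) (Fin m)) (k : ℕ)

/-- The part of the store that is never changed after the initialisation: the input, and the
multiples of `n` in the array `3`, which serve to address the incidence matrix. -/
structure Base (s : Store) : Prop where
  var0 : s.var 0 = n
  var1 : s.var 1 = m
  var2 : s.var 2 = k
  inc : ∀ (e : Fin m) (v : Fin n), s.arr 0 ((e : ℕ) * n + v) ≠ 0 ↔ v ∈ H.edge e
  off : ∀ e : Fin m, s.arr 3 e = (e : ℕ) * n

variable {H k}

theorem Base.of_frame {p : Code} {s s' : Store} (hs : Base H k s) (hF : p.Frame s s')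
    (hp : p.wf = true) (h0 : p.writesArr 0 = false) (h3 : p.writesArr 3 = false) :
    Base H k s' where
  var0 := by rw [hF.1 0 (Code.writesVar_of_wf hp (by norm_num))]; exact hs.var0
  var1 := by rw [hF.1 1 (Code.writesVar_of_wf hp (by norm_num))]; exact hs.var1
  var2 := by rw [hF.1 2 (Code.writesVar_of_wf hp (by norm_num))]; exact hs.var2
  inc e v := by rw [hF.2 0 h0]; exact hs.inc e v
  off e := by rw [hF.2 3 h3]; exact hs.off e

theorem Base.setVar {s : Store} (hs : Base H k s) {x v : ℕ} (hx : 3 ≤ x) :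
    Base H k (s.setVar x v) where
  var0 := by rw [Store.setVar_var, if_neg (by omega)]; exact hs.var0
  var1 := by rw [Store.setVar_var, if_neg (by omega)]; exact hs.var1
  var2 := by rw [Store.setVar_var, if_neg (by omega)]; exact hs.var2
  inc := hs.inc
  off := hs.off

/-- The array `a` holds the heads of `O`. -/
def HeadsAt (O : H.Orientation) (a : ℕ) (s : Store) : Prop := ∀ e : Fin m, s.arr a e = O.head e

/-- The set marked by the array `a`. -/
def marks (n : ℕ) (s : Store) (a : ℕ) : Finset (Fin n) :=
  Finset.univ.filter fun v : Fin n => s.arr a v ≠ 0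

theorem mem_marks {s : Store} {a : ℕ} {v : Fin n} : v ∈ marks n s a ↔ s.arr a v ≠ 0 := by
  simp [marks]

/-- `R` is closed under the steps from a tail vertex `u` of `e` with `ok e u` to the head. -/
def StepClosed (O : H.Orientation) (ok : Fin m → Fin n → Prop) (R : Finset (Fin n)) : Prop :=
  ∀ e u, ok e u → u ∈ R → O.head e ∈ R

/-- The array `w` marks, with time stamps, vertices reachable from `A`; the arrays `w + 1` and
`w + 2` hold the last hyperedge and its tail vertex on a path to such a vertex. -/
structure SearchTree (O : H.Orientation) (ok : Fin m → Fin n → Prop) (A : Finset (Fin n)) (w : ℕ)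
    (s : Store) : Prop where
  src : A ⊆ marks n s w
  pred : ∀ v ∈ marks n s w, v ∉ A → ∃ (e : Fin m) (u : Fin n), s.arr (w + 1) v = e ∧
    s.arr (w + 2) v = u ∧ O.head e = v ∧ ok e u ∧ u ∈ marks n s w ∧ s.arr w u < s.arr w v
  least : ∀ R, A ⊆ R → StepClosed O ok R → marks n s w ⊆ R

theorem SearchTree.congr {O : H.Orientation} {ok : Fin m → Fin n → Prop} {A : Finset (Fin n)}
    {w : ℕ} {s s' : Store} (h : SearchTree O ok A w s) (h0 : s'.arr w = s.arr w)
    (h1 : s'.arr (w + 1) = s.arr (w + 1)) (h2 : s'.arr (w + 2) = s.arr (w + 2)) :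
    SearchTree O ok A w s' := by
  have e : marks n s' w = marks n s w := by unfold marks; rw [h0]
  exact ⟨by rw [e]; exact h.src, by rw [e, h0, h1, h2]; exact h.pred, by rw [e]; exact h.least⟩

end Context

/-- The code of one search step: if the head of the hyperedge in variable `11` is new, and can be
reached from the vertex in variable `12`, mark it. -/
def searchStep (g ok w : ℕ) : Code :=
  .ite (.get w (.get g (.var 11))) .skip
    (.ite (.get w (.var 12))
      (.ite (.get ok (.add (.get 3 (.var 11)) (.var 12)))
        (.assign 13 (.add (.var 13) (.const 1)) ;;
          .put (w + 1) (.get g (.var 11)) (.var 11) ;;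
          .put (w + 2) (.get g (.var 11)) (.var 12) ;;
          .put w (.get g (.var 11)) (.var 13)) .skip) .skip)

/-- The code that searches from the set marked by the array `A`, along the hyperarcs with heads in
the array `g`, and through the tail vertices permitted by the table `ok`. -/
def search (g ok A w : ℕ) : Code :=
  .rep 32 0 (.ite (.get A (.var 32)) (.put w (.var 32) (.const 1)) (.put w (.var 32) (.const 0))) ;;
  .assign 13 (.const 1) ;;
  .rep 10 0 (.rep 11 1 (.rep 12 0 (searchStep g ok w)))

section Search

variable {n m : ℕ} {H : MultiHypergraph (Fin n) (Fin m)} {k : ℕ} {O : H.Orientation}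
  {ok : Fin m → Fin n → Prop} {g ko A w : ℕ}

/-- What the search reads but does not write. -/
structure SearchCtx (H : MultiHypergraph (Fin n) (Fin m)) (k : ℕ) (O : H.Orientation)
    (ok : Fin m → Fin n → Prop) (g ko A : ℕ) (S : Finset (Fin n)) (s : Store) : Prop where
  base : Base H k s
  heads : HeadsAt O g s
  okay : ∀ (e : Fin m) (v : Fin n), s.arr ko ((e : ℕ) * n + v) ≠ 0 ↔ ok e v
  srcs : marks n s A = S

theorem SearchCtx.of_frame {S : Finset (Fin n)} {p : Code} {s s' : Store}
    (hs : SearchCtx H k O ok g ko A S s) (hF : p.Frame s s') (hp : p.wf = true)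
    (h0 : p.writesArr 0 = false) (h3 : p.writesArr 3 = false)
    (hg : p.writesArr g = false) (hko : p.writesArr ko = false) (hA : p.writesArr A = false) :
    SearchCtx H k O ok g ko A S s' where
  base := hs.base.of_frame hF hp h0 h3
  heads e := by rw [hF.2 g hg]; exact hs.heads e
  okay e v := by rw [hF.2 ko hko]; exact hs.okay e v
  srcs := by unfold marks; rw [hF.2 A hA]; exact hs.srcs

theorem marks_setVar (s : Store) (x v a : ℕ) : marks n (s.setVar x v) a = marks n s a := rfl

/-- The time stamps are bounded by the clock in variable `13`. -/
def Clocked (n w : ℕ) (s : Store) : Prop := ∀ v : Fin n, s.arr w v ≤ s.var 13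

theorem exec_searchStep {S : Finset (Fin n)} {s : Store} (hg : g < w)
    (hs : SearchCtx H k O ok g ko A S s) (ht : SearchTree O ok S w s) (hc : Clocked n w s)
    {e : Fin m} {u : Fin n} (he : s.var 11 = e) (hu : s.var 12 = u) :
    SearchTree O ok S w ((searchStep g ko w).exec s) ∧ Clocked n w ((searchStep g ko w).exec s) ∧
    marks n s w ⊆ marks n ((searchStep g ko w).exec s) w ∧
    (ok e u → u ∈ marks n s w → O.head e ∈ marks n ((searchStep g ko w).exec s) w) := by
  have hhead : s.arr g e = O.head e := hs.heads e
  have hoff := hs.base.off e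
  simp only [searchStep, Code.exec, Expr.eval, he, hu, hhead, hoff]
  by_cases h1 : s.arr w (O.head e) ≠ 0
  · rw [if_pos h1]
    exact ⟨ht, hc, subset_rfl, fun _ _ => mem_marks.mpr h1⟩
  rw [if_neg h1]
  by_cases h2 : s.arr w u ≠ 0
  swap
  · rw [if_neg h2]
    exact ⟨ht, hc, subset_rfl, fun _ h => absurd (mem_marks.mp h) h2⟩
  rw [if_pos h2]
  by_cases h3 : s.arr ko ((e : ℕ) * n + u) ≠ 0
  swap
  · rw [if_neg h3]
    exact ⟨ht, hc, subset_rfl, fun h _ => absurd ((hs.okay e u).mpr h) h3⟩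
  rw [if_pos h3]
  have h3' := (hs.okay e u).mp h3
  have hgw : g ≠ w := by omega
  have hgw1 : g ≠ w + 1 := by omega
  have hgw2 : g ≠ w + 2 := by omega
  simp only [Store.setVar_var, Store.setVar_arr, Store.setArr_arr, Store.setArr_var, hgw1,
    hgw2, false_and, if_false, if_true, he, hu, hhead, show (11 : ℕ) ≠ 13 by norm_num,
    show (12 : ℕ) ≠ 13 by norm_num]
  set s' := (((s.setVar 13 (s.var 13 + 1)).setArr (w + 1) (O.head e) e).setArr (w + 2)
    (O.head e) u).setArr w (O.head e) (s.var 13 + 1) with hs'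
  have hw : ∀ v : Fin n, s'.arr w v = if v = O.head e then s.var 13 + 1 else s.arr w v := by
    intro v
    simp [hs', Fin.ext_iff]
  have hw1 : ∀ v : Fin n, s'.arr (w + 1) v = if v = O.head e then (e : ℕ) else s.arr (w + 1) v := by
    intro v
    simp [hs', Fin.ext_iff]
  have hw2 : ∀ v : Fin n, s'.arr (w + 2) v = if v = O.head e then (u : ℕ) else s.arr (w + 2) v := by
    intro v
    simp [hs', Fin.ext_iff]
  have h13 : s'.var 13 = s.var 13 + 1 := by simp [hs']
  have hm : ∀ v, v ∈ marks n s' w ↔ v = O.head e ∨ v ∈ marks n s w := by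
    intro v
    rw [mem_marks, mem_marks, hw]
    split_ifs with h <;> simp [h]
  have hhd : O.head e ∉ marks n s w := fun h => h1 (mem_marks.mp h)
  refine ⟨⟨fun v hv => (hm v).mpr (Or.inr (ht.src hv)), fun v hv hvS => ?_, fun R hR hR' v hv => ?_⟩,
    fun v => ?_, fun v hv => (hm v).mpr (Or.inr hv), fun _ _ => (hm _).mpr (Or.inl rfl)⟩
  · rw [hw, hw1, hw2]
    rcases (hm v).mp hv with rfl | hv'
    · refine ⟨e, u, by simp, by simp, rfl, h3', (hm u).mpr (Or.inr (mem_marks.mpr h2)), ?_⟩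
      rw [if_pos rfl, hw, if_neg (fun h => hhd (by rw [← h]; exact mem_marks.mpr h2))]
      exact Nat.lt_succ_of_le (hc u)
    · have hne : v ≠ O.head e := fun h => hhd (h ▸ hv')
      obtain ⟨e', u', a1, a2, a3, a4, a5, a6⟩ := ht.pred v hv' hvS
      refine ⟨e', u', by simpa [hne] using a1, by simpa [hne] using a2, a3, a4,
        (hm u').mpr (Or.inr a5), ?_⟩
      rw [if_neg hne, hw, if_neg (fun h => hhd (by rw [← h]; exact a5))]
      exact a6
  · rcases (hm v).mp hv with rfl | hv'
    · exact hR' e u h3' (ht.least R hR hR' (mem_marks.mpr h2))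
    · exact ht.least R hR hR' hv'
  · rw [hw, h13]
    split_ifs
    · exact le_rfl
    · exact (hc v).trans (Nat.le_succ _)

/-- The search marks exactly the vertices reachable from `S`: in each of its `n` rounds, the set of
marked vertices grows or is closed already. -/
theorem exec_search {S : Finset (Fin n)} {s : Store} (hg : g < w) (hko : ko < w) (hA : A < w)
    (hw : 3 < w) (hs : SearchCtx H k O ok g ko A S s) :
    SearchTree O ok S w ((search g ko A w).exec s) ∧
    StepClosed O ok (marks n ((search g ko A w).exec s) w) := by
  have ne : ∀ {a : ℕ}, a < w → (w == a) = false ∧ (w + 1 == a) = false ∧ (w + 2 == a) = false := by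
    intro a ha
    simp only [beq_eq_false_iff_ne]
    omega
  have n0 := ne (show 0 < w by omega)
  have n3 := ne hw
  have ng := ne hg
  have nk := ne hko
  have nA := ne hA
  -- initialisation
  set p1 : Code := .rep 32 0
    (.ite (.get A (.var 32)) (.put w (.var 32) (.const 1)) (.put w (.var 32) (.const 0))) with hp1
  set s1 := (p1.exec s).setVar 13 1 with hs1
  have hs1c : SearchCtx H k O ok g ko A S (p1.exec s) := by
    refine hs.of_frame (Code.frame_exec p1 s) rfl ?_ ?_ ?_ ?_ ?_ <;>
    simp [hp1, Code.writesArr, n0, n3, ng, nk, nA]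
  have hv1 : ∀ v : Fin n, (p1.exec s).arr w v = if v ∈ S then 1 else 0 := by
    have := Code.exec_rep (i := 32) (x := 0) s (fun j s' => ∀ v : Fin n, (v : ℕ) < j →
      s'.arr w v = if v ∈ S then 1 else 0) (p := .ite (.get A (.var 32)) (.put w (.var 32) (.const 1))
        (.put w (.var 32) (.const 0))) rfl (fun v hv => absurd hv (Nat.not_lt_zero _)) (by
      intro j s' hj hi hF hI v hv
      have hA' : s'.arr A = s.arr A := hF.2 A (by simp [Code.writesArr, nA])
      simp only [Code.exec, Expr.eval, hi, hA']
      have hS := hs.srcs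
      have hmem : v ∈ S ↔ s.arr A v ≠ 0 := by rw [← hS, mem_marks]
      rcases Nat.lt_succ_iff_lt_or_eq.mp hv with h | h
      · have := hI v h
        split_ifs <;> simp_all [Nat.ne_of_lt h]
      · subst h
        split_ifs <;> simp_all)
    intro v
    exact this v (by rw [hs.base.var0]; exact v.2)
  have hinit : SearchTree O ok S w s1 ∧ Clocked n w s1 := by
    have hm : marks n s1 w = S := by
      ext v
      rw [mem_marks, hs1, Store.setVar_arr, hv1]
      split_ifs with h <;> simp [h]
    refine ⟨⟨hm.ge, fun v hv hvS => absurd (hm ▸ hv) hvS, fun R hR _ => hm ▸ hR⟩, fun v => ?_⟩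
    rw [hs1, Store.setVar_arr, hv1]
    split_ifs <;> simp
  have hs1c' : SearchCtx H k O ok g ko A S s1 := ⟨hs1c.base.setVar (by norm_num), hs1c.heads,
    hs1c.okay, hs1c.srcs⟩
  have hex : (search g ko A w).exec s =
      (Code.rep 10 0 (.rep 11 1 (.rep 12 0 (searchStep g ko w)))).exec s1 := rfl
  rw [hex]
  have wA : ∀ a, a < w → (searchStep g ko w).writesArr a = false := by
    intro a ha
    simp [searchStep, Code.writesArr, ne ha]
  have ctx : ∀ {p : Code} {s s' : Store}, SearchCtx H k O ok g ko A S s → p.Frame s s' →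
      p.wf = true → (∀ a, a < w → p.writesArr a = false) → SearchCtx H k O ok g ko A S s' :=
    fun h hF hp hw' => h.of_frame hF hp (hw' 0 (by omega)) (hw' 3 hw) (hw' g hg) (hw' ko hko) (hw' A hA)
  -- the invariant of all loops
  set Inv : Finset (Fin n) → Store → Prop := fun R s => SearchTree O ok S w s ∧ Clocked n w s ∧
    R ⊆ marks n s w with hInv
  have inv_setVar : ∀ R s x v, x ≠ 13 → Inv R s → Inv R (s.setVar x v) := by
    rintro R s x v hx ⟨h1, h2, h3⟩
    refine ⟨h1.congr rfl rfl rfl, fun y => ?_, h3⟩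
    rw [Store.setVar_var, if_neg (Ne.symm hx)]
    exact h2 y
  have loop12 : ∀ R s (e : Fin m), SearchCtx H k O ok g ko A S s → s.var 11 = e → Inv R s →
      Inv R ((Code.rep 12 0 (searchStep g ko w)).exec s) ∧
      ∀ u ∈ R, ok e u → O.head e ∈ marks n ((Code.rep 12 0 (searchStep g ko w)).exec s) w := by
    intro R s e hsc he hI
    have := Code.exec_rep (i := 12) (x := 0) (p := searchStep g ko w) s (fun j s' => Inv R s' ∧
      ∀ u ∈ R, (u : ℕ) < j → ok e u → O.head e ∈ marks n s' w) rfl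
      ⟨inv_setVar _ _ _ _ (by norm_num) hI, fun u _ hu => absurd hu (Nat.not_lt_zero _)⟩ (by
      rintro j s' hj hi hF ⟨hI', hstep⟩
      rw [hsc.base.var0] at hj
      have hc' := ctx hsc hF rfl wA
      obtain ⟨a1, a2, a3, a4⟩ := exec_searchStep (u := ⟨j, hj⟩) hg hc' hI'.1 hI'.2.1
        ((hF.1 11 rfl).trans he) hi
      refine ⟨inv_setVar _ _ _ _ (by norm_num) ⟨a1, a2, hI'.2.2.trans a3⟩, fun u hu huj hok => ?_⟩
      rcases Nat.lt_succ_iff_lt_or_eq.mp huj with h | h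
      · exact a3 (hstep u hu h hok)
      · have hu' : u = ⟨j, hj⟩ := Fin.ext h
        subst hu'
        exact a4 hok (hI'.2.2 hu))
    exact ⟨this.1, fun u hu hok => this.2 u hu (by rw [hsc.base.var0]; exact u.2) hok⟩
  have loop11 : ∀ R s, SearchCtx H k O ok g ko A S s → Inv R s →
      Inv R ((Code.rep 11 1 (.rep 12 0 (searchStep g ko w))).exec s) ∧
      ∀ e, ∀ u ∈ R, ok e u →
        O.head e ∈ marks n ((Code.rep 11 1 (.rep 12 0 (searchStep g ko w))).exec s) w := by
    intro R s hsc hI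
    have := Code.exec_rep (i := 11) (x := 1) (p := .rep 12 0 (searchStep g ko w)) s
      (fun j s' => Inv R s' ∧ ∃ R', Inv R' s' ∧
      ∀ e : Fin m, (e : ℕ) < j → ∀ u ∈ R, ok e u → O.head e ∈ R') rfl
      ⟨inv_setVar _ _ _ _ (by norm_num) hI, R, inv_setVar _ _ _ _ (by norm_num) hI,
        fun u hu => absurd hu (Nat.not_lt_zero _)⟩ (by
      rintro j s' hj hi hF ⟨hI', R', hI'', hstep⟩
      rw [hsc.base.var1] at hj
      have hc' := ctx hsc hF rfl wA
      obtain ⟨a1, a2⟩ := loop12 R s' ⟨j, hj⟩ hc' hi hI'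
      obtain ⟨b1, -⟩ := loop12 R' s' ⟨j, hj⟩ hc' hi hI''
      refine ⟨inv_setVar _ _ _ _ (by norm_num) a1, _,
        inv_setVar _ _ _ _ (by norm_num) ⟨a1.1, a1.2.1, subset_rfl⟩, fun e hej u hu hok => ?_⟩
      rcases Nat.lt_succ_iff_lt_or_eq.mp hej with h | h
      · exact b1.2.2 (hstep e h u hu hok)
      · have he' : e = ⟨j, hj⟩ := Fin.ext h
        subst he'
        exact a2 u hu hok)
    obtain ⟨h1, R', h2, h3⟩ := this
    exact ⟨h1, fun e u hu hok => h2.2.2 (h3 e (by rw [hsc.base.var1]; exact e.2) u hu hok)⟩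
  have := Code.exec_rep (i := 10) (x := 0) (p := .rep 11 1 (.rep 12 0 (searchStep g ko w))) s1
    (fun j s' => Inv ∅ s' ∧ (StepClosed O ok (marks n s' w) ∨ j ≤ (marks n s' w).card)) rfl
    ⟨inv_setVar _ _ _ _ (by norm_num) ⟨hinit.1, hinit.2, Finset.empty_subset _⟩,
      Or.inr (Nat.zero_le _)⟩ (by
    rintro j s' hj hi hF ⟨hI, hor⟩
    have hc' := ctx hs1c' hF rfl wA
    obtain ⟨a1, a2⟩ := loop11 (marks n s' w) s' hc' ⟨hI.1, hI.2.1, subset_rfl⟩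
    refine ⟨inv_setVar _ _ _ _ (by norm_num) ⟨a1.1, a1.2.1, Finset.empty_subset _⟩, ?_⟩
    rw [marks_setVar]
    by_cases hcl : StepClosed O ok (marks n s' w)
    · left
      have : marks n ((Code.rep 11 1 (.rep 12 0 (searchStep g ko w))).exec s') w = marks n s' w :=
        Finset.Subset.antisymm (a1.1.least _ hI.1.src hcl) a1.2.2
      rwa [this]
    · right
      have hle := hor.resolve_left hcl
      unfold StepClosed at hcl
      push Not at hcl
      obtain ⟨e, u, hok, hu, hh⟩ := hcl
      exact Nat.lt_of_le_of_lt hle (Finset.card_lt_card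
        (Finset.ssubset_iff_of_subset a1.2.2 |>.mpr ⟨_, a2 e u hu hok, hh⟩)))
  obtain ⟨h1, h2⟩ := this
  refine ⟨h1.1, ?_⟩
  rcases h2 with h2 | h2
  · exact h2
  · rw [hs1c'.base.var0] at h2
    have hu := Finset.eq_univ_of_card _ (le_antisymm (Finset.card_le_univ _)
      (by rw [Fintype.card_fin]; exact h2))
    intro e u _ _
    rw [hu]
    exact Finset.mem_univ _

end Search

end RAM

namespace RAM

open MultiHypergraph

/-! ### Reversing hyperpaths and computing cuts -/

/-- The code that reverses the hyperpath found by a search into the array `w`, from its end in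
variable `16` back to the set marked by `A`, in the orientation with heads `g`. -/
def reverse (g A w : ℕ) : Code :=
  .rep 15 0 (.ite (.get A (.var 16)) .skip
    (.assign 17 (.get (w + 1) (.var 16)) ;;
      .put g (.var 17) (.get (w + 2) (.var 16)) ;;
      .assign 16 (.get (w + 2) (.var 16))))

/-- The code that finds a vertex marked in both `A` and `B`, or `n` if there is none. -/
def pick (A B : ℕ) : Code :=
  .assign 16 (.var 0) ;;
  .rep 25 0 (.ite (.get A (.var 25)) (.ite (.get B (.var 25)) (.assign 16 (.var 25)) .skip) .skip)

/-- The code that marks in the array `a` the vertices in variable `34` for which `u ≠ 0`. -/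
def mark (a : ℕ) (u : Expr) : Code := .rep 34 0 (.put a (.var 34) u)

/-- The code that copies the heads in `a` to `b`. -/
def copyHeads (a b : ℕ) : Code := .rep 24 1 (.put b (.var 24) (.get a (.var 24)))

/-- The code that decides whether all sets that contain the set marked by `B` and avoid the one
marked by `A` have in-degree at least the value of variable `23`. -/
def cut (a A B : ℕ) : Code :=
  copyHeads a 5 ;;
  .assign 21 (.const 1) ;;
  .rep 20 2 (.ite (.sub (.var 23) (.var 20))
    (search 5 0 A 20 ;; pick B 20 ;;
      .ite (.sub (.var 0) (.var 16)) (reverse 5 A 20) (.assign 21 (.const 0))) .skip)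

/-- An expression that is non-zero if and only if `u = v`. -/
def Expr.eqv (u v : Expr) : Expr := .sub (.const 1) (.neq u v)

theorem Expr.eval_eqv (s : Store) (u v : Expr) :
    (Expr.eqv u v).eval s ≠ 0 ↔ u.eval s = v.eval s := by
  simp only [Expr.eqv, Expr.eval, Expr.neq]
  omega

/-- The code that decides whether the orientation with heads `a` has hyperarc-connectivity at least
the value of variable `23`. -/
def connTest (a : ℕ) : Code :=
  .assign 33 (.const 1) ;;
  .rep 30 0 (.rep 31 0 (mark 10 (.eqv (.var 34) (.var 30)) ;; mark 11 (.eqv (.var 34) (.var 31)) ;;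
    cut a 10 11 ;; .ite (.var 21) .skip (.assign 33 (.const 0))))

section Reverse

variable {n m : ℕ} {H : MultiHypergraph (Fin n) (Fin m)} {k : ℕ} {O : H.Orientation}
  {ok : Fin m → Fin n → Prop}

/-- The orientation `Oc` arises from `O` by the reversal of the end of a hyperpath, from `c` to
`t`; the hyperarcs reoriented so far had heads with time stamps larger than that of `c`. -/
structure PartialReversal (O : H.Orientation) (τ : Fin n → ℕ) (t : Fin n) (Oc : H.Orientation)
    (c : Fin n) : Prop where
  exch : O.Exchange Oc c t
  heads : ∀ f, τ (O.head f) ≤ τ c → Oc.head f = O.head f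

theorem PartialReversal.step {τ : Fin n → ℕ} {t c u : Fin n} {Oc : H.Orientation} {e : Fin m}
    (h : PartialReversal O τ t Oc c) (he : O.head e = c) (hu : u ∈ H.edge e) (hτ : τ u < τ c) :
    PartialReversal O τ t (Oc.setHead e u hu) u where
  exch := by
    have h1 : Oc.head e = c := by rw [h.heads e (by rw [he]), he]
    have h2 := Oc.exchange_setHead e u hu
    rw [h1] at h2
    exact h.exch.trans h2
  heads f hf := by
    have hne : f ≠ e := by
      rintro rfl
      rw [he] at hf
      omega
    simp only [Orientation.setHead, Function.update_of_ne hne]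
    exact h.heads f (by omega)

theorem HeadsAt.setHead {Oc : H.Orientation} {g : ℕ} {s : Store} (h : HeadsAt Oc g s) {e : Fin m}
    {u : Fin n} (hu : u ∈ H.edge e) : HeadsAt (Oc.setHead e u hu) g (s.setArr g e u) := by
  intro f
  simp only [Store.setArr_arr, true_and, Orientation.setHead, Function.update_apply]
  by_cases hf : f = e
  · simp [hf]
  · rw [if_neg (fun hh => hf (Fin.ext hh)), if_neg hf]
    exact h f

/-- The reversed hyperpath is followed back until it reaches `S`. The time stamps decrease along it,
so that `n` rounds suffice, and no hyperarc is reoriented twice. -/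
theorem exec_reverse {g A w : ℕ} {S : Finset (Fin n)} {s : Store} (hg : g < w) (hgA : g ≠ A)
    (hb : Base H k s) (hok : ∀ e u, ok e u → u ∈ H.edge e) (ht : SearchTree O ok S w s)
    (hh : HeadsAt O g s) (hA : marks n s A = S) {t : Fin n} (htw : t ∈ marks n s w)
    (h16 : s.var 16 = t) :
    ∃ (O' : H.Orientation) (a : Fin n), a ∈ S ∧ HeadsAt O' g ((reverse g A w).exec s) ∧
      O.Exchange O' a t := by
  have hgw1 : (w + 1) ≠ g := by omega
  have hgw2 : (w + 2) ≠ g := by omega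
  have hgw : w ≠ g := by omega
  set body : Code := .ite (.get A (.var 16)) .skip
    (.assign 17 (.get (w + 1) (.var 16)) ;;
      .put g (.var 17) (.get (w + 2) (.var 16)) ;;
      .assign 16 (.get (w + 2) (.var 16))) with hbody
  have hwr : ∀ a, a ≠ g → body.writesArr a = false := by
    intro a ha
    simp [hbody, Code.writesArr, Ne.symm ha]
  have := Code.exec_rep (i := 15) (x := 0) (p := body) s (fun j s' => ∃ (Oc : H.Orientation)
    (c : Fin n), s'.var 16 = c ∧ c ∈ marks n s w ∧ HeadsAt Oc g s' ∧
    PartialReversal O (fun v => s.arr w v) t Oc c ∧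
    (c ∈ S ∨ ∃ D : Finset (Fin n), D.card = j ∧ ∀ d ∈ D, s.arr w c < s.arr w d)) rfl
    ⟨O, t, h16, htw, hh, ⟨.refl O t, fun _ _ => rfl⟩, Or.inr ⟨∅, rfl, by simp⟩⟩ (by
    rintro j s' hj hi hF ⟨Oc, c, h1, h2, h3, h4, h5⟩
    have hw0 := hF.2 w (hwr w hgw)
    have hw1 := hF.2 (w + 1) (hwr _ hgw1)
    have hw2 := hF.2 (w + 2) (hwr _ hgw2)
    have hA' := hF.2 A (hwr _ hgA.symm)
    have hmem : s'.arr A c ≠ 0 ↔ c ∈ S := by rw [hA', ← hA, mem_marks]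
    simp only [hbody, Code.exec, Expr.eval, h1]
    by_cases hcS : c ∈ S
    · rw [if_pos (hmem.mpr hcS)]
      exact ⟨Oc, c, h1, h2, h3, h4, Or.inl hcS⟩
    · rw [if_neg (fun h => hcS (hmem.mp h))]
      obtain ⟨e, u, p1, p2, p3, p4, p5, p6⟩ := ht.pred c h2 hcS
      have hu := hok e u p4
      obtain ⟨D, hD, hD'⟩ := h5.resolve_left hcS
      refine ⟨Oc.setHead e u hu, u, ?_, p5, ?_, h4.step p3 hu p6, Or.inr ⟨insert c D, ?_, ?_⟩⟩
      · simp [hw2, hgw2, h1, p2]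
      · have := h3.setHead hu
        intro f
        have := this f
        simpa [hw1, hw2, hgw2, h1, p1, p2] using this
      · rw [Finset.card_insert_of_notMem, hD]
        exact fun hcD => lt_irrefl _ (hD' c hcD)
      · intro d hd
        rcases Finset.mem_insert.mp hd with rfl | hd
        · exact p6
        · exact p6.trans (hD' d hd))
  obtain ⟨Oc, c, h1, h2, h3, h4, h5⟩ := this
  refine ⟨Oc, c, ?_, h3, h4.exch⟩
  rcases h5 with h5 | ⟨D, hD, hD'⟩
  · exact h5
  · rw [hb.var0] at hD
    have hu := Finset.eq_univ_of_card D (by rw [hD, Fintype.card_fin])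
    exact absurd (hD' c (hu ▸ Finset.mem_univ c)) (lt_irrefl _)

theorem exec_pick {A B : ℕ} {s : Store} (hb : Base H k s) :
    (((pick A B).exec s).var 16 = n ∧ Disjoint (marks n s A) (marks n s B)) ∨
    ∃ v : Fin n, ((pick A B).exec s).var 16 = v ∧ v ∈ marks n s A ∧ v ∈ marks n s B := by
  have hb' : Base H k (s.setVar 16 n) := hb.setVar (by norm_num)
  have := Code.exec_rep (i := 25) (x := 0) (p := .ite (.get A (.var 25)) (.ite (.get B (.var 25))
    (.assign 16 (.var 25)) .skip) .skip) (s.setVar 16 n) (fun j s' =>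
    (s'.var 16 = n ∧ ∀ v : Fin n, (v : ℕ) < j → ¬ (v ∈ marks n s A ∧ v ∈ marks n s B)) ∨
    ∃ v : Fin n, s'.var 16 = v ∧ v ∈ marks n s A ∧ v ∈ marks n s B) rfl
    (Or.inl ⟨by simp, fun v hv => absurd hv (Nat.not_lt_zero _)⟩) (by
    intro j s' hj hi hF hI
    rw [hb'.var0] at hj
    have hA' := hF.2 A rfl
    have hB' := hF.2 B rfl
    simp only [Code.exec, Expr.eval, hi, hA', hB', Store.setVar_arr]
    have mA : (⟨j, hj⟩ : Fin n) ∈ marks n s A ↔ s.arr A j ≠ 0 := mem_marks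
    have mB : (⟨j, hj⟩ : Fin n) ∈ marks n s B ↔ s.arr B j ≠ 0 := mem_marks
    by_cases h1 : s.arr A j ≠ 0 ∧ s.arr B j ≠ 0
    · rw [if_pos h1.1, if_pos h1.2]
      exact Or.inr ⟨⟨j, hj⟩, by simp, mA.mpr h1.1, mB.mpr h1.2⟩
    · have : (if s.arr A j ≠ 0 then if s.arr B j ≠ 0 then s'.setVar 16 (s'.var 25) else s'
          else s') = s' := by
        split_ifs with h2 h3
        · exact absurd ⟨h2, h3⟩ h1
        · rfl
        · rfl
      rw [hi] at this
      rw [this]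
      rcases hI with ⟨h2, h3⟩ | ⟨v, h2, h3⟩
      · left
        refine ⟨by simpa using h2, fun v hv => ?_⟩
        rcases Nat.lt_succ_iff_lt_or_eq.mp hv with h | h
        · exact h3 v h
        · have hv' : v = ⟨j, hj⟩ := Fin.ext h
          subst hv'
          rw [mA, mB]
          exact h1
      · exact Or.inr ⟨v, by simpa using h2, h3⟩)
  have hex : (pick A B).exec s = (Code.rep 25 0 (.ite (.get A (.var 25)) (.ite (.get B (.var 25))
    (.assign 16 (.var 25)) .skip) .skip)).exec (s.setVar 16 n) := by
    rw [← hb.var0]; rfl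
  rw [hex]
  rcases this with ⟨h1, h2⟩ | h
  · refine Or.inl ⟨h1, Finset.disjoint_left.mpr fun v hv hv' => h2 v ?_ ⟨hv, hv'⟩⟩
    rw [hb'.var0]
    exact v.2
  · exact Or.inr h

theorem exec_mark {a : ℕ} {u : Expr} {s : Store} (hb : Base H k s) (P : Fin n → Prop)
    (hu : ∀ (y : Fin n) (s' : Store), s'.var 34 = y → (∀ z, z ≠ 34 → s'.var z = s.var z) →
      (∀ b, b ≠ a → s'.arr b = s.arr b) → (u.eval s' ≠ 0 ↔ P y)) (v : Fin n) :
    v ∈ marks n ((mark a u).exec s) a ↔ P v := by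
  have := Code.exec_rep (i := 34) (x := 0) (p := .put a (.var 34) u) s (fun j s' =>
    ∀ v : Fin n, (v : ℕ) < j → (s'.arr a v ≠ 0 ↔ P v)) rfl
    (fun v hv => absurd hv (Nat.not_lt_zero _)) (by
    intro j s' hj hi hF hI v hv
    have h1 := hu v s'
    simp only [Code.exec, Expr.eval, hi, Store.setVar_arr, Store.setArr_arr, true_and]
    rcases Nat.lt_succ_iff_lt_or_eq.mp hv with h | h
    · rw [if_neg h.ne]; exact hI v h
    · rw [if_pos h]
      refine hu v s' (hi.trans h.symm) (fun z hz => hF.1 z ?_) (fun b hb => hF.2 b ?_)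
      · simp [Code.writesVar, Ne.symm hz]
      · simp [Code.writesArr, Ne.symm hb])
  rw [mem_marks]
  exact this v (by rw [hb.var0]; exact v.2)

theorem exec_copyHeads {a b : ℕ} {s : Store} (hab : a ≠ b) (hb : Base H k s) (hh : HeadsAt O a s) :
    HeadsAt O b ((copyHeads a b).exec s) := by
  have := Code.exec_rep (i := 24) (x := 1) (p := .put b (.var 24) (.get a (.var 24))) s
    (fun j s' => ∀ e : Fin m, (e : ℕ) < j → s'.arr b e = O.head e) rfl
    (fun v hv => absurd hv (Nat.not_lt_zero _)) (by
    intro j s' hj hi hF hI e he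
    have ha := hF.2 a (by simp [Code.writesArr, Ne.symm hab])
    simp only [Code.exec, Expr.eval, hi, Store.setVar_arr, Store.setArr_arr, true_and, ha]
    rcases Nat.lt_succ_iff_lt_or_eq.mp he with h | h
    · rw [if_neg h.ne]; exact hI e h
    · rw [if_pos h, ← h]; exact hh e)
  exact fun e => this e (by rw [hb.var1]; exact e.2)

end Reverse

section Cut

variable {n m : ℕ} {H : MultiHypergraph (Fin n) (Fin m)} {k : ℕ} {O : H.Orientation}

theorem HeadsAt.of_frame {p : Code} {s s' : Store} {a : ℕ} (h : HeadsAt O a s) (hF : p.Frame s s')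
    (ha : p.writesArr a = false) : HeadsAt O a s' := fun e => by rw [hF.2 a ha]; exact h e

theorem marks_of_frame {p : Code} {s s' : Store} {a : ℕ} (hF : p.Frame s s')
    (ha : p.writesArr a = false) : marks n s' a = marks n s a := by
  unfold marks; rw [hF.2 a ha]

theorem writesArr_cut {a A B b : ℕ} (h5 : b ≠ 5) (hb : b < 20) :
    (cut a A B).writesArr b = false := by
  simp [cut, copyHeads, search, searchStep, pick, reverse, Code.writesArr]
  omega

/-- Correctness of the cut test. In each round, a hyperpath from `A` to `B` is reversed, and the
required in-degree drops by one; if there is no such hyperpath, some set has in-degree `0`. -/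
theorem exec_cut {a A B : ℕ} {s : Store} (ha : a ≠ 5) (hA : A < 20) (hA5 : A ≠ 5)
    (hB : B < 20) (hB5 : B ≠ 5) (hb : Base H k s) (hh : HeadsAt O a s) (hc : s.var 23 ≤ k) :
    ((cut a A B).exec s).var 21 ≠ 0 ↔ O.CutGE (marks n s A) (marks n s B) (s.var 23) := by
  set s1 := ((copyHeads a 5).exec s).setVar 21 1 with hs1
  have hF1 := Code.frame_exec (copyHeads a 5) s
  have wr1 : ∀ b, b ≠ 5 → (copyHeads a 5).writesArr b = false := by
    intro b hb; simp [copyHeads, Code.writesArr, Ne.symm hb]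
  have hb1 : Base H k s1 := (hb.of_frame hF1 rfl rfl rfl).setVar (by norm_num)
  have hh1 : HeadsAt O 5 s1 := exec_copyHeads ha hb hh
  have hA1 : marks n s1 A = marks n s A :=
    (marks_setVar _ _ _ _).trans (marks_of_frame hF1 (wr1 A hA5))
  have hB1 : marks n s1 B = marks n s B :=
    (marks_setVar _ _ _ _).trans (marks_of_frame hF1 (wr1 B hB5))
  have h23 : s1.var 23 = s.var 23 := by
    rw [hs1, Store.setVar_var, if_neg (by norm_num)]
    exact hF1.1 23 rfl
  set inner : Code := search 5 0 A 20 ;; pick B 20 ;;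
      .ite (.sub (.var 0) (.var 16)) (reverse 5 A 20) (.assign 21 (.const 0)) with hinner
  set body : Code := .ite (.sub (.var 23) (.var 20)) inner .skip with hbody
  have wsrch : ∀ b, b < 20 → (search 5 0 A 20).writesArr b = false := by
    intro b hb
    simp [search, searchStep, Code.writesArr]; omega
  have wbody : ∀ b, b ≠ 5 → b < 20 → body.writesArr b = false := by
    intro b hb5 hb
    simp [hbody, hinner, search, searchStep, pick, reverse, Code.writesArr]; omega
  have := Code.exec_rep (i := 20) (x := 2) (p := body) s1 (fun j s' => ∃ Oc : H.Orientation,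
    HeadsAt Oc 5 s' ∧ (O.CutGE (marks n s A) (marks n s B) (s.var 23) ↔
      (s'.var 21 ≠ 0 ∧ Oc.CutGE (marks n s A) (marks n s B) (s.var 23 - j)))) rfl
    ⟨O, hh1, by simp [hs1]⟩ (by
    rintro j s' hj hi hF ⟨Oc, h1, h2⟩
    have hb' : Base H k s' := hb1.of_frame hF rfl (wbody 0 (by norm_num) (by norm_num))
      (wbody 3 (by norm_num) (by norm_num))
    have h23' : s'.var 23 = s.var 23 := (hF.1 23 rfl).trans h23
    have hA' : marks n s' A = marks n s A := (marks_of_frame hF (wbody A hA5 hA)).trans hA1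
    have hB' : marks n s' B = marks n s B := (marks_of_frame hF (wbody B hB5 hB)).trans hB1
    simp only [hbody, Code.exec, Expr.eval, hi, h23']
    by_cases hlt : s.var 23 - j = 0
    · rw [if_neg (by omega)]
      refine ⟨Oc, h1, ?_⟩
      rw [h2, hlt, show s.var 23 - (j + 1) = 0 by omega]
      simp
    rw [if_pos hlt]
    -- the search
    have hctx : SearchCtx H k Oc (fun e u => u ∈ H.edge e) 5 0 A (marks n s A) s' :=
      ⟨hb', h1, hb'.inc, hA'⟩
    obtain ⟨t1, t2⟩ := exec_search (g := 5) (ko := 0) (A := A) (w := 20) (by norm_num)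
      (by norm_num) hA (by norm_num) hctx
    set s2 := (search 5 0 A 20).exec s' with hs2
    have hF2 := Code.frame_exec (search 5 0 A 20) s'
    have hb2 : Base H k s2 := hb'.of_frame hF2 rfl (wsrch 0 (by norm_num)) (wsrch 3 (by norm_num))
    have hh2 : HeadsAt Oc 5 s2 := h1.of_frame hF2 (wsrch 5 (by norm_num))
    have hA2 : marks n s2 A = marks n s A := (marks_of_frame hF2 (wsrch A hA)).trans hA'
    have hB2 : marks n s2 B = marks n s B := (marks_of_frame hF2 (wsrch B hB)).trans hB'
    have h21 : s2.var 21 = s'.var 21 := hF2.1 21 rfl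
    have hpick := exec_pick (A := B) (B := 20) hb2
    set s3 := (pick B 20).exec s2 with hs3
    have hF3 := Code.frame_exec (pick B 20) s2
    have hb3 : Base H k s3 := hb2.of_frame hF3 rfl rfl rfl
    have hh3 : HeadsAt Oc 5 s3 := hh2.of_frame hF3 rfl
    have hA3 : marks n s3 A = marks n s A := (marks_of_frame hF3 rfl).trans hA2
    have hM3 : marks n s3 20 = marks n s2 20 := marks_of_frame hF3 rfl
    have h21' : s3.var 21 = s'.var 21 := (hF3.1 21 rfl).trans h21
    have ht3 : SearchTree Oc (fun e u => u ∈ H.edge e) (marks n s A) 20 s3 :=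
      t1.congr (hF3.2 20 rfl) (hF3.2 21 rfl) (hF3.2 22 rfl)
    have hex : inner.exec s' = (Code.ite (.sub (.var 0) (.var 16)) (reverse 5 A 20)
        (.assign 21 (.const 0))).exec s3 := rfl
    obtain ⟨q, hq⟩ : ∃ q, s.var 23 - j = q + 1 :=
      Nat.exists_eq_succ_of_ne_zero hlt
    have hq' : s.var 23 - (j + 1) = q := by omega
    rw [hex]
    simp only [Code.exec, Expr.eval, hb3.var0]
    rw [hB2] at hpick
    rcases hpick with ⟨h16, hdis⟩ | ⟨v, h16, hvB, hvR⟩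
    · rw [h16, Nat.sub_self, if_neg (by simp)]
      refine ⟨Oc, hh3, ?_⟩
      rw [h2, hq]
      have := Oc.not_cutGE_of_closed (A := marks n s A) (B := marks n s B) t1.src hdis
        (fun e u hu hR => t2 e u hu hR) q
      simp [this]
    · rw [h16, if_pos (by have := v.2; omega)]
      obtain ⟨O', a', ha', hO', hex'⟩ := exec_reverse (g := 5) (A := A) (w := 20) (by norm_num)
        hA5.symm hb3 (fun e u h => h) ht3 hh3 hA3 (hM3.symm ▸ hvR) h16
      refine ⟨O', hO', ?_⟩
      have hF4 := Code.frame_exec (reverse 5 A 20) s3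
      rw [h2, hq, hq', hex'.cutGE ha' hvB, Store.setVar_var, if_neg (by norm_num), hF4.1 21 rfl,
        h21'])
  obtain ⟨Oc, h1, h2⟩ := this
  have hex : (cut a A B).exec s = (Code.rep 20 2 body).exec s1 := rfl
  rw [hex, h2, hb1.var2, Nat.sub_eq_zero_of_le hc]
  simp [Orientation.cutGE_zero]

theorem exec_connTest {a : ℕ} {s : Store} (ha : a ≠ 5) (ha' : a < 10) (hb : Base H k s)
    (hh : HeadsAt O a s) (hc : s.var 23 ≤ k) :
    ((connTest a).exec s).var 33 ≠ 0 ↔ O.IsHyperarcConnected (s.var 23) := by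
  set body : Code := mark 10 (.eqv (.var 34) (.var 30)) ;; mark 11 (.eqv (.var 34) (.var 31)) ;;
    cut a 10 11 ;; .ite (.var 21) .skip (.assign 33 (.const 0)) with hbody
  have wbody : ∀ b, b ≠ 5 → b < 10 → body.writesArr b = false := by
    intro b hb5 hb
    simp only [hbody, Code.writesArr, mark, writesArr_cut hb5 (by omega : b < 20),
      Bool.or_false, Bool.or_eq_false_iff, beq_eq_false_iff_ne]
    omega
  have ctx : ∀ {p : Code} {s s' : Store}, (∀ b, b ≠ 5 → b < 10 → p.writesArr b = false) →
      p.wf = true → p.Frame s s' → Base H k s → HeadsAt O a s → Base H k s' ∧ HeadsAt O a s' :=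
    fun hw hwf hF hb hh => ⟨hb.of_frame hF hwf (hw 0 (by norm_num) (by norm_num))
      (hw 3 (by norm_num) (by norm_num)), hh.of_frame hF (hw a ha ha')⟩
  have step : ∀ (s : Store) (x y : Fin n), Base H k s → HeadsAt O a s → s.var 23 ≤ k →
      s.var 30 = x → s.var 31 = y →
      ((body.exec s).var 33 ≠ 0 ↔ s.var 33 ≠ 0 ∧ O.CutGE {x} {y} (s.var 23)) := by
    intro s x y hb hh hc h30 h31
    have m1 := exec_mark (a := 10) (u := .eqv (.var 34) (.var 30)) hb (fun v => v = x) (by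
      intro y s' h1 h2 _
      rw [Expr.eval_eqv, Expr.eval, Expr.eval, h1, h2 30 (by norm_num), h30, Fin.ext_iff])
    set s1 := (mark 10 (.eqv (.var 34) (.var 30))).exec s with hs1
    have hF1 := Code.frame_exec (mark 10 (.eqv (.var 34) (.var 30))) s
    have hb1 : Base H k s1 := hb.of_frame hF1 rfl rfl rfl
    have m2 := exec_mark (a := 11) (u := .eqv (.var 34) (.var 31)) hb1 (fun v => v = y) (by
      intro y s' h1 h2 _
      rw [Expr.eval_eqv, Expr.eval, Expr.eval, h1, h2 31 (by norm_num), hF1.1 31 rfl, h31,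
        Fin.ext_iff])
    set s2 := (mark 11 (.eqv (.var 34) (.var 31))).exec s1 with hs2
    have hF2 := Code.frame_exec (mark 11 (.eqv (.var 34) (.var 31))) s1
    have hb2 : Base H k s2 := hb1.of_frame hF2 rfl rfl rfl
    have hh2 : HeadsAt O a s2 := (hh.of_frame hF1 (by simp [mark, Code.writesArr]; omega)).of_frame
      hF2 (by simp [mark, Code.writesArr]; omega)
    have h23 : s2.var 23 = s.var 23 := (hF2.1 23 rfl).trans (hF1.1 23 rfl)
    have hm1 : marks n s2 10 = {x} := by
      rw [marks_of_frame hF2 rfl]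
      ext v
      rw [m1, Finset.mem_singleton]
    have hm2 : marks n s2 11 = {y} := by
      ext v
      rw [m2, Finset.mem_singleton]
    have hcut := exec_cut (A := 10) (B := 11) ha (by norm_num) (by norm_num) (by norm_num)
      (by norm_num) hb2 hh2 (h23 ▸ hc)
    rw [hm1, hm2, h23] at hcut
    have hF3 := Code.frame_exec (cut a 10 11) s2
    have h33 : ((cut a 10 11).exec s2).var 33 = s.var 33 :=
      (hF3.1 33 rfl).trans ((hF2.1 33 rfl).trans (hF1.1 33 rfl))
    have hex : body.exec s = (Code.ite (.var 21) .skip (.assign 33 (.const 0))).exec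
      ((cut a 10 11).exec s2) := rfl
    rw [hex]
    simp only [Code.exec, Expr.eval]
    rw [← hcut]
    split_ifs with h
    · simp [h33, h]
    · simp [h]
  set s0 := s.setVar 33 1 with hs0
  have hb0 : Base H k s0 := hb.setVar (by norm_num)
  have hh0 : HeadsAt O a s0 := hh
  have h230 : s0.var 23 = s.var 23 := by simp [hs0]
  have inner : ∀ (s : Store) (x : Fin n), Base H k s → HeadsAt O a s → s.var 23 ≤ k →
      s.var 30 = x → (((Code.rep 31 0 body).exec s).var 33 ≠ 0 ↔
        s.var 33 ≠ 0 ∧ ∀ y, O.CutGE {x} {y} (s.var 23)) := by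
    intro s x hb hh hc h30
    have := Code.exec_rep (i := 31) (x := 0) (p := body) s (fun j s' => s'.var 33 ≠ 0 ↔
      s.var 33 ≠ 0 ∧ ∀ y : Fin n, (y : ℕ) < j → O.CutGE {x} {y} (s.var 23)) rfl (by simp) (by
      intro j s' hj hi hF hI
      rw [hb.var0] at hj
      obtain ⟨hb', hh'⟩ := ctx (p := .rep 31 0 body) wbody rfl hF hb hh
      have h23 : s'.var 23 = s.var 23 := hF.1 23 rfl
      have := step s' x ⟨j, hj⟩ hb' hh' (h23 ▸ hc) ((hF.1 30 rfl).trans h30) hi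
      rw [Store.setVar_var, if_neg (by norm_num), this, hI, h23, and_assoc]
      refine and_congr_right fun _ => ⟨fun h y hy => ?_, fun h =>
        ⟨fun y hy => h y (hy.trans (Nat.lt_succ_self j)), h ⟨j, hj⟩ (Nat.lt_succ_self j)⟩⟩
      rcases Nat.lt_succ_iff_lt_or_eq.mp hy with h' | h'
      · exact h.1 y h'
      · rw [show y = ⟨j, hj⟩ from Fin.ext h']
        exact h.2)
    rw [this, hb.var0]
    exact and_congr_right fun _ => ⟨fun h y => h y y.2, fun h y _ => h y⟩
  have := Code.exec_rep (i := 30) (x := 0) (p := .rep 31 0 body) s0 (fun j s' => s'.var 33 ≠ 0 ↔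
    ∀ x : Fin n, (x : ℕ) < j → ∀ y, O.CutGE {x} {y} (s.var 23)) rfl (by simp [hs0]) (by
    intro j s' hj hi hF hI
    rw [hb0.var0] at hj
    obtain ⟨hb', hh'⟩ := ctx (p := .rep 30 0 (.rep 31 0 body)) wbody rfl hF hb0 hh0
    have h23 : s'.var 23 = s.var 23 := (hF.1 23 rfl).trans h230
    have := inner s' ⟨j, hj⟩ hb' hh' (h23 ▸ hc) hi
    rw [Store.setVar_var, if_neg (by norm_num), this, hI, h23]
    refine ⟨fun h y hy => ?_, fun h =>
      ⟨fun y hy => h y (hy.trans (Nat.lt_succ_self j)), h ⟨j, hj⟩ (Nat.lt_succ_self j)⟩⟩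
    rcases Nat.lt_succ_iff_lt_or_eq.mp hy with h' | h'
    · exact h.1 y h'
    · rw [show y = ⟨j, hj⟩ from Fin.ext h']
      exact h.2)
  rw [O.isHyperarcConnected_iff_cutGE]
  have hex : (connTest a).exec s = (Code.rep 30 0 (.rep 31 0 body)).exec s0 := rfl
  rw [hex, this, hb0.var0]
  exact ⟨fun h x y => h x x.2 y, fun h x _ y => h x y⟩

end Cut

end RAM

namespace RAM

open MultiHypergraph

/-! ### Computing the score -/

/-- The code of one test: in the array `10` it marks the vertex `0`, the vertices larger than the
value `v` of variable `40` and the value `x` of variable `41`, in the array `11` it marks `v`, and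
counts in variable `43` whether the cut condition from `A` to `B` holds. -/
def scoreTest (a A B : ℕ) : Code :=
  mark 10 (.add (.add (.sub (.const 1) (.var 34)) (.sub (.var 34) (.var 40)))
    (.eqv (.var 34) (.var 41))) ;;
  mark 11 (.eqv (.var 34) (.var 40)) ;;
  cut a A B ;;
  .ite (.var 21) (.assign 43 (.add (.var 43) (.const 1))) (.assign 45 (.const 1))

/-- The code that performs the tests for a fixed `v`. -/
def scoreRow (a A B : ℕ) : Code :=
  .rep 41 0 (.ite (.sub (.var 40) (.var 41)) (scoreTest a A B) .skip)

/-- The code for one of the two stages of the score. -/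
def scoreStage (a A B : ℕ) : Code :=
  .rep 40 0 (.ite (.var 44)
    (.assign 45 (.const 0) ;; scoreRow a A B ;; .ite (.var 45) (.assign 44 (.const 0)) .skip) .skip)

/-- The code that computes the score of the orientation with heads `a`. -/
def scoreCode (a : ℕ) : Code :=
  .assign 43 (.const 0) ;; .assign 23 (.var 60) ;; connTest a ;;
  .ite (.var 33)
    (.assign 43 (.const 1) ;; .assign 44 (.const 1) ;; .assign 23 (.add (.var 60) (.const 1)) ;;
      scoreStage a 10 11 ;; scoreStage a 11 10) .skip

section Score

variable {n m : ℕ} {H : MultiHypergraph (Fin n) (Fin m)} {k : ℕ} {O : H.Orientation}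

/-- The source set of the test for `v` and `x`. -/
def lowSrc (n v x : ℕ) : Finset (Fin n) :=
  Finset.univ.filter fun y => (y : ℕ) = 0 ∨ v < (y : ℕ) ∨ (y : ℕ) = x

/-- The target set of the test for `v`. -/
def lowTgt (n v : ℕ) : Finset (Fin n) := Finset.univ.filter fun y => (y : ℕ) = v

theorem cutGE_lowSrc {v x K : ℕ} (hv : v < n) :
    O.CutGE (lowSrc n v x) (lowTgt n v) K ↔ LowTest O.inDegree K v x := by
  refine forall_congr' fun Y => ?_
  have h1 : lowTgt n v ⊆ Y ↔ ∃ y ∈ Y, (y : ℕ) = v := by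
    constructor
    · exact fun h => ⟨⟨v, hv⟩, h (by simp [lowTgt]), rfl⟩
    · rintro ⟨y, hy, hyv⟩ z hz
      have : z = y := Fin.ext ((by simpa [lowTgt] using hz : (z : ℕ) = v).trans hyv.symm)
      exact this ▸ hy
  have h2 : Disjoint (lowSrc n v x) Y ↔ ∀ y ∈ Y, 0 < (y : ℕ) ∧ (y : ℕ) ≤ v ∧ (y : ℕ) ≠ x := by
    rw [disjoint_comm, Finset.disjoint_left]
    refine forall_congr' fun y => forall_congr' fun _ => ?_
    simp only [lowSrc, Finset.mem_filter, Finset.mem_univ, true_and]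
    omega
  rw [h1, h2]

theorem cutGE_lowTgt {v x K : ℕ} (hv : v < n) :
    O.CutGE (lowTgt n v) (lowSrc n v x) K ↔ LowTest O.outDegree K v x := by
  have key : O.CutGE (lowTgt n v) (lowSrc n v x) K ↔
      ∀ Y : Finset (Fin n), lowTgt n v ⊆ Y → Disjoint (lowSrc n v x) Y → K ≤ O.outDegree Y := by
    constructor
    · intro h Y h1 h2
      rw [Orientation.outDegree_eq]
      refine h Yᶜ (fun y hy => Finset.mem_compl.mpr (Finset.disjoint_left.mp h2 hy)) ?_
      exact Finset.disjoint_left.mpr fun y hy hy' => Finset.mem_compl.mp hy' (h1 hy)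
    · intro h Y h1 h2
      rw [Orientation.inDegree_eq]
      refine h Yᶜ (fun y hy => Finset.mem_compl.mpr (Finset.disjoint_left.mp h2 hy)) ?_
      exact Finset.disjoint_left.mpr fun y hy hy' => Finset.mem_compl.mp hy' (h1 hy)
  rw [key]
  refine forall_congr' fun Y => ?_
  have h1 : lowTgt n v ⊆ Y ↔ ∃ y ∈ Y, (y : ℕ) = v := by
    constructor
    · exact fun h => ⟨⟨v, hv⟩, h (by simp [lowTgt]), rfl⟩
    · rintro ⟨y, hy, hyv⟩ z hz
      have : z = y := Fin.ext ((by simpa [lowTgt] using hz : (z : ℕ) = v).trans hyv.symm)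
      exact this ▸ hy
  have h2 : Disjoint (lowSrc n v x) Y ↔ ∀ y ∈ Y, 0 < (y : ℕ) ∧ (y : ℕ) ≤ v ∧ (y : ℕ) ≠ x := by
    rw [disjoint_comm, Finset.disjoint_left]
    refine forall_congr' fun y => forall_congr' fun _ => ?_
    simp only [lowSrc, Finset.mem_filter, Finset.mem_univ, true_and]
    omega
  rw [h1, h2]

theorem writesArr_scoreTest {a A B b : ℕ} (h5 : b ≠ 5) (hb : b < 10) :
    (scoreTest a A B).writesArr b = false := by
  simp only [scoreTest, Code.writesArr, mark, writesArr_cut h5 (by omega : b < 20),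
    Bool.or_false, Bool.or_eq_false_iff, beq_eq_false_iff_ne]
  omega

theorem exec_scoreTest {a A B K v x : ℕ} {s : Store} {T : Prop} (ha : a ≠ 5) (ha' : a < 10)
    (hAB : (A = 10 ∧ B = 11) ∨ (A = 11 ∧ B = 10)) (hb : Base H k s) (hh : HeadsAt O a s)
    (hK : K ≤ k) (h23 : s.var 23 = K) (h40 : s.var 40 = v) (h41 : s.var 41 = x)
    (hT : ∀ s', marks n s' 10 = lowSrc n v x → marks n s' 11 = lowTgt n v →
      (O.CutGE (marks n s' A) (marks n s' B) K ↔ T)) :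
    (T → ((scoreTest a A B).exec s).var 43 = s.var 43 + 1 ∧
      ((scoreTest a A B).exec s).var 45 = s.var 45) ∧
    (¬ T → ((scoreTest a A B).exec s).var 43 = s.var 43 ∧
      ((scoreTest a A B).exec s).var 45 = 1) := by
  set u : Expr := .add (.add (.sub (.const 1) (.var 34)) (.sub (.var 34) (.var 40)))
    (.eqv (.var 34) (.var 41)) with hu
  have m1 := exec_mark (a := 10) (u := u) hb (fun y => (y : ℕ) = 0 ∨ v < (y : ℕ) ∨ (y : ℕ) = x) (by
    intro y s' h1 h2 _
    have h3 := Expr.eval_eqv s' (.var 34) (.var 41)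
    have h4 := h2 40 (by norm_num)
    have h5 := h2 41 (by norm_num)
    simp only [Expr.eval, h1, h5, h41] at h3
    simp only [hu, Expr.eval, h1, h4, h40]
    rw [← h3]
    omega)
  set s1 := (mark 10 u).exec s with hs1
  have hF1 := Code.frame_exec (mark 10 u) s
  have hb1 : Base H k s1 := hb.of_frame hF1 rfl rfl rfl
  have m2 := exec_mark (a := 11) (u := .eqv (.var 34) (.var 40)) hb1 (fun y => (y : ℕ) = v) (by
    intro y s' h1 h2 _
    rw [Expr.eval_eqv, Expr.eval, Expr.eval, h1, h2 40 (by norm_num), hF1.1 40 rfl, h40])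
  set s2 := (mark 11 (.eqv (.var 34) (.var 40))).exec s1 with hs2
  have hF2 := Code.frame_exec (mark 11 (.eqv (.var 34) (.var 40))) s1
  have hb2 : Base H k s2 := hb1.of_frame hF2 rfl rfl rfl
  have hh2 : HeadsAt O a s2 := (hh.of_frame hF1 (by simp [mark, Code.writesArr]; omega)).of_frame
    hF2 (by simp [mark, Code.writesArr]; omega)
  have keep : ∀ z, z ≠ 34 → s2.var z = s.var z := by
    intro z hz
    rw [hF2.1 z (by simp [mark, Code.writesVar, Ne.symm hz]),
      hF1.1 z (by simp [mark, Code.writesVar, Ne.symm hz])]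
  have h23' : s2.var 23 = K := (keep 23 (by norm_num)).trans h23
  have hm1 : marks n s2 10 = lowSrc n v x := by
    rw [marks_of_frame hF2 rfl]
    ext y
    rw [m1]
    simp [lowSrc]
  have hm2 : marks n s2 11 = lowTgt n v := by
    ext y
    rw [m2]
    simp [lowTgt]
  have hcut := exec_cut (A := A) (B := B) ha (by omega) (by omega) (by omega)
    (by omega) hb2 hh2 (h23'.trans_le hK)
  rw [h23', hT s2 hm1 hm2] at hcut
  have hF3 := Code.frame_exec (cut a A B) s2
  have h43 : ((cut a A B).exec s2).var 43 = s.var 43 := (hF3.1 43 rfl).trans (keep 43 (by norm_num))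
  have h45 : ((cut a A B).exec s2).var 45 = s.var 45 := (hF3.1 45 rfl).trans (keep 45 (by norm_num))
  have hex : (scoreTest a A B).exec s = (Code.ite (.var 21)
    (.assign 43 (.add (.var 43) (.const 1))) (.assign 45 (.const 1))).exec
    ((cut a A B).exec s2) := rfl
  rw [hex]
  refine ⟨fun h => ?_, fun h => ?_⟩
  · rw [Code.exec_ite_pos (u := .var 21) (hcut.mpr h)]; simp [Code.exec, Expr.eval, h43, h45]
  · rw [Code.exec_ite_neg (u := .var 21) (mt hcut.mp h)]; simp [Code.exec, Expr.eval, h43]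

theorem exec_scoreRow {a A B K v : ℕ} {s : Store} {f : Finset (Fin n) → ℕ} (ha : a ≠ 5)
    (ha' : a < 10) (hAB : (A = 10 ∧ B = 11) ∨ (A = 11 ∧ B = 10)) (hb : Base H k s)
    (hh : HeadsAt O a s) (hK : K ≤ k) (h23 : s.var 23 = K) (h40 : s.var 40 = v) (hv : v < n)
    (hT : ∀ s' x, marks n s' 10 = lowSrc n v x → marks n s' 11 = lowTgt n v →
      (O.CutGE (marks n s' A) (marks n s' B) K ↔ LowTest f K v x)) :
    ((scoreRow a A B).exec s).var 43 = s.var 43 + lowCount f K v ∧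
    (((scoreRow a A B).exec s).var 45 ≠ 0 ↔ s.var 45 ≠ 0 ∨ lowCount f K v ≠ v) := by
  classical
  have := Code.exec_rep (i := 41) (x := 0) (p := .ite (.sub (.var 40) (.var 41)) (scoreTest a A B)
    .skip) s (fun j s' => s'.var 43 = s.var 43 +
      ((Finset.range v).filter fun x => x < j ∧ LowTest f K v x).card ∧
      (s'.var 45 ≠ 0 ↔ s.var 45 ≠ 0 ∨ ∃ x < v, x < j ∧ ¬ LowTest f K v x)) rfl
    (by simp) (by
    rintro j s' hj hi hF ⟨h1, h2⟩
    have wr : ∀ b, b ≠ 5 → b < 10 → (Code.ite (.sub (.var 40) (.var 41)) (scoreTest a A B)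
        .skip).writesArr b = false := by
      intro b h5 hb
      simp [Code.writesArr, writesArr_scoreTest h5 hb]
    have hb' : Base H k s' := hb.of_frame hF rfl (wr 0 (by norm_num) (by norm_num))
      (wr 3 (by norm_num) (by norm_num))
    have hh' : HeadsAt O a s' := hh.of_frame hF (wr a ha ha')
    have h40' : s'.var 40 = v := (hF.1 40 rfl).trans h40
    have h23' : s'.var 23 = K := (hF.1 23 rfl).trans h23
    simp only [Code.exec, Expr.eval, hi, h40']
    by_cases hlt : j < v
    · rw [if_pos (by omega)]
      have ht := exec_scoreTest ha ha' hAB hb' hh' hK h23' h40' hi (fun s' => hT s' j)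
      by_cases hj' : LowTest f K v j
      · obtain ⟨a1, a2⟩ := ht.1 hj'
        have e : (Finset.range v).filter (fun x => x < j + 1 ∧ LowTest f K v x)
            = insert j ((Finset.range v).filter fun x => x < j ∧ LowTest f K v x) := by
          ext x
          simp only [Finset.mem_insert, Finset.mem_filter, Finset.mem_range]
          constructor
          · rintro ⟨b1, b2, b3⟩
            rcases Nat.lt_succ_iff_lt_or_eq.mp b2 with h | h
            · exact Or.inr ⟨b1, h, b3⟩
            · exact Or.inl h
          · rintro (rfl | ⟨b1, b2, b3⟩)
            · exact ⟨hlt, Nat.lt_succ_self _, hj'⟩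
            · exact ⟨b1, b2.trans (Nat.lt_succ_self _), b3⟩
        refine ⟨?_, ?_⟩
        · rw [Store.setVar_var, if_neg (by norm_num), a1, h1, e, Finset.card_insert_of_notMem
            (by simp), add_assoc]
        · rw [Store.setVar_var, if_neg (by norm_num), a2, h2]
          refine or_congr_right ⟨fun ⟨x, b1, b2, b3⟩ => ⟨x, b1, b2.trans (Nat.lt_succ_self _), b3⟩,
            fun ⟨x, b1, b2, b3⟩ => ⟨x, b1, ?_, b3⟩⟩
          refine lt_of_le_of_ne (Nat.lt_succ_iff.mp b2) ?_
          rintro rfl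
          exact b3 hj'
      · obtain ⟨a1, a2⟩ := ht.2 hj'
        have e : (Finset.range v).filter (fun x => x < j + 1 ∧ LowTest f K v x)
            = (Finset.range v).filter fun x => x < j ∧ LowTest f K v x := by
          refine Finset.filter_congr fun x _ => ⟨fun ⟨b1, b2⟩ => ⟨lt_of_le_of_ne
            (Nat.lt_succ_iff.mp b1) ?_, b2⟩, fun ⟨b1, b2⟩ => ⟨b1.trans (Nat.lt_succ_self _), b2⟩⟩
          rintro rfl
          exact hj' b2
        refine ⟨?_, ?_⟩
        · rw [Store.setVar_var, if_neg (by norm_num), a1, h1, e]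
        · rw [Store.setVar_var, if_neg (by norm_num), a2]
          simp only [ne_eq, one_ne_zero, not_false_eq_true, true_iff]
          exact Or.inr ⟨j, hlt, Nat.lt_succ_self _, hj'⟩
    · rw [if_neg (by omega)]
      have e : ∀ x, x < v → (x < j + 1 ↔ x < j) := by intro x hx; omega
      refine ⟨?_, ?_⟩
      · rw [Store.setVar_var, if_neg (by norm_num), h1]
        congr 2
        refine Finset.filter_congr fun x hx => ?_
        rw [e x (Finset.mem_range.mp hx)]
      · rw [Store.setVar_var, if_neg (by norm_num), h2]
        refine or_congr_right (exists_congr fun x => and_congr_right fun hx => ?_)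
        rw [e x hx])
  rw [hb.var0] at this
  have hr : (scoreRow a A B).exec s = (Code.rep 41 0 (.ite (.sub (.var 40) (.var 41))
    (scoreTest a A B) .skip)).exec s := rfl
  rw [hr, ne_eq (lowCount f K v), lowCount_eq_iff]
  refine ⟨?_, ?_⟩
  · rw [this.1]
    unfold lowCount
    congr 2
    refine Finset.filter_congr fun x hx => ?_
    have := Finset.mem_range.mp hx
    exact and_iff_right (by omega)
  · rw [this.2]
    refine or_congr_right ?_
    push Not
    refine exists_congr fun x => and_congr_right fun hx => ?_
    exact and_iff_right (by omega)

theorem stageScore_succ (φ : ℕ → ℕ) (N : ℕ) :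
    stageScore φ (N + 1) = stageScore φ N + if ∀ w < N, φ w = w then φ N else 0 :=
  Finset.sum_range_succ _ _

theorem writesArr_scoreStage {a A B b : ℕ} (h5 : b ≠ 5) (hb : b < 10) :
    (scoreStage a A B).writesArr b = false := by
  simp [scoreStage, scoreRow, Code.writesArr, writesArr_scoreTest h5 hb]

theorem exec_scoreStage {a A B K : ℕ} {s : Store} {f : Finset (Fin n) → ℕ} (ha : a ≠ 5)
    (ha' : a < 10) (hAB : (A = 10 ∧ B = 11) ∨ (A = 11 ∧ B = 10)) (hb : Base H k s)
    (hh : HeadsAt O a s) (hK : K ≤ k) (h23 : s.var 23 = K)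
    (hT : ∀ s' v x, v < n → marks n s' 10 = lowSrc n v x → marks n s' 11 = lowTgt n v →
      (O.CutGE (marks n s' A) (marks n s' B) K ↔ LowTest f K v x)) :
    ((scoreStage a A B).exec s).var 43 =
      s.var 43 + (if s.var 44 ≠ 0 then stageScore (lowCount f K) n else 0) ∧
    (((scoreStage a A B).exec s).var 44 ≠ 0 ↔ s.var 44 ≠ 0 ∧ ∀ w < n, lowCount f K w = w) := by
  set body : Code := .ite (.var 44)
    (.assign 45 (.const 0) ;; scoreRow a A B ;; .ite (.var 45) (.assign 44 (.const 0)) .skip) .skip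
    with hbody
  have := Code.exec_rep (i := 40) (x := 0) (p := body) s (fun j s' => s'.var 43 = s.var 43 +
      (if s.var 44 ≠ 0 then stageScore (lowCount f K) j else 0) ∧
      (s'.var 44 ≠ 0 ↔ s.var 44 ≠ 0 ∧ ∀ w < j, lowCount f K w = w)) rfl
    (by simp [stageScore]) (by
    rintro j s' hj hi hF ⟨h1, h2⟩
    rw [hb.var0] at hj
    have wr : ∀ b, b ≠ 5 → b < 10 → body.writesArr b = false := by
      intro b h5 hb
      simp [hbody, scoreRow, Code.writesArr, writesArr_scoreTest h5 hb]
    have hb' : Base H k s' := hb.of_frame hF rfl (wr 0 (by norm_num) (by norm_num))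
      (wr 3 (by norm_num) (by norm_num))
    have hh' : HeadsAt O a s' := hh.of_frame hF (wr a ha ha')
    have h23' : s'.var 23 = K := (hF.1 23 rfl).trans h23
    have hsucc : (∀ w < j + 1, lowCount f K w = w) ↔
        (∀ w < j, lowCount f K w = w) ∧ lowCount f K j = j := by
      constructor
      · exact fun h => ⟨fun w hw => h w (hw.trans (Nat.lt_succ_self _)), h j (Nat.lt_succ_self _)⟩
      · rintro ⟨h, h'⟩ w hw
        rcases Nat.lt_succ_iff_lt_or_eq.mp hw with h'' | rfl
        exacts [h w h'', h']
    by_cases h44 : s'.var 44 ≠ 0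
    · have hr := exec_scoreRow (s := s'.setVar 45 0) ha ha' hAB (hb'.setVar (by norm_num))
        hh' hK (by simpa using h23') (by simpa using hi) hj (fun s' x => hT s' j x hj)
      set s2 := (scoreRow a A B).exec (s'.setVar 45 0) with hs2
      have hF2 := Code.frame_exec (scoreRow a A B) (s'.setVar 45 0)
      have hex : body.exec s' = (Code.ite (.var 45) (.assign 44 (.const 0)) .skip).exec s2 := by
        rw [hbody, Code.exec_ite_pos (u := .var 44) h44]; rfl
      have h44' : s2.var 44 = s'.var 44 := by
        rw [hF2.1 44 rfl]; simp
      have hcond := h2.mp h44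
      have h45 : s2.var 45 ≠ 0 ↔ lowCount f K j ≠ j := by rw [hr.2]; simp
      have h43 : s2.var 43 = s'.var 43 + lowCount f K j := by rw [hr.1]; simp
      rw [stageScore_succ, if_pos hcond.1, if_pos hcond.2, hsucc]
      rw [if_pos hcond.1] at h1
      by_cases hfull : lowCount f K j = j
      · rw [hex, Code.exec_ite_neg (u := .var 45) (mt h45.mp (not_not.mpr hfull)), Code.exec]
        refine ⟨?_, ?_⟩
        · rw [Store.setVar_var, if_neg (by norm_num), h43, h1, add_assoc]
        · rw [Store.setVar_var, if_neg (by norm_num), h44']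
          exact ⟨fun _ => ⟨hcond.1, hcond.2, hfull⟩, fun _ => h44⟩
      · rw [hex, Code.exec_ite_pos (u := .var 45) (h45.mpr hfull), Code.exec, Expr.eval]
        refine ⟨?_, ?_⟩
        · rw [Store.setVar_var, if_neg (by norm_num), Store.setVar_var, if_neg (by norm_num), h43,
            h1, add_assoc]
        · simp [hfull]
    · rw [hbody, Code.exec_ite_neg (u := .var 44) h44, Code.exec]
      have hnot := fun h => h44 (h2.mpr h)
      refine ⟨?_, ?_⟩
      · rw [Store.setVar_var, if_neg (by norm_num), h1, stageScore_succ]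
        by_cases h : s.var 44 ≠ 0
        · rw [if_pos h, if_pos h, if_neg (fun h' => hnot ⟨h, h'⟩), add_zero]
        · rw [if_neg h, if_neg h]
      · rw [Store.setVar_var, if_neg (by norm_num), hsucc, ← and_assoc, ← h2]
        exact ⟨fun h => absurd h h44, fun h => h.1⟩)
  rw [hb.var0] at this
  exact this

theorem writesArr_connTest {a b : ℕ} (h5 : b ≠ 5) (hb : b < 10) :
    (connTest a).writesArr b = false := by
  simp only [connTest, Code.writesArr, mark, writesArr_cut h5 (by omega : b < 20),
    Bool.or_false, Bool.false_or, Bool.or_eq_false_iff, beq_eq_false_iff_ne]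
  omega

theorem exec_scoreCode {a lev : ℕ} {s : Store} (ha : a ≠ 5) (ha' : a < 10) (hb : Base H k s)
    (hh : HeadsAt O a s) (h60 : s.var 60 = lev) (hlev : lev < k) :
    ((scoreCode a).exec s).var 43 = score O lev := by
  set s1 := (s.setVar 43 0).setVar 23 lev with hs1
  have hb1 : Base H k s1 := (hb.setVar (by norm_num)).setVar (by norm_num)
  have hh1 : HeadsAt O a s1 := hh
  have h23 : s1.var 23 = lev := by simp [hs1]
  have hct := exec_connTest ha ha' hb1 hh1 (h23.trans_le hlev.le)
  rw [h23] at hct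
  set s2 := (connTest a).exec s1 with hs2
  have hF2 := Code.frame_exec (connTest a) s1
  have hb2 : Base H k s2 := hb1.of_frame hF2 rfl (writesArr_connTest (by norm_num) (by norm_num))
    (writesArr_connTest (by norm_num) (by norm_num))
  have hh2 : HeadsAt O a s2 := hh1.of_frame hF2 (writesArr_connTest ha ha')
  have h60' : s2.var 60 = lev := by
    rw [hF2.1 60 rfl]; simp [hs1, h60]
  have h43 : s2.var 43 = 0 := by
    rw [hF2.1 43 rfl]; simp [hs1]
  have hex : (scoreCode a).exec s = (Code.ite (.var 33)
    (.assign 43 (.const 1) ;; .assign 44 (.const 1) ;; .assign 23 (.add (.var 60) (.const 1)) ;;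
      scoreStage a 10 11 ;; scoreStage a 11 10) .skip).exec s2 := by
    simp only [scoreCode, Code.exec, Expr.eval, hs2, hs1]
    simp [h60]
  rw [hex]
  by_cases hO : O.IsHyperarcConnected lev
  swap
  · rw [Code.exec_ite_neg (u := .var 33) (mt hct.mp hO), Code.exec, h43, score, if_neg hO]
  rw [Code.exec_ite_pos (u := .var 33) (hct.mpr hO), score, if_pos hO]
  simp only [Code.exec, Expr.eval]
  simp only [Store.setVar_var, h60']
  norm_num only [if_false]
  set s3 := ((s2.setVar 43 1).setVar 44 1).setVar 23 (lev + 1) with hs3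
  have hb3 : Base H k s3 := ((hb2.setVar (by norm_num)).setVar (by norm_num)).setVar (by norm_num)
  have hh3 : HeadsAt O a s3 := hh2
  have h4 := exec_scoreStage (s := s3) (f := O.inDegree) (K := lev + 1) ha ha' (Or.inl ⟨rfl, rfl⟩)
    hb3 hh3 hlev (by simp [hs3]) (fun s' v x hv h1 h2 => by rw [h1, h2]; exact cutGE_lowSrc hv)
  set s4 := (scoreStage a 10 11).exec s3 with hs4
  have hF4 := Code.frame_exec (scoreStage a 10 11) s3
  have hb4 : Base H k s4 := hb3.of_frame hF4 rfl (writesArr_scoreStage (by norm_num) (by norm_num))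
    (writesArr_scoreStage (by norm_num) (by norm_num))
  have hh4 : HeadsAt O a s4 := hh3.of_frame hF4 (writesArr_scoreStage ha ha')
  have h23' : s4.var 23 = lev + 1 := by
    rw [hF4.1 23 rfl]; simp [hs3]
  have h5 := exec_scoreStage (s := s4) (f := O.outDegree) (K := lev + 1) ha ha' (Or.inr ⟨rfl, rfl⟩)
    hb4 hh4 hlev h23' (fun s' v x hv h1 h2 => by rw [h1, h2]; exact cutGE_lowTgt hv)
  rw [h5.1, h4.1]
  have e1 : s3.var 43 = 1 := by simp [hs3]
  have e2 : s3.var 44 ≠ 0 := by simp [hs3]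
  rw [e1, if_pos e2]
  by_cases hfull : ∀ w < n, lowCount O.inDegree (lev + 1) w = w
  · rw [if_pos hfull, if_pos (h4.2.mpr ⟨e2, hfull⟩)]
  · rw [if_neg hfull, if_neg (fun h => hfull (h4.2.mp h).2)]

end Score

end RAM

namespace RAM

open MultiHypergraph

/-! ### Increasing the score to the maximum -/

/-- The invariant rule for a loop whose rounds all advance a counter by `d`. -/
theorem Code.exec_rep_count {i x d : ℕ} {p : Code} (hpi : p.writesVar i = false)
    (R : ℕ → Store → Prop) (hset : ∀ c s v, R c s → R c (s.setVar i v))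
    (hstep : ∀ c s, R c s → R (c + d) (p.exec s)) {c : ℕ} {s : Store} (h : R c s) :
    R (c + s.var x * d) ((Code.rep i x p).exec s) :=
  Code.exec_rep s (fun j s' => R (c + j * d) s') hpi (by simpa using hset c s 0 h)
    fun j s' _ _ _ hR => by
      rw [Nat.succ_mul, ← add_assoc]
      exact hset _ _ _ (hstep _ _ hR)

/-- A loop reaches the invariant `Q` if some round leads from `P` to `Q`. -/
theorem Code.exec_rep_hit {i x : ℕ} {p : Code} (hpi : p.writesVar i = false) {s : Store}
    {a : ℕ} (ha : a < s.var x) (P Q : Store → Prop)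
    (hP : ∀ s v, P s → P (s.setVar i v)) (hQ : ∀ s v, Q s → Q (s.setVar i v))
    (hPP : ∀ s' : Store, s'.var i < s.var x → P s' → P (p.exec s') ∨ Q (p.exec s'))
    (hQQ : ∀ s' : Store, s'.var i < s.var x → Q s' → Q (p.exec s'))
    (hPQ : ∀ s' : Store, s'.var i = a → P s' → Q (p.exec s')) (h : P s ∨ Q s) :
    Q ((Code.rep i x p).exec s) := by
  have := Code.exec_rep s (fun j s' => Q s' ∨ (P s' ∧ j ≤ a)) hpi
    (h.elim (fun h => Or.inr ⟨hP _ _ h, Nat.zero_le _⟩) fun h => Or.inl (hQ _ _ h))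
    fun j s' hj hi _ hI => by
      rcases hI with hI | ⟨hI, hja⟩
      · exact Or.inl (hQ _ _ (hQQ s' (hi ▸ hj) hI))
      rcases hja.lt_or_eq with h | h
      · rcases hPP s' (hi ▸ hj) hI with h' | h'
        exacts [Or.inr ⟨hP _ _ h', h⟩, Or.inl (hQ _ _ h')]
      · exact Or.inl (hQ _ _ (hPQ s' (hi.trans h) hI))
  exact this.resolve_right fun h => absurd h.2 (by omega)

/-- The code of one attempt to increase the score of the orientation with heads `4`, whose score is
held by variable `53`: if there is a hyperpath from the vertex in variable `50` to the vertex in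
variable `51`, reverse it, and keep the result if its score is larger. -/
def tryPair : Code :=
  copyHeads 4 6 ;; mark 10 (.eqv (.var 34) (.var 50)) ;; search 6 0 10 20 ;;
  .ite (.get 20 (.var 51))
    (.assign 16 (.var 51) ;; reverse 6 10 20 ;; scoreCode 6 ;;
      .ite (.sub (.var 43) (.var 53)) (copyHeads 6 4 ;; .assign 53 (.var 43)) .skip) .skip

/-- The code that attempts to increase the score with all pairs of vertices. -/
def tryAll : Code := .rep 50 0 (.rep 51 0 tryPair)

/-- The code that turns a copy of the orientation with heads `1` into one with the next larger
hyperarc-connectivity. -/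
def findTarget : Code :=
  copyHeads 1 4 ;; scoreCode 4 ;; .assign 53 (.var 43) ;; .rep 54 0 (.rep 55 0 tryAll)

section FindTarget

variable {n m : ℕ} {H : MultiHypergraph (Fin n) (Fin m)} {k lev : ℕ} {O O' : H.Orientation}

/-- The orientation `O'` with heads `4` has been obtained from `O` by at most `score O' lev - 1`
reversals of hyperpaths. -/
structure Improved (k lev : ℕ) (O O' : H.Orientation) (s : Store) : Prop where
  base : Base H k s
  heads : HeadsAt O' 4 s
  var60 : s.var 60 = lev
  best : s.var 53 = score O' lev
  dist : O.headDist O' + 1 ≤ score O' lev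

theorem Improved.setVar {s : Store} (h : Improved k lev O O' s) {x v : ℕ} (hx : 3 ≤ x)
    (h53 : x ≠ 53) (h60 : x ≠ 60) : Improved k lev O O' (s.setVar x v) where
  base := h.base.setVar hx
  heads := h.heads
  var60 := by rw [Store.setVar_var, if_neg h60.symm]; exact h.var60
  best := by rw [Store.setVar_var, if_neg h53.symm]; exact h.best
  dist := h.dist

theorem Improved.of_frame {p : Code} {s s' : Store} (h : Improved k lev O O' s)
    (hF : p.Frame s s') (hp : p.wf = true) (h0 : p.writesArr 0 = false)
    (h3 : p.writesArr 3 = false) (h4 : p.writesArr 4 = false) (h53 : p.writesVar 53 = false)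
    (h60 : p.writesVar 60 = false) : Improved k lev O O' s' where
  base := h.base.of_frame hF hp h0 h3
  heads := h.heads.of_frame hF h4
  var60 := (hF.1 60 h60).trans h.var60
  best := (hF.1 53 h53).trans h.best
  dist := h.dist

/-- An attempt changes the orientation only if this increases the score; it does increase it if all
reversals of hyperpaths from `x` to `y` do, and there is one. -/
theorem exec_tryPair {s : Store} (hlev : lev < k) (h : Improved k lev O O' s) {x y : Fin n}
    (h50 : s.var 50 = x) (h51 : s.var 51 = y) :
    (Improved k lev O O' (tryPair.exec s) ∨
      ∃ O₁, score O' lev < score O₁ lev ∧ Improved k lev O O₁ (tryPair.exec s)) ∧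
    ((∀ R : Finset (Fin n), x ∈ R → (∀ e u, u ∈ H.edge e → u ∈ R → O'.head e ∈ R) → y ∈ R) →
      (∀ O₁ : H.Orientation, O'.Exchange O₁ x y → score O' lev < score O₁ lev) →
      ∃ O₁, score O' lev < score O₁ lev ∧ Improved k lev O O₁ (tryPair.exec s)) := by
  set s1 := (copyHeads 4 6).exec s with hs1
  have hF1 := Code.frame_exec (copyHeads 4 6) s
  have h1 : Improved k lev O O' s1 := h.of_frame hF1 rfl rfl rfl rfl rfl rfl
  have hh1 : HeadsAt O' 6 s1 := exec_copyHeads (by norm_num) h.base h.heads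
  set p2 := mark 10 (.eqv (.var 34) (.var 50)) with hp2
  have m1 := exec_mark (a := 10) (u := .eqv (.var 34) (.var 50)) h1.base (fun v => v = x) (by
    intro y s' h1 h2 _
    rw [Expr.eval_eqv, Expr.eval, Expr.eval, h1, h2 50 (by norm_num), hF1.1 50 rfl, h50,
      Fin.ext_iff])
  set s2 := p2.exec s1 with hs2
  have hF2 := Code.frame_exec p2 s1
  have h2 : Improved k lev O O' s2 := h1.of_frame hF2 rfl rfl rfl rfl rfl rfl
  have hh2 : HeadsAt O' 6 s2 := hh1.of_frame hF2 rfl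
  have hm2 : marks n s2 10 = {x} := by
    ext v
    rw [m1, Finset.mem_singleton]
  obtain ⟨t1, t2⟩ := exec_search (g := 6) (ko := 0) (A := 10) (w := 20) (by norm_num)
    (by norm_num) (by norm_num) (by norm_num)
    (⟨h2.base, hh2, h2.base.inc, hm2⟩ : SearchCtx H k O' (fun e u => u ∈ H.edge e) 6 0 10 {x} s2)
  set s3 := (search 6 0 10 20).exec s2 with hs3
  have hF3 := Code.frame_exec (search 6 0 10 20) s2
  have h3 : Improved k lev O O' s3 := h2.of_frame hF3 rfl rfl rfl rfl rfl rfl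
  have hh3 : HeadsAt O' 6 s3 := hh2.of_frame hF3 rfl
  have hm3 : marks n s3 10 = {x} := (marks_of_frame hF3 rfl).trans hm2
  have h51' : s3.var 51 = y := by rw [hF3.1 51 rfl, hF2.1 51 rfl, hF1.1 51 rfl, h51]
  have hex : tryPair.exec s = (Code.ite (.get 20 (.var 51))
    (.assign 16 (.var 51) ;; reverse 6 10 20 ;; scoreCode 6 ;;
      .ite (.sub (.var 43) (.var 53)) (copyHeads 6 4 ;; .assign 53 (.var 43)) .skip)
    .skip).exec s3 := rfl
  have hval : Expr.eval s3 (.get 20 (.var 51)) ≠ 0 ↔ y ∈ marks n s3 20 := by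
    rw [mem_marks, ← h51']; rfl
  rw [hex]
  by_cases hy : y ∈ marks n s3 20
  swap
  · rw [Code.exec_ite_neg (mt hval.mp hy), Code.exec]
    refine ⟨Or.inl h3, fun hR _ => absurd (hR _ (t1.src (Finset.mem_singleton_self x)) ?_) hy⟩
    exact fun e u hu hu' => t2 e u hu hu'
  rw [Code.exec_ite_pos (hval.mpr hy)]
  set s4 := s3.setVar 16 y with hs4
  have h4 : Improved k lev O O' s4 := h3.setVar (by norm_num) (by norm_num) (by norm_num)
  obtain ⟨O₁, a, ha, hO₁, hex₁⟩ := exec_reverse (g := 6) (A := 10) (w := 20) (s := s4)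
    (by norm_num) (by norm_num) h4.base (fun e u h => h) (t1.congr rfl rfl rfl) hh3 hm3 hy
    (by simp [hs4])
  obtain rfl := Finset.mem_singleton.mp ha
  set s5 := (reverse 6 10 20).exec s4 with hs5
  have hF5 := Code.frame_exec (reverse 6 10 20) s4
  have h5 : Improved k lev O O' s5 := h4.of_frame hF5 rfl rfl rfl rfl rfl rfl
  have hsc := exec_scoreCode (a := 6) (lev := lev) (by norm_num) (by norm_num) h5.base hO₁
    h5.var60 hlev
  set s6 := (scoreCode 6).exec s5 with hs6
  have hF6 := Code.frame_exec (scoreCode 6) s5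
  have h6 : Improved k lev O O' s6 := h5.of_frame hF6 rfl rfl rfl rfl rfl rfl
  have hh6 : HeadsAt O₁ 6 s6 := hO₁.of_frame hF6 rfl
  have hex' : (Code.assign 16 (.var 51) ;; reverse 6 10 20 ;; scoreCode 6 ;;
      .ite (.sub (.var 43) (.var 53)) (copyHeads 6 4 ;; .assign 53 (.var 43)) .skip).exec s3 =
      (Code.ite (.sub (.var 43) (.var 53)) (copyHeads 6 4 ;; .assign 53 (.var 43)) .skip).exec
        s6 := by
    simp only [Code.exec, Expr.eval, h51', hs6, hs5, hs4]
  have hval' : Expr.eval s6 (.sub (.var 43) (.var 53)) ≠ 0 ↔ score O' lev < score O₁ lev := by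
    simp only [Expr.eval, hsc, h6.best]
    omega
  rw [hex']
  by_cases hlt : score O' lev < score O₁ lev
  · rw [Code.exec_ite_pos (hval'.mpr hlt)]
    have hF7 := Code.frame_exec (copyHeads 6 4) s6
    have h43 : ((copyHeads 6 4).exec s6).var 43 = score O₁ lev := (hF7.1 43 rfl).trans hsc
    have h7 : Improved k lev O O₁ ((copyHeads 6 4 ;; .assign 53 (.var 43)).exec s6) := by
      refine ⟨(h6.base.of_frame hF7 rfl rfl rfl).setVar (by norm_num),
        exec_copyHeads (by norm_num) h6.base hh6, ?_, ?_, ?_⟩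
      · simp only [Code.exec, Expr.eval, Store.setVar_var]
        rw [if_neg (by norm_num), hF7.1 60 rfl, h6.var60]
      · simp [Code.exec, Expr.eval, h43]
      · have := hex₁.headDist_le (O := O)
        have := h.dist
        omega
    exact ⟨Or.inr ⟨O₁, hlt, h7⟩, fun _ _ => ⟨O₁, hlt, h7⟩⟩
  · rw [Code.exec_ite_neg (mt hval'.mp hlt), Code.exec]
    exact ⟨Or.inl h6, fun _ hs => absurd (hs O₁ hex₁) hlt⟩

/-- A pass through all pairs increases the score, unless the goal is reached. -/
theorem exec_tryAll {s : Store} (hlev : lev < k) (hn : 0 < n)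
    (hH : H.IsPartitionConnected (lev + 1)) (h : Improved k lev O O' s) :
    ∃ O₁, Improved k lev O O₁ (tryAll.exec s) ∧
      (O₁.IsHyperarcConnected (lev + 1) ∨ score O' lev < score O₁ lev) := by
  -- `P` says that nothing has changed, `Q` that the score has been increased
  set P : Store → Prop := Improved k lev O O' with hP
  set Q : Store → Prop := fun s => ∃ O₁, score O' lev < score O₁ lev ∧ Improved k lev O O₁ s
    with hQ
  have pset : ∀ x v s, 3 ≤ x → x ≠ 53 → x ≠ 60 → P s → P (s.setVar x v) :=
    fun x v s h1 h2 h3 h => h.setVar h1 h2 h3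
  have qset : ∀ x v s, 3 ≤ x → x ≠ 53 → x ≠ 60 → Q s → Q (s.setVar x v) :=
    fun x v s h1 h2 h3 ⟨O₁, h, h'⟩ => ⟨O₁, h, h'.setVar h1 h2 h3⟩
  have qbase : ∀ s, Q s → Base H k s := fun s ⟨_, _, h⟩ => h.base
  have pp : ∀ s, s.var 50 < n → s.var 51 < n → P s → P (tryPair.exec s) ∨ Q (tryPair.exec s) :=
    fun s h1 h2 h => (exec_tryPair (x := ⟨_, h1⟩) (y := ⟨_, h2⟩) hlev h rfl rfl).1
  have qq : ∀ s, s.var 50 < n → s.var 51 < n → Q s → Q (tryPair.exec s) := by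
    rintro s h1 h2 ⟨O₁, h, h'⟩
    rcases (exec_tryPair (x := ⟨_, h1⟩) (y := ⟨_, h2⟩) hlev h' rfl rfl).1 with h3 | ⟨O₂, h3, h4⟩
    exacts [⟨O₁, h, h3⟩, ⟨O₂, h.trans h3, h4⟩]
  have base : ∀ s, P s ∨ Q s → Base H k s := fun s h => h.elim (fun h => h.base) (qbase s)
  have inner : ∀ s, s.var 50 < n → P s ∨ Q s → P ((Code.rep 51 0 tryPair).exec s) ∨
      Q ((Code.rep 51 0 tryPair).exec s) := by
    intro s h1 h
    refine Code.exec_rep s (fun _ s' => P s' ∨ Q s') rfl (h.imp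
      (pset _ _ _ (by norm_num) (by norm_num) (by norm_num))
      (qset _ _ _ (by norm_num) (by norm_num) (by norm_num))) fun j s' hj hi hF hI => ?_
    rw [(base s h).var0] at hj
    have h50 : s'.var 50 < n := by rw [hF.1 50 rfl]; exact h1
    have : P (tryPair.exec s') ∨ Q (tryPair.exec s') :=
      hI.elim (pp s' h50 (hi ▸ hj)) fun h => Or.inr (qq s' h50 (hi ▸ hj) h)
    exact this.imp (pset _ _ _ (by norm_num) (by norm_num) (by norm_num))
      (qset _ _ _ (by norm_num) (by norm_num) (by norm_num))
  have innerQ : ∀ s, s.var 50 < n → Q s → Q ((Code.rep 51 0 tryPair).exec s) := by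
    intro s h1 h
    refine Code.exec_rep s (fun _ s' => Q s') rfl (qset _ _ _ (by norm_num) (by norm_num)
      (by norm_num) h) fun j s' hj hi hF hI => ?_
    rw [(qbase s h).var0] at hj
    have h50 : s'.var 50 < n := by rw [hF.1 50 rfl]; exact h1
    exact qset _ _ _ (by norm_num) (by norm_num) (by norm_num) (qq s' h50 (hi ▸ hj) hI)
  have n0 := h.base.var0
  by_cases hconn : O'.IsHyperarcConnected (lev + 1)
  · have := Code.exec_rep (i := 50) (x := 0) (p := .rep 51 0 tryPair) s
      (fun _ s' => P s' ∨ Q s') rfl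
      (Or.inl (pset _ _ _ (by norm_num) (by norm_num) (by norm_num) h)) fun j s' hj hi hF hI =>
        (inner s' (by omega) hI).imp (pset _ _ _ (by norm_num) (by norm_num) (by norm_num))
          (qset _ _ _ (by norm_num) (by norm_num) (by norm_num))
    rcases this with h' | ⟨O₁, h1, h2⟩
    exacts [⟨O', h', Or.inl hconn⟩, ⟨O₁, h2, Or.inr h1⟩]
  · have hk : O'.IsHyperarcConnected lev := by
      by_contra hcon
      have := h.dist
      rw [score, if_neg hcon] at this
      omega
    obtain ⟨x, y, hxy, hsc⟩ := MultiHypergraph.Orientation.exists_score_lt hH hn hk hconn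
    have : Q (tryAll.exec s) := by
      refine Code.exec_rep_hit (a := x) (x := 0) (i := 50) (p := .rep 51 0 tryPair) rfl
        (by rw [n0]; exact x.2) P Q
        (fun s v => pset _ _ _ (by norm_num) (by norm_num) (by norm_num))
        (fun s v => qset _ _ _ (by norm_num) (by norm_num) (by norm_num))
        (fun s' hs' h => inner s' (by omega) (Or.inl h)) (fun s' hs' h => innerQ s' (by omega) h)
        (fun s' hs' h => ?_) (Or.inl h)
      have n0' := h.base.var0
      have := Code.exec_rep_hit (a := y) (x := 0) (i := 51) (p := tryPair) (s := s') rfl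
        (by rw [n0']; exact y.2) (fun s => P s ∧ s.var 50 = x) (fun s => Q s ∧ s.var 50 = x)
        (fun s v h => ⟨pset _ _ _ (by norm_num) (by norm_num) (by norm_num) h.1, by
          rw [Store.setVar_var, if_neg (by norm_num)]; exact h.2⟩)
        (fun s v h => ⟨qset _ _ _ (by norm_num) (by norm_num) (by norm_num) h.1, by
          rw [Store.setVar_var, if_neg (by norm_num)]; exact h.2⟩)
        (fun s h1 h2 => ?_) (fun s h1 h2 => ?_) (fun s h1 h2 => ?_) (Or.inl ⟨h, hs'⟩)
      · exact this.1
      · have hF : (tryPair.exec s).var 50 = x := ((Code.frame_exec tryPair s).1 50 rfl).trans h2.2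
        exact (pp s (h2.2 ▸ x.2) (by omega) h2.1).imp (fun h => ⟨h, hF⟩) fun h => ⟨h, hF⟩
      · have hF : (tryPair.exec s).var 50 = x := ((Code.frame_exec tryPair s).1 50 rfl).trans h2.2
        exact ⟨qq s (h2.2 ▸ x.2) (by omega) h2.1, hF⟩
      · have hF : (tryPair.exec s).var 50 = x := ((Code.frame_exec tryPair s).1 50 rfl).trans h2.2
        exact ⟨(exec_tryPair hlev h2.1 h2.2 h1).2 hxy hsc, hF⟩
    obtain ⟨O₁, h1, h2⟩ := this
    exact ⟨O₁, h2, Or.inr h1⟩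

/-- As the score is at most `n (n - 1) + 1`, the `n ^ 2` passes suffice. -/
theorem exec_findTarget {s : Store} (hb : Base H k s) (hh : HeadsAt O 1 s) (h60 : s.var 60 = lev)
    (hlev : lev < k) (hn : 0 < n) (hH : H.IsPartitionConnected (lev + 1))
    (hO : O.IsHyperarcConnected lev) :
    ∃ O', HeadsAt O' 4 (findTarget.exec s) ∧ O'.IsHyperarcConnected (lev + 1) ∧
      O.headDist O' ≤ n * (n - 1) := by
  have hF1 := Code.frame_exec (copyHeads 1 4) s
  set s1 := (copyHeads 1 4).exec s with hs1
  have hb1 : Base H k s1 := hb.of_frame hF1 rfl rfl rfl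
  have hh1 : HeadsAt O 4 s1 := exec_copyHeads (by norm_num) hb hh
  have h60' : s1.var 60 = lev := (hF1.1 60 rfl).trans h60
  have hsc := exec_scoreCode (a := 4) (by norm_num) (by norm_num) hb1 hh1 h60' hlev
  set s2 := (scoreCode 4).exec s1 with hs2
  have hF2 := Code.frame_exec (scoreCode 4) s1
  have hI : Improved k lev O O (s2.setVar 53 (s2.var 43)) := by
    refine ⟨(hb1.of_frame hF2 rfl rfl rfl).setVar (by norm_num), (hh1.of_frame hF2 rfl : HeadsAt O 4 s2), ?_, ?_, ?_⟩
    · rw [Store.setVar_var, if_neg (by norm_num), hF2.1 60 rfl, h60']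
    · rw [Store.setVar_var, if_pos rfl, hsc]
    · rw [Orientation.headDist_self, score, if_pos hO]
      omega
  set R : ℕ → Store → Prop := fun c s => ∃ O', Improved k lev O O' s ∧
    (O'.IsHyperarcConnected (lev + 1) ∨ c < score O' lev) with hR
  have rset : ∀ x, 3 ≤ x → x ≠ 53 → x ≠ 60 → ∀ c s v, R c s → R c (s.setVar x v) :=
    fun x h1 h2 h3 c s v ⟨O', h, h'⟩ => ⟨O', h.setVar h1 h2 h3, h'⟩
  have h0 : R 0 (s2.setVar 53 (s2.var 43)) := ⟨O, hI, Or.inr (by have := hI.dist; omega)⟩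
  have step : ∀ c s, R c s → R (c + 1) (tryAll.exec s) := by
    rintro c s ⟨O', h, h'⟩
    obtain ⟨O₁, h1, h2⟩ := exec_tryAll hlev hn hH h
    refine ⟨O₁, h1, ?_⟩
    rcases h2 with h2 | h2
    · exact Or.inl h2
    rcases h' with h' | h'
    · have := Orientation.score_of_isHyperarcConnected h'
      have := score_le O₁ lev
      omega
    · exact Or.inr (by omega)
  have rbase : ∀ c s, R c s → s.var 0 = n := fun c s ⟨_, h, _⟩ => h.base.var0
  have row : ∀ c s, R c s → R (c + n) ((Code.rep 55 0 tryAll).exec s) := by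
    intro c s h
    have := Code.exec_rep_count (i := 55) (x := 0) rfl R (rset 55 (by norm_num) (by norm_num)
      (by norm_num)) step h
    rwa [rbase c s h, mul_one] at this
  have := Code.exec_rep_count (i := 54) (x := 0) rfl R (rset 54 (by norm_num) (by norm_num)
    (by norm_num)) row h0
  rw [rbase _ _ h0, zero_add] at this
  obtain ⟨O', h1, h2⟩ := this
  have hle := score_le O' lev
  refine ⟨O', h1.heads, h2.resolve_right fun h => ?_, ?_⟩
  · have : n * n = n * (n - 1) + n := by
      obtain ⟨q, rfl⟩ := Nat.exists_eq_succ_of_ne_zero hn.ne'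
      simp [Nat.mul_succ]
    omega
  · have := h1.dist
    omega

end FindTarget

end RAM

namespace RAM

open MultiHypergraph

/-! ### Walking to the target along safe hyperpaths -/

/-- The code that stores in the array `b` how often each vertex occurs in the array `a`. -/
def headCounts (a b : ℕ) : Code :=
  mark b (.const 0) ;;
  .rep 65 1 (.put b (.get a (.var 65)) (.add (.get b (.get a (.var 65))) (.const 1)))

/-- The code that marks in the arrays `15` and `16` the vertices with fewer and more heads in the
array `1` than in the array `4`. -/
def compareCounts : Code :=
  headCounts 1 13 ;; headCounts 4 14 ;; mark 15 (.sub (.get 14 (.var 34)) (.get 13 (.var 34))) ;;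
  mark 16 (.sub (.get 13 (.var 34)) (.get 14 (.var 34)))

/-- The address of the incidence of the hyperedge in variable `63` and the vertex in variable `64`. -/
def cell : Expr := .add (.get 3 (.var 63)) (.var 64)

/-- The code that decides whether the reorientation of the hyperedge in variable `63` towards the
vertex in variable `64` keeps the hyperarc-connectivity at least the value of variable `60`. -/
def safeCell : Code :=
  .ite (.get 0 cell) (copyHeads 1 6 ;; .put 6 (.var 63) (.var 64) ;; .assign 23 (.var 60) ;;
    connTest 6 ;; .put 12 cell (.var 33)) (.put 12 cell (.const 0))

/-- The code that tabulates the safe reorientations in the array `12`. -/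
def safeTable : Code := .rep 63 1 (.rep 64 0 safeCell)

/-- The code that appends the current heads to the output. -/
def record : Code := .rep 73 1 (.put 2 (.add (.var 72) (.var 73)) (.get 1 (.var 73)))

/-- The code that reorients the last hyperarc of the hyperpath to the vertex in variable `69`,
appends the result to the output, and decides whether the goal is reached. -/
def flip : Code :=
  .put 1 (.get 31 (.var 69)) (.get 32 (.var 69)) ;; .assign 69 (.get 32 (.var 69)) ;;
  .assign 3 (.add (.var 3) (.const 1)) ;; .assign 72 (.add (.var 72) (.var 1)) ;; record ;;
  .assign 23 (.add (.var 60) (.const 1)) ;; connTest 1 ;; .ite (.var 33) (.assign 71 (.const 1)) .skip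

/-- The code that reorients the hyperarcs of a hyperpath one by one, from its end in variable `69`
back to the set marked by the array `15`, unless the goal is reached earlier. -/
def walk : Code := .rep 68 0 (.ite (.get 15 (.var 69)) .skip (.ite (.var 71) .skip flip))

/-- The code that finds a safe hyperpath from a vertex with too few heads to a vertex with too many
heads, compared with the orientation with heads `4`, and reverses it. -/
def approach : Code :=
  .ite (.var 71) .skip
    (compareCounts ;; safeTable ;; search 1 12 15 30 ;; pick 16 30 ;; .assign 69 (.var 16) ;; walk)

/-- The reorientation of `e` towards `u` keeps the hyperarc-connectivity at least `c`. -/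
def Safe {n m : ℕ} {H : MultiHypergraph (Fin n) (Fin m)} (O : H.Orientation) (c : ℕ) (e : Fin m)
    (u : Fin n) : Prop :=
  ∃ hu : u ∈ H.edge e, (O.setHead e u hu).IsHyperarcConnected c

section Walk

variable {n m : ℕ} {H : MultiHypergraph (Fin n) (Fin m)} {k lev : ℕ} {O₀ O O' : H.Orientation}

theorem exec_headCounts {a b : ℕ} {s : Store} (hab : a ≠ b) (h0 : b ≠ 0) (h3 : b ≠ 3)
    (hb : Base H k s) (hh : HeadsAt O a s) (v : Fin n) :
    ((headCounts a b).exec s).arr b v = O.headCount v := by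
  have m1 := exec_mark (a := b) (u := .const 0) hb (fun _ => False) (by simp [Expr.eval])
  set s1 := (mark b (.const 0)).exec s with hs1
  have hF1 := Code.frame_exec (mark b (.const 0)) s
  have hb1 : Base H k s1 := hb.of_frame hF1 rfl (by simp [mark, Code.writesArr, h0])
    (by simp [mark, Code.writesArr, h3])
  have hh1 : HeadsAt O a s1 := hh.of_frame hF1 (by simp [mark, Code.writesArr, hab.symm])
  have hz : ∀ v : Fin n, s1.arr b v = 0 := fun v => by
    by_contra h
    exact (m1 v).mp (mem_marks.mpr h)
  have := Code.exec_rep (i := 65) (x := 1) (p := .put b (.get a (.var 65))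
    (.add (.get b (.get a (.var 65))) (.const 1))) s1 (fun j s' => ∀ v : Fin n, s'.arr b v =
      (Finset.univ.filter fun e : Fin m => (e : ℕ) < j ∧ O.head e = v).card) rfl
    (by simpa using hz) (by
    intro j s' hj hi hF hI v
    rw [hb1.var1] at hj
    have ha : s'.arr a j = O.head ⟨j, hj⟩ := by
      rw [hF.2 a (by simp [Code.writesArr, hab.symm])]
      exact hh1 ⟨j, hj⟩
    simp only [Code.exec, Expr.eval, hi, ha, hI, Store.setVar_arr, Store.setArr_arr, true_and]
    split_ifs with hv
    · have hv' : v = O.head ⟨j, hj⟩ := Fin.ext hv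
      subst hv'
      rw [← Finset.card_insert_of_notMem (a := (⟨j, hj⟩ : Fin m)) (by simp)]
      congr 1
      ext e
      simp only [Finset.mem_insert, Finset.mem_filter, Finset.mem_univ, true_and]
      constructor
      · rintro (rfl | ⟨h1, h2⟩)
        exacts [⟨Nat.lt_succ_self _, rfl⟩, ⟨h1.trans (Nat.lt_succ_self _), h2⟩]
      · rintro ⟨h1, h2⟩
        rcases Nat.lt_succ_iff_lt_or_eq.mp h1 with h | h
        exacts [Or.inr ⟨h, h2⟩, Or.inl (Fin.ext h)]
    · congr 1
      ext e
      simp only [Finset.mem_filter, Finset.mem_univ, true_and]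
      refine ⟨fun ⟨h1, h2⟩ => ⟨h1.trans (Nat.lt_succ_self _), h2⟩, fun ⟨h1, h2⟩ => ⟨?_, h2⟩⟩
      rcases Nat.lt_succ_iff_lt_or_eq.mp h1 with h | h
      · exact h
      · refine absurd ?_ hv
        rw [← h2]
        exact congrArg (fun e => ((O.head e : Fin n) : ℕ)) (Fin.ext h))
  have hex : (headCounts a b).exec s = (Code.rep 65 1 (.put b (.get a (.var 65))
    (.add (.get b (.get a (.var 65))) (.const 1)))).exec s1 := rfl
  rw [hex, this v, hb1.var1, Orientation.headCount]
  congr 1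
  ext e
  simp

theorem exec_compareCounts {s : Store} (hb : Base H k s) (hh : HeadsAt O 1 s)
    (hh' : HeadsAt O' 4 s) :
    (∀ v, v ∈ marks n (compareCounts.exec s) 15 ↔ O.headCount v < O'.headCount v) ∧
    ∀ v, v ∈ marks n (compareCounts.exec s) 16 ↔ O'.headCount v < O.headCount v := by
  have c1 := exec_headCounts (a := 1) (b := 13) (by norm_num) (by norm_num) (by norm_num) hb hh
  set s1 := (headCounts 1 13).exec s with hs1
  have hF1 := Code.frame_exec (headCounts 1 13) s
  have hb1 : Base H k s1 := hb.of_frame hF1 rfl rfl rfl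
  have c2 := exec_headCounts (a := 4) (b := 14) (by norm_num) (by norm_num) (by norm_num) hb1
    (hh'.of_frame hF1 rfl)
  set s2 := (headCounts 4 14).exec s1 with hs2
  have hF2 := Code.frame_exec (headCounts 4 14) s1
  have hb2 : Base H k s2 := hb1.of_frame hF2 rfl rfl rfl
  have c1' : ∀ v : Fin n, s2.arr 13 v = O.headCount v := fun v => by rw [hF2.2 13 rfl]; exact c1 v
  have m1 := exec_mark (a := 15) (u := .sub (.get 14 (.var 34)) (.get 13 (.var 34))) hb2
    (fun v => O.headCount v < O'.headCount v) (by
    intro y s' h1 _ h3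
    simp only [Expr.eval, h1, h3 14 (by norm_num), h3 13 (by norm_num), c1', c2]
    omega)
  set p3 := mark 15 (.sub (.get 14 (.var 34)) (.get 13 (.var 34))) with hp3
  set s3 := p3.exec s2 with hs3
  have hF3 := Code.frame_exec p3 s2
  have c3 : ∀ v : Fin n, s3.arr 13 v = O.headCount v := fun v => by rw [hF3.2 13 rfl]; exact c1' v
  have c4 : ∀ v : Fin n, s3.arr 14 v = O'.headCount v := fun v => by rw [hF3.2 14 rfl]; exact c2 v
  have m2 := exec_mark (a := 16) (u := .sub (.get 13 (.var 34)) (.get 14 (.var 34)))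
    (hb2.of_frame hF3 rfl rfl rfl : Base H k s3) (fun v => O'.headCount v < O.headCount v) (by
    intro y s' h1 _ h3
    simp only [Expr.eval, h1, h3 14 (by norm_num), h3 13 (by norm_num), c3, c4]
    omega)
  have hF4 := Code.frame_exec (mark 16 (.sub (.get 13 (.var 34)) (.get 14 (.var 34)))) s3
  have hex : compareCounts.exec s =
      (mark 16 (.sub (.get 13 (.var 34)) (.get 14 (.var 34)))).exec s3 := rfl
  rw [hex]
  exact ⟨fun v => by rw [marks_of_frame hF4 rfl, m1], m2⟩

theorem exec_safeCell {s : Store} (hb : Base H k s) (hh : HeadsAt O 1 s) (h60 : s.var 60 = lev)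
    (hlev : lev ≤ k) {e : Fin m} {u : Fin n} (h63 : s.var 63 = e) (h64 : s.var 64 = u) :
    ∃ z, (safeCell.exec s).arr 12 = Function.update (s.arr 12) ((e : ℕ) * n + u) z ∧
      (z ≠ 0 ↔ Safe O lev e u) := by
  have hcell : ∀ s', Base H k s' → s'.var 63 = e → s'.var 64 = u →
      cell.eval s' = (e : ℕ) * n + u := by
    intro s' hb' h1 h2
    simp only [cell, Expr.eval, h1, h2, hb'.off e]
  have hval : Expr.eval s (.get 0 cell) ≠ 0 ↔ u ∈ H.edge e := by
    rw [← hb.inc e u, Expr.eval, hcell s hb h63 h64]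
  by_cases hu : u ∈ H.edge e
  swap
  · rw [safeCell, Code.exec_ite_neg (mt hval.mp hu)]
    refine ⟨0, ?_, by simp [Safe, hu]⟩
    simp [Code.exec, Expr.eval, hcell s hb h63 h64, Store.setArr]
  rw [safeCell, Code.exec_ite_pos (hval.mpr hu)]
  set s1 := (copyHeads 1 6).exec s with hs1
  have hF1 := Code.frame_exec (copyHeads 1 6) s
  have hb1 : Base H k s1 := hb.of_frame hF1 rfl rfl rfl
  have hh1 : HeadsAt O 6 s1 := exec_copyHeads (by norm_num) hb hh
  have v1 : ∀ x, x ≠ 24 → s1.var x = s.var x := fun x hx => hF1.1 x (by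
    simp [copyHeads, Code.writesVar, hx.symm])
  set s2 := (s1.setArr 6 e u).setVar 23 lev with hs2
  have hb2 : Base H k s2 := by
    have : Base H k (s1.setArr 6 e u) := ⟨hb1.var0, hb1.var1, hb1.var2, fun e v => by
      rw [Store.setArr_arr, if_neg (by simp)]; exact hb1.inc e v, fun e => by
      rw [Store.setArr_arr, if_neg (by simp)]; exact hb1.off e⟩
    exact this.setVar (by norm_num)
  have hh2 : HeadsAt (O.setHead e u hu) 6 s2 := hh1.setHead hu
  have h23 : s2.var 23 = lev := by simp [hs2]
  have v2 : ∀ x, x ≠ 23 → x ≠ 24 → s2.var x = s.var x := fun x h1 h2 => by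
    rw [hs2, Store.setVar_var, if_neg h1]
    exact v1 x h2
  have hct := exec_connTest (a := 6) (by norm_num) (by norm_num) hb2 hh2 (h23.trans_le hlev)
  rw [h23] at hct
  set s3 := (connTest 6).exec s2 with hs3
  have hF3 := Code.frame_exec (connTest 6) s2
  have hb3 : Base H k s3 := hb2.of_frame hF3 rfl rfl rfl
  have hex : (copyHeads 1 6 ;; .put 6 (.var 63) (.var 64) ;; .assign 23 (.var 60) ;;
    connTest 6 ;; .put 12 cell (.var 33)).exec s = (Code.put 12 cell (.var 33)).exec s3 := by
    simp only [Code.exec, Expr.eval, hs3, hs2, ← hs1, v1 63 (by norm_num), v1 64 (by norm_num), h63,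
      h64, Store.setArr_var, v1 60 (by norm_num), h60]
  rw [hex]
  refine ⟨s3.var 33, ?_, hct.trans ⟨fun h => ⟨hu, h⟩, fun ⟨_, h⟩ => h⟩⟩
  have e63 : s3.var 63 = e := by rw [hF3.1 63 rfl, v2 63 (by norm_num) (by norm_num), h63]
  have e64 : s3.var 64 = u := by rw [hF3.1 64 rfl, v2 64 (by norm_num) (by norm_num), h64]
  have e12 : s3.arr 12 = s.arr 12 := by
    rw [hF3.2 12 rfl, hs2, Store.setVar_arr, Store.setArr_arr_of_ne _ _ _ _ _ (by norm_num),
      hF1.2 12 rfl]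
  simp [Code.exec, Expr.eval, hcell s3 hb3 e63 e64, Store.setArr, e12]

theorem exec_safeTable {s : Store} (hb : Base H k s) (hh : HeadsAt O 1 s) (h60 : s.var 60 = lev)
    (hlev : lev ≤ k) (e : Fin m) (u : Fin n) :
    (safeTable.exec s).arr 12 ((e : ℕ) * n + u) ≠ 0 ↔ Safe O lev e u := by
  -- the cells with address below `c` are correct
  set R : ℕ → Store → Prop := fun c s => ∀ (e : Fin m) (u : Fin n), (e : ℕ) * n + u < c →
    (s.arr 12 ((e : ℕ) * n + u) ≠ 0 ↔ Safe O lev e u) with hR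
  have := Code.exec_rep (i := 63) (x := 1) (p := .rep 64 0 safeCell) s (fun j s' => R (j * n) s') rfl
    (fun e u h => absurd h (by omega)) (by
    intro j s' hj hi hF hI
    rw [hb.var1] at hj
    have hb' : Base H k s' := hb.of_frame hF rfl rfl rfl
    have hh' : HeadsAt O 1 s' := hh.of_frame hF rfl
    have h60' : s'.var 60 = lev := (hF.1 60 rfl).trans h60
    have := Code.exec_rep (i := 64) (x := 0) (p := safeCell) s' (fun j' s'' => R (j * n + j') s'')
      rfl (fun e u h => hI e u (by omega)) (by
      intro j' s'' hj' hi' hF' hI' e u heu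
      rw [hb'.var0] at hj'
      obtain ⟨z, hz, hz'⟩ := exec_safeCell (e := ⟨j, hj⟩) (u := ⟨j', hj'⟩)
        (hb'.of_frame hF' rfl rfl rfl) (hh'.of_frame hF' rfl) ((hF'.1 60 rfl).trans h60') hlev
        ((hF'.1 63 rfl).trans hi) hi'
      rw [Store.setVar_arr, hz]
      by_cases h : (e : ℕ) * n + u = j * n + j'
      · have he : e = ⟨j, hj⟩ := by
          refine Fin.ext ?_
          have h1 : ((e : ℕ) * n + u) / n = e := by
            rw [mul_comm, Nat.mul_add_div u.pos, Nat.div_eq_of_lt u.2, add_zero]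
          have h2 : (j * n + j') / n = j := by
            rw [mul_comm, Nat.mul_add_div u.pos, Nat.div_eq_of_lt hj', add_zero]
          rw [← h1, h, h2]
        subst he
        have hu : u = ⟨j', hj'⟩ := Fin.ext (by simpa using h)
        subst hu
        rw [Function.update_self]
        exact hz'
      · rw [Function.update_of_ne h]
        exact hI' e u (by omega))
    rw [hb'.var0] at this
    rw [Nat.succ_mul]
    exact this)
  refine this e u ?_
  rw [hb.var1]
  calc (e : ℕ) * n + u < (e : ℕ) * n + n := by have := u.2; omega
    _ = ((e : ℕ) + 1) * n := by rw [Nat.succ_mul]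
    _ ≤ m * n := Nat.mul_le_mul_right n e.2

/-- The output consists of the heads of orientations `S 0 = O₀, …, S ℓ = O`, each of which arises
from the preceding one by a reorientation that does not decrease the hyperarc-connectivity. -/
structure Recorded (k : ℕ) (O₀ : H.Orientation) (ℓ : ℕ) (O : H.Orientation) (s : Store) : Prop where
  base : Base H k s
  heads : HeadsAt O 1 s
  var3 : s.var 3 = ℓ
  var72 : s.var 72 = ℓ * m
  seq : ∃ S : ℕ → H.Orientation, S 0 = O₀ ∧ S ℓ = O ∧ (∀ i < ℓ, (S i).Reorients (S (i + 1))) ∧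
    (∀ i < ℓ, (S i).connectivity ≤ (S (i + 1)).connectivity) ∧
    ∀ i ≤ ℓ, ∀ e : Fin m, s.arr 2 (i * m + e) = (S i).head e

theorem Recorded.of_frame {ℓ : ℕ} {p : Code} {s s' : Store} (h : Recorded k O₀ ℓ O s)
    (hF : p.Frame s s') (hp : p.wf = true) (h0 : p.writesArr 0 = false)
    (h1 : p.writesArr 1 = false) (h2 : p.writesArr 2 = false) (h3 : p.writesArr 3 = false)
    (hv3 : p.writesVar 3 = false) (hv72 : p.writesVar 72 = false) : Recorded k O₀ ℓ O s' where
  base := h.base.of_frame hF hp h0 h3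
  heads := h.heads.of_frame hF h1
  var3 := (hF.1 3 hv3).trans h.var3
  var72 := (hF.1 72 hv72).trans h.var72
  seq := by rw [hF.2 2 h2]; exact h.seq

theorem Recorded.setVar {ℓ : ℕ} {s : Store} (h : Recorded k O₀ ℓ O s) {x v : ℕ} (hx : 3 < x)
    (hx' : x ≠ 72) : Recorded k O₀ ℓ O (s.setVar x v) where
  base := h.base.setVar hx.le
  heads := h.heads
  var3 := by rw [Store.setVar_var, if_neg hx.ne]; exact h.var3
  var72 := by rw [Store.setVar_var, if_neg hx'.symm]; exact h.var72
  seq := h.seq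

theorem exec_record {q : ℕ} {s : Store} (hb : Base H k s) (hh : HeadsAt O 1 s)
    (h72 : s.var 72 = q * m) :
    (∀ e : Fin m, (record.exec s).arr 2 (q * m + e) = O.head e) ∧
    ∀ x < q * m, (record.exec s).arr 2 x = s.arr 2 x := by
  have := Code.exec_rep (i := 73) (x := 1) (p := .put 2 (.add (.var 72) (.var 73))
    (.get 1 (.var 73))) s (fun j s' => (∀ e : Fin m, (e : ℕ) < j →
      s'.arr 2 (q * m + e) = O.head e) ∧ ∀ x < q * m, s'.arr 2 x = s.arr 2 x) rfl
    ⟨fun e he => absurd he (Nat.not_lt_zero _), fun x _ => rfl⟩ (by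
    rintro j s' hj hi hF ⟨h1, h2⟩
    have h72' : s'.var 72 = q * m := (hF.1 72 rfl).trans h72
    have ha : s'.arr 1 = s.arr 1 := hF.2 1 rfl
    simp only [Code.exec, Expr.eval, hi, h72', ha, Store.setVar_arr, Store.setArr_arr, true_and]
    refine ⟨fun e he => ?_, fun x hx => ?_⟩
    · rcases Nat.lt_succ_iff_lt_or_eq.mp he with h | h
      · rw [if_neg (by omega)]
        exact h1 e h
      · rw [if_pos (by omega), ← h]
        exact hh e
    · rw [if_neg (by omega)]
      exact h2 x hx)
  rw [hb.var1] at this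
  exact ⟨fun e => this.1 e e.2, this.2⟩

theorem exec_flip {ℓ : ℕ} {s : Store} (h : Recorded k O₀ ℓ O s) (h60 : s.var 60 = lev)
    (hlev : lev < k) {c u : Fin n} {e : Fin m} (h69 : s.var 69 = c) (h31 : s.arr 31 c = e)
    (h32 : s.arr 32 c = u) (hu : u ∈ H.edge e) (hne : u ≠ O.head e)
    (hconn : O.connectivity ≤ (O.setHead e u hu).connectivity) :
    Recorded k O₀ (ℓ + 1) (O.setHead e u hu) (flip.exec s) ∧ (flip.exec s).var 69 = u ∧
    ((flip.exec s).var 71 ≠ 0 ↔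
      s.var 71 ≠ 0 ∨ (O.setHead e u hu).IsHyperarcConnected (lev + 1)) := by
  set O₁ := O.setHead e u hu with hO₁
  set s1 := (((s.setArr 1 e u).setVar 69 u).setVar 3 (ℓ + 1)).setVar 72 ((ℓ + 1) * m) with hs1
  have hb1 : Base H k s1 := by
    have : Base H k (s.setArr 1 e u) := ⟨h.base.var0, h.base.var1, h.base.var2, fun e v => by
      rw [Store.setArr_arr, if_neg (by simp)]; exact h.base.inc e v, fun e => by
      rw [Store.setArr_arr, if_neg (by simp)]; exact h.base.off e⟩
    exact ((this.setVar (by norm_num)).setVar (by norm_num)).setVar (by norm_num)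
  have hh1 : HeadsAt O₁ 1 s1 := h.heads.setHead hu
  have h72 : s1.var 72 = (ℓ + 1) * m := by simp [hs1]
  have hrec := exec_record hb1 hh1 h72
  set s2 := record.exec s1 with hs2
  have hF2 := Code.frame_exec record s1
  have hb2 : Base H k s2 := hb1.of_frame hF2 rfl rfl rfl
  have hh2 : HeadsAt O₁ 1 s2 := hh1.of_frame hF2 rfl
  have hR : Recorded k O₀ (ℓ + 1) O₁ s2 := by
    refine ⟨hb2, hh2, (hF2.1 3 rfl).trans (by simp [hs1]), (hF2.1 72 rfl).trans h72, ?_⟩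
    obtain ⟨S, a1, a2, a3, a4, a5⟩ := h.seq
    have old : ∀ i ≤ ℓ, (fun i => if i ≤ ℓ then S i else O₁) i = S i := fun i hi => if_pos hi
    have new : (fun i => if i ≤ ℓ then S i else O₁) (ℓ + 1) = O₁ := if_neg (by omega)
    refine ⟨fun i => if i ≤ ℓ then S i else O₁, by rw [old 0 (Nat.zero_le _), a1], new, ?_, ?_, ?_⟩
    · intro i hi
      rw [old i (by omega)]
      rcases Nat.lt_succ_iff_lt_or_eq.mp hi with hi' | rfl
      · rw [old (i + 1) hi']
        exact a3 i hi'
      · rw [new, a2]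
        refine ⟨e, ?_, fun f hf => ?_⟩
        · simp [hO₁, Orientation.setHead, hne]
        · simp [hO₁, Orientation.setHead, hf]
    · intro i hi
      rw [old i (by omega)]
      rcases Nat.lt_succ_iff_lt_or_eq.mp hi with hi' | rfl
      · rw [old (i + 1) hi']
        exact a4 i hi'
      · rw [new, a2]
        exact hconn
    · intro i hi f
      rcases hi.lt_or_eq with hi' | rfl
      · rw [old i (by omega), hrec.2]
        · rw [hs1, Store.setVar_arr, Store.setVar_arr, Store.setVar_arr,
            Store.setArr_arr_of_ne _ _ _ _ _ (by norm_num)]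
          exact a5 i (by omega) f
        · calc i * m + f < i * m + m := by have := f.2; omega
            _ = (i + 1) * m := by rw [Nat.succ_mul]
            _ ≤ (ℓ + 1) * m := Nat.mul_le_mul_right m hi'
      · rw [new]
        exact hrec.1 f
  set s3 := s2.setVar 23 (lev + 1) with hs3
  have hR3 : Recorded k O₀ (ℓ + 1) O₁ s3 := hR.setVar (by norm_num) (by norm_num)
  have h23 : s3.var 23 = lev + 1 := by simp [hs3]
  have hct := exec_connTest (a := 1) (by norm_num) (by norm_num) hR3.base hR3.heads
    (h23.trans_le hlev)
  rw [h23] at hct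
  set s4 := (connTest 1).exec s3 with hs4
  have hF4 := Code.frame_exec (connTest 1) s3
  have hR4 : Recorded k O₀ (ℓ + 1) O₁ s4 := hR3.of_frame hF4 rfl rfl rfl rfl rfl rfl rfl
  have h60' : s2.var 60 = lev := (hF2.1 60 rfl).trans (by simp [hs1, h60])
  have h69' : s4.var 69 = u := by
    rw [hF4.1 69 rfl, hs3, Store.setVar_var, if_neg (by norm_num), hF2.1 69 rfl]
    simp [hs1]
  have h71' : s4.var 71 = s.var 71 := by
    rw [hF4.1 71 rfl, hs3, Store.setVar_var, if_neg (by norm_num), hF2.1 71 rfl]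
    simp [hs1]
  have hex : flip.exec s = (Code.ite (.var 33) (.assign 71 (.const 1)) .skip).exec s4 := by
    have e1 : ((((s.setArr 1 e u).setVar 69 u).setVar 3 (ℓ + 1)).setVar 72 (ℓ * m + m)) = s1 := by
      rw [hs1, Nat.succ_mul]
    simp only [flip, Code.exec, Expr.eval, h69, h31, h32, Store.setVar_var, Store.setArr_var,
      Store.setArr_arr]
    norm_num only [h69, h31, h32, h.var3, h.var72, h.base.var1, if_false, false_and, e1]
    rw [← hs2, h60']
    rfl
  rw [hex]
  by_cases hc : O₁.IsHyperarcConnected (lev + 1)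
  · rw [Code.exec_ite_pos (u := .var 33) (hct.mpr hc)]
    refine ⟨hR4.setVar (by norm_num) (by norm_num), ?_, ?_⟩
    · rw [Code.exec, Store.setVar_var, if_neg (by norm_num), h69']
    · simp [Code.exec, Expr.eval, hc]
  · rw [Code.exec_ite_neg (u := .var 33) (mt hct.mp hc), Code.exec]
    exact ⟨hR4, h69', by simp [h71', hc]⟩

/-- The walk along a safe hyperpath either stops when the hyperarc-connectivity has increased, or
reverses the whole hyperpath. The tightness condition in the invariant says that all sets of
in-degree `lev` containing the end of the hyperpath contain the vertices passed so far. -/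
theorem exec_walk {ℓ : ℕ} {s : Store} {S : Finset (Fin n)} (hn : 2 ≤ n) (h : Recorded k O₀ ℓ O s)
    (h60 : s.var 60 = lev) (hlev : lev < k) (hO : O.connectivity = lev) (h71 : s.var 71 = 0)
    (ht : SearchTree O (Safe O lev) S 30 s) (hS : marks n s 15 = S) {t : Fin n}
    (htw : t ∈ marks n s 30) (h69 : s.var 69 = t) :
    ∃ (Oc : H.Orientation) (ℓ' : ℕ), Recorded k O₀ ℓ' Oc (walk.exec s) ∧ ℓ' ≤ ℓ + n ∧
      (((walk.exec s).var 71 ≠ 0 ∧ Oc.connectivity = lev + 1) ∨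
        ((walk.exec s).var 71 = 0 ∧ Oc.connectivity = lev ∧ ∃ a ∈ S, O.Exchange Oc a t)) := by
  have hV : 2 ≤ Fintype.card (Fin n) := by rwa [Fintype.card_fin]
  have hOc : O.IsHyperarcConnected lev := (O.isHyperarcConnected_iff_le hV lev).mpr hO.ge
  have := Code.exec_rep (i := 68) (x := 0)
    (p := .ite (.get 15 (.var 69)) .skip (.ite (.var 71) .skip flip)) s
    (fun j s' => ∃ (Oc : H.Orientation) (ℓ' : ℕ), Recorded k O₀ ℓ' Oc s' ∧ ℓ' ≤ ℓ + j ∧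
      ((s'.var 71 ≠ 0 ∧ Oc.connectivity = lev + 1) ∨
        (s'.var 71 = 0 ∧ Oc.connectivity = lev ∧ ∃ c : Fin n, s'.var 69 = c ∧ c ∈ marks n s 30 ∧
          PartialReversal O (fun v => s.arr 30 v) t Oc c ∧
          (∀ W : Finset (Fin n), W ≠ Finset.univ → O.inDegree W = lev → t ∈ W → c ∈ W) ∧
          (c ∈ S ∨ ∃ D : Finset (Fin n), D.card = j ∧ ∀ d ∈ D, s.arr 30 c < s.arr 30 d)))) rfl
    ⟨O, ℓ, h.setVar (by norm_num) (by norm_num), le_rfl, Or.inr ⟨by simpa using h71, hO, t,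
      by simpa using h69, htw, ⟨.refl O t, fun _ _ => rfl⟩, fun _ _ _ h => h,
      Or.inr ⟨∅, rfl, by simp⟩⟩⟩ (by
    rintro j s' hj hi hF ⟨Oc, ℓ', h1, h2, h3⟩
    have h60' : s'.var 60 = lev := (hF.1 60 rfl).trans h60
    have w15 : s'.arr 15 = s.arr 15 := hF.2 15 rfl
    have w31 : s'.arr 31 = s.arr 31 := hF.2 31 rfl
    have w32 : s'.arr 32 = s.arr 32 := hF.2 32 rfl
    by_cases hS' : Expr.eval s' (.get 15 (.var 69)) ≠ 0
    · rw [Code.exec_ite_pos hS', Code.exec]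
      refine ⟨Oc, ℓ', h1.setVar (by norm_num) (by norm_num), by omega, h3.imp
        (fun h => ⟨by simpa using h.1, h.2⟩) ?_⟩
      rintro ⟨a1, a2, c, a3, a4, a5, a6, a7⟩
      refine ⟨by simpa using a1, a2, c, by simpa using a3, a4, a5, a6, Or.inl ?_⟩
      rw [← hS, mem_marks, ← w15, ← a3]
      exact hS'
    rw [Code.exec_ite_neg hS']
    rcases h3 with ⟨a1, a2⟩ | ⟨a1, a2, c, a3, a4, a5, a6, a7⟩
    · rw [Code.exec_ite_pos (u := .var 71) a1, Code.exec]
      exact ⟨Oc, ℓ', h1.setVar (by norm_num) (by norm_num), by omega,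
        Or.inl ⟨by simpa using a1, a2⟩⟩
    rw [Code.exec_ite_neg (u := .var 71) (not_not.mpr a1)]
    have hcS : c ∉ S := by
      intro hc
      rw [← hS, mem_marks, ← w15, ← a3] at hc
      exact hS' hc
    obtain ⟨D, hD, hD'⟩ := a7.resolve_left hcS
    obtain ⟨e, u, p1, p2, p3, ⟨hu, p4⟩, p5, p6⟩ := ht.pred c a4 hcS
    have hhead : Oc.head e = c := by rw [a5.heads e (by rw [p3]), p3]
    have hstep := a5.step p3 hu p6
    have htight : ∀ W : Finset (Fin n), W ≠ Finset.univ → O.inDegree W = lev → t ∈ W → u ∈ W :=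
      fun W hW hWl htW => Orientation.tight_of_isHyperarcConnected_setHead p4 hW hWl
        (p3.symm ▸ a6 W hW hWl htW)
    have hc1 : lev ≤ (Oc.setHead e u hu).connectivity :=
      (Orientation.isHyperarcConnected_iff_le _ hV _).mp
        (hstep.exch.isHyperarcConnected hOc htight)
    have hc2 : (Oc.setHead e u hu).connectivity ≤ lev + 1 :=
      a2 ▸ (Oc.exchange_setHead e u hu).connectivity_le hV
    obtain ⟨f1, f2, f3⟩ := exec_flip h1 h60' hlev a3 (by rw [w31]; exact p1)
      (by rw [w32]; exact p2) hu (by rw [hhead]; rintro rfl; exact lt_irrefl _ p6) (a2 ▸ hc1)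
    refine ⟨_, ℓ' + 1, f1.setVar (by norm_num) (by norm_num), by omega, ?_⟩
    rw [Orientation.isHyperarcConnected_iff_le _ hV] at f3
    by_cases hdone : lev + 1 ≤ (Oc.setHead e u hu).connectivity
    · exact Or.inl ⟨by simpa using f3.mpr (Or.inr hdone), le_antisymm hc2 hdone⟩
    · refine Or.inr ⟨?_, by omega, u, by simpa using f2, p5, hstep, htight,
        Or.inr ⟨insert c D, ?_, ?_⟩⟩
      · have : (flip.exec s').var 71 = 0 := by
          by_contra hne
          exact (f3.mp hne).elim (fun h => h a1) hdone
        simpa using this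
      · rw [Finset.card_insert_of_notMem, hD]
        exact fun hcD => lt_irrefl _ (hD' c hcD)
      · intro d hd
        rcases Finset.mem_insert.mp hd with rfl | hd
        · exact p6
        · exact p6.trans (hD' d hd))
  rw [h.base.var0] at this
  obtain ⟨Oc, ℓ', h1, h2, h3⟩ := this
  refine ⟨Oc, ℓ', h1, h2, h3.imp id ?_⟩
  rintro ⟨a1, a2, c, -, -, a5, -, a7⟩
  refine ⟨a1, a2, c, ?_, a5.exch⟩
  rcases a7 with h5 | ⟨D, hD, hD'⟩
  · exact h5
  · have hu := Finset.eq_univ_of_card D (by rw [hD, Fintype.card_fin])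
    exact absurd (hD' c (hu ▸ Finset.mem_univ c)) (lt_irrefl _)

/-- One hyperpath: either the hyperarc-connectivity increases, or the head counts get closer to those
of the target. -/
theorem exec_approach {ℓ : ℕ} {s : Store} (hn : 2 ≤ n) (h : Recorded k O₀ ℓ O s)
    (h4 : HeadsAt O' 4 s) (h60 : s.var 60 = lev) (hlev : lev < k) (hO : O.connectivity = lev)
    (hO' : O'.IsHyperarcConnected (lev + 1)) (h71 : s.var 71 = 0) :
    ∃ (Oc : H.Orientation) (ℓ' : ℕ), Recorded k O₀ ℓ' Oc (approach.exec s) ∧ ℓ' ≤ ℓ + n ∧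
      1 ≤ O.headDist O' ∧
      (((approach.exec s).var 71 ≠ 0 ∧ Oc.connectivity = lev + 1) ∨
        ((approach.exec s).var 71 = 0 ∧ Oc.connectivity = lev ∧
          Oc.headDist O' + 1 = O.headDist O')) := by
  have hV : 2 ≤ Fintype.card (Fin n) := by rwa [Fintype.card_fin]
  have hOc : O.IsHyperarcConnected lev := (O.isHyperarcConnected_iff_le hV lev).mpr hO.ge
  have hdist : O.headDist O' ≠ 0 := by
    intro h0
    have : O.IsHyperarcConnected (lev + 1) := by
      rw [Orientation.isHyperarcConnected_iff] at hO' ⊢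
      intro X h1 h2
      rw [Orientation.inDegree_congr (Orientation.headDist_eq_zero h0)]
      exact hO' X h1 h2
    have := (O.isHyperarcConnected_iff_le hV _).mp this
    omega
  have hcmp := exec_compareCounts h.base h.heads h4
  set s4 := compareCounts.exec s with hs4
  have hF4 : compareCounts.Frame s s4 := Code.frame_exec compareCounts s
  clear_value s4
  have h4' : Recorded k O₀ ℓ O s4 := h.of_frame hF4 rfl rfl rfl rfl rfl rfl rfl
  have h60' : s4.var 60 = lev := (hF4.1 60 rfl).trans h60
  have htab := exec_safeTable h4'.base h4'.heads h60' hlev.le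
  set s5 := safeTable.exec s4 with hs5
  have hF5 : safeTable.Frame s4 s5 := Code.frame_exec safeTable s4
  clear_value s5
  have h5 : Recorded k O₀ ℓ O s5 := h4'.of_frame hF5 rfl rfl rfl rfl rfl rfl rfl
  set S : Finset (Fin n) := marks n s5 15 with hS
  have mS : ∀ v, v ∈ S ↔ O.headCount v < O'.headCount v := fun v => by
    rw [hS, marks_of_frame (a := 15) hF5 rfl, hcmp.1]
  have mT : ∀ v, v ∈ marks n s5 16 ↔ O'.headCount v < O.headCount v := fun v => by
    rw [marks_of_frame (a := 16) hF5 rfl, hcmp.2]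
  obtain ⟨t1, t2⟩ := exec_search (g := 1) (ko := 12) (A := 15) (w := 30) (by norm_num)
    (by norm_num) (by norm_num) (by norm_num)
    (⟨h5.base, h5.heads, htab, hS.symm⟩ : SearchCtx H k O (Safe O lev) 1 12 15 S s5)
  set s6 := (search 1 12 15 30).exec s5 with hs6
  have hF6 : (search 1 12 15 30).Frame s5 s6 := Code.frame_exec (search 1 12 15 30) s5
  clear_value s6
  have h6 : Recorded k O₀ ℓ O s6 := h5.of_frame hF6 rfl rfl rfl rfl rfl rfl rfl
  have hpick := exec_pick (A := 16) (B := 30) h6.base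
  set s7 := (pick 16 30).exec s6 with hs7
  have hF7 : (pick 16 30).Frame s6 s7 := Code.frame_exec (pick 16 30) s6
  clear_value s7
  have h7 : Recorded k O₀ ℓ O s7 := h6.of_frame hF7 rfl rfl rfl rfl rfl rfl rfl
  have mT' : ∀ v, v ∈ marks n s6 16 ↔ O'.headCount v < O.headCount v := fun v => by
    rw [marks_of_frame (a := 16) hF6 rfl, mT]
  obtain ⟨v, hv, hv'⟩ := Orientation.exists_mem_of_safe_closed hOc hO' hdist
    (fun v hv => t1.src ((mS v).mpr hv))
    (fun e u hu huY hsafe => t2 e u ⟨hu, hsafe⟩ huY)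
  obtain ⟨t, ht16, htT, htR⟩ := hpick.resolve_left fun hp =>
    Finset.disjoint_left.mp hp.2 ((mT' v).mpr hv') hv
  set s8 := s7.setVar 69 t with hs8
  have h8 : Recorded k O₀ ℓ O s8 := h7.setVar (by norm_num) (by norm_num)
  have e60 : s8.var 60 = lev := by
    rw [hs8, Store.setVar_var, if_neg (by norm_num), hF7.1 60 rfl, hF6.1 60 rfl, hF5.1 60 rfl, h60']
  have e71 : s8.var 71 = 0 := by
    rw [hs8, Store.setVar_var, if_neg (by norm_num), hF7.1 71 rfl, hF6.1 71 rfl, hF5.1 71 rfl,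
      hF4.1 71 rfl, h71]
  have a30 : s7.arr 30 = s6.arr 30 := hF7.2 30 rfl
  have a31 : s7.arr 31 = s6.arr 31 := hF7.2 31 rfl
  have a32 : s7.arr 32 = s6.arr 32 := hF7.2 32 rfl
  have ht7 : SearchTree O (Safe O lev) S 30 s7 := t1.congr a30 a31 a32
  have ht8 : SearchTree O (Safe O lev) S 30 s8 := ht7.congr rfl rfl rfl
  have hS7 : marks n s7 15 = S := (marks_of_frame (a := 15) hF7 rfl).trans
    (marks_of_frame (a := 15) hF6 rfl)
  have hS8 : marks n s8 15 = S := by rw [hs8, marks_setVar, hS7]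
  have htw : t ∈ marks n s8 30 := by
    rw [hs8, marks_setVar, marks_of_frame (a := 30) hF7 rfl]
    exact htR
  obtain ⟨Oc, ℓ', r1, r2, r3⟩ := exec_walk hn h8 e60 hlev hO e71 ht8 hS8 htw (by simp [hs8])
  have hex : approach.exec s = walk.exec s8 := by
    rw [approach, Code.exec_ite_neg (u := .var 71) (not_not.mpr h71), hs8, ← ht16]
    simp only [Code.exec, Expr.eval, hs7, hs6, hs5, hs4]
  rw [hex]
  have hdist' : 1 ≤ O.headDist O' := Nat.one_le_iff_ne_zero.mpr hdist
  rcases r3 with r3 | ⟨a1, a2, a, ha, hex'⟩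
  · exact ⟨Oc, ℓ', r1, r2, hdist', Or.inl r3⟩
  · exact ⟨Oc, ℓ', r1, r2, hdist', Or.inr ⟨a1, a2,
      hex'.headDist_lt ((mS a).mp ha) ((mT' t).mp htT)⟩⟩

end Walk

end RAM

namespace RAM

open MultiHypergraph

/-! ### The program -/

/-- The code that raises the hyperarc-connectivity from the value of variable `60`, if it is equal
to it, by one. -/
def level : Code :=
  .assign 23 (.add (.var 60) (.const 1)) ;; connTest 1 ;;
  .ite (.var 33) .skip (findTarget ;; .assign 71 (.const 0) ;; .rep 61 0 (.rep 62 0 approach))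

/-- The code that tabulates the multiples of `n` and outputs the initial orientation. -/
def initialise : Code :=
  .rep 81 1 (.put 3 (.var 81) (.var 80) ;; .assign 80 (.add (.var 80) (.var 0))) ;; record

/-- The code that raises the hyperarc-connectivity to `k`. -/
def augment : Code := initialise ;; .rep 60 2 level

section Main

variable {n m : ℕ} {H : MultiHypergraph (Fin n) (Fin m)} {k lev : ℕ} {O₀ O O' : H.Orientation}

/-- The distance of the head counts is at most `n (n - 1)`, and drops with every hyperpath; so `n ^ 2`
rounds reach the goal, with at most `n` reorientations in each of the first `n (n - 1)` of them. -/
theorem exec_approach_loop {ℓ : ℕ} {s : Store} (hn : 2 ≤ n) (h : Recorded k O₀ ℓ O s)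
    (h4 : HeadsAt O' 4 s) (h60 : s.var 60 = lev) (hlev : lev < k) (hO : O.connectivity = lev)
    (hO' : O'.IsHyperarcConnected (lev + 1)) (hd : O.headDist O' ≤ n * (n - 1))
    (h71 : s.var 71 = 0) :
    ∃ (O₁ : H.Orientation) (ℓ' : ℕ),
      Recorded k O₀ ℓ' O₁ ((Code.rep 61 0 (.rep 62 0 approach)).exec s) ∧
      O₁.connectivity = lev + 1 ∧ ℓ' ≤ ℓ + n ^ 3 := by
  have hcube : n * (n * (n - 1)) + n * n = n ^ 3 := by
    obtain ⟨q, rfl⟩ := Nat.exists_eq_succ_of_ne_zero (show n ≠ 0 by omega)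
    simp only [Nat.succ_eq_add_one, Nat.add_sub_cancel]
    ring
  set R : ℕ → Store → Prop := fun c s => ∃ (O₁ : H.Orientation) (ℓ₁ : ℕ), Recorded k O₀ ℓ₁ O₁ s ∧
    HeadsAt O' 4 s ∧ s.var 60 = lev ∧
    ((s.var 71 ≠ 0 ∧ O₁.connectivity = lev + 1 ∧ ℓ₁ ≤ ℓ + n ^ 3) ∨
      (s.var 71 = 0 ∧ O₁.connectivity = lev ∧ O₁.headDist O' + c ≤ n * (n - 1) ∧
        ℓ₁ + n * O₁.headDist O' ≤ ℓ + n * (n * (n - 1)))) with hR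
  have rset : ∀ x, 3 < x → x ≠ 60 → x ≠ 71 → x ≠ 72 → ∀ c s v, R c s → R c (s.setVar x v) := by
    rintro x h3 h60 h71 h72 c s v ⟨O₁, ℓ₁, a1, a2, a3, a4⟩
    refine ⟨O₁, ℓ₁, a1.setVar h3 h72, a2, ?_, ?_⟩
    · rw [Store.setVar_var, if_neg h60.symm, a3]
    · rw [Store.setVar_var, if_neg h71.symm]
      exact a4
  have step : ∀ c s, R c s → R (c + 1) (approach.exec s) := by
    rintro c s ⟨O₁, ℓ₁, a1, a2, a3, a4⟩
    rcases a4 with a4 | ⟨a4, a5, a6, a7⟩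
    · rw [approach, Code.exec_ite_pos (u := .var 71) a4.1, Code.exec]
      exact ⟨O₁, ℓ₁, a1, a2, a3, Or.inl a4⟩
    · obtain ⟨Oc, ℓ', b1, b2, b3, b4⟩ := exec_approach hn a1 a2 a3 hlev a5 hO' a4
      have hF : approach.Frame s (approach.exec s) := Code.frame_exec approach s
      have hle : n * 1 ≤ n * O₁.headDist O' := Nat.mul_le_mul_left n b3
      refine ⟨Oc, ℓ', b1, a2.of_frame hF rfl, (hF.1 60 rfl).trans a3, ?_⟩
      rcases b4 with ⟨b4, b5⟩ | ⟨b4, b5, b6⟩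
      · exact Or.inl ⟨b4, b5, by omega⟩
      · refine Or.inr ⟨b4, b5, by omega, ?_⟩
        rw [← b6, Nat.mul_add, mul_one] at a7
        omega
  have rbase : ∀ c s, R c s → s.var 0 = n := fun c s ⟨_, _, h, _⟩ => h.base.var0
  have row : ∀ c s, R c s → R (c + n) ((Code.rep 62 0 approach).exec s) := by
    intro c s h
    have := Code.exec_rep_count (i := 62) (x := 0) rfl R (rset 62 (by norm_num) (by norm_num)
      (by norm_num) (by norm_num)) step h
    rwa [rbase c s h, mul_one] at this
  have h0 : R 0 s := ⟨O, ℓ, h, h4, h60, Or.inr ⟨h71, hO, by omega, by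
    have := Nat.mul_le_mul_left n hd
    omega⟩⟩
  have := Code.exec_rep_count (i := 61) (x := 0) rfl R (rset 61 (by norm_num) (by norm_num)
    (by norm_num) (by norm_num)) row h0
  rw [rbase _ _ h0, zero_add] at this
  obtain ⟨O₁, ℓ₁, a1, -, -, a4⟩ := this
  rcases a4 with a4 | ⟨-, -, a6, -⟩
  · exact ⟨O₁, ℓ₁, a1, a4.2⟩
  · exfalso
    have : n * n = n * (n - 1) + n := by
      obtain ⟨q, rfl⟩ := Nat.exists_eq_succ_of_ne_zero (show n ≠ 0 by omega)
      simp [Nat.mul_succ]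
    omega

theorem exec_level {ℓ : ℕ} {s : Store} (hn : 2 ≤ n) (h : Recorded k O₀ ℓ O s)
    (h60 : s.var 60 = lev) (hlev : lev < k) (hH : H.IsPartitionConnected (lev + 1))
    (hO : O.connectivity = max lev O₀.connectivity)
    (hℓ : ℓ ≤ (lev - O₀.connectivity) * n ^ 3) :
    ∃ (O₁ : H.Orientation) (ℓ' : ℕ), Recorded k O₀ ℓ' O₁ (level.exec s) ∧
      O₁.connectivity = max (lev + 1) O₀.connectivity ∧
      ℓ' ≤ (lev + 1 - O₀.connectivity) * n ^ 3 := by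
  have hV : 2 ≤ Fintype.card (Fin n) := by rwa [Fintype.card_fin]
  set s1 := s.setVar 23 (lev + 1) with hs1
  have h1 : Recorded k O₀ ℓ O s1 := h.setVar (by norm_num) (by norm_num)
  have h23 : s1.var 23 = lev + 1 := by simp [hs1]
  have hct := exec_connTest (a := 1) (by norm_num) (by norm_num) h1.base h1.heads
    (h23.trans_le hlev)
  rw [h23, O.isHyperarcConnected_iff_le hV] at hct
  set s2 := (connTest 1).exec s1 with hs2
  have hF2 : (connTest 1).Frame s1 s2 := Code.frame_exec (connTest 1) s1
  have h60' : s2.var 60 = lev := (hF2.1 60 rfl).trans (by simp [hs1, h60])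
  have h2 : Recorded k O₀ ℓ O s2 := h1.of_frame hF2 rfl rfl rfl rfl rfl rfl rfl
  have hex : level.exec s = (Code.ite (.var 33) .skip
      (findTarget ;; .assign 71 (.const 0) ;; .rep 61 0 (.rep 62 0 approach))).exec s2 := by
    rw [hs2, hs1, ← h60]
    rfl
  clear_value s2
  rw [hex]
  by_cases hc : lev + 1 ≤ O.connectivity
  · rw [Code.exec_ite_pos (u := .var 33) (hct.mpr hc), Code.exec]
    refine ⟨O, ℓ, h2, by omega, hℓ.trans (Nat.mul_le_mul_right _ (by omega))⟩
  rw [Code.exec_ite_neg (u := .var 33) (mt hct.mp hc)]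
  have hOlev : O.connectivity = lev := by omega
  obtain ⟨O', t1, t2, t3⟩ := exec_findTarget h2.base h2.heads h60' hlev (by omega) hH
    ((O.isHyperarcConnected_iff_le hV lev).mpr hOlev.ge)
  have hex' : (findTarget ;; .assign 71 (.const 0) ;; .rep 61 0 (.rep 62 0 approach)).exec s2 =
    (Code.rep 61 0 (.rep 62 0 approach)).exec ((findTarget.exec s2).setVar 71 0) := rfl
  rw [hex']
  have hF3 : findTarget.Frame s2 (findTarget.exec s2) := Code.frame_exec findTarget s2
  generalize findTarget.exec s2 = s3 at *
  have h3 : Recorded k O₀ ℓ O s3 := h2.of_frame hF3 rfl rfl rfl rfl rfl rfl rfl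
  have h60'' : s3.var 60 = lev := (hF3.1 60 rfl).trans h60'
  obtain ⟨O₁, ℓ', r1, r2, r3⟩ := exec_approach_loop (s := s3.setVar 71 0) hn
    (h3.setVar (by norm_num) (by norm_num)) t1 (by simpa using h60'') hlev hOlev t2 t3 (by simp)
  refine ⟨O₁, ℓ', r1, by omega, ?_⟩
  have : lev + 1 - O₀.connectivity = lev - O₀.connectivity + 1 := by omega
  rw [this, Nat.add_mul, one_mul]
  omega

theorem exec_initialise (O : H.Orientation) (k : ℕ) :
    Recorded k O 0 O (initialise.exec (input O k)) := by
  set p : Code := .rep 81 1 (.put 3 (.var 81) (.var 80) ;; .assign 80 (.add (.var 80) (.var 0)))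
    with hp
  have hF : p.Frame (input O k) (p.exec (input O k)) := Code.frame_exec p _
  have hv : ∀ x, x < 3 → (p.exec (input O k)).var x = (input O k).var x := fun x hx =>
    hF.1 x (Code.writesVar_of_wf rfl hx)
  have hb : Base H k (p.exec (input O k)) := by
    refine ⟨hv 0 (by norm_num), hv 1 (by norm_num), hv 2 (by norm_num), fun e v => ?_, ?_⟩
    · rw [hF.2 0 rfl]
      have key : (∃ (e' : Fin m) (v' : Fin n), (e : ℕ) * n + v = (e' : ℕ) * n + v' ∧
          v' ∈ H.edge e') ↔ v ∈ H.edge e := by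
        refine ⟨?_, fun h => ⟨e, v, rfl, h⟩⟩
        rintro ⟨e', v', h1, h2⟩
        have he : e = e' := by
          refine Fin.ext ?_
          have a1 : ((e : ℕ) * n + v) / n = e := by
            rw [mul_comm, Nat.mul_add_div v.pos, Nat.div_eq_of_lt v.2, add_zero]
          have a2 : ((e' : ℕ) * n + v') / n = e' := by
            rw [mul_comm, Nat.mul_add_div v.pos, Nat.div_eq_of_lt v'.2, add_zero]
          rw [← a1, h1, a2]
        subst he
        rwa [show v = v' from Fin.ext (by omega)]
      simp only [input, if_true, key]
      split_ifs with h <;> simp [h]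
    · have := Code.exec_rep (i := 81) (x := 1) (p := .put 3 (.var 81) (.var 80) ;;
        .assign 80 (.add (.var 80) (.var 0))) (input O k) (fun j s' => s'.var 80 = j * n ∧
        ∀ e : Fin m, (e : ℕ) < j → s'.arr 3 e = (e : ℕ) * n) rfl
        ⟨by simp [input], fun e he => absurd he (Nat.not_lt_zero _)⟩ (by
        rintro j s' hj hi hF ⟨h1, h2⟩
        have hn : s'.var 0 = n := hF.1 0 rfl
        simp only [Code.exec, Expr.eval, hi, h1, hn, Store.setArr_var, Store.setVar_arr,
          Store.setVar_var, Store.setArr_arr, true_and]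
        refine ⟨by norm_num [Nat.succ_mul], fun e he => ?_⟩
        rcases Nat.lt_succ_iff_lt_or_eq.mp he with h | h
        · rw [if_neg h.ne]
          exact h2 e h
        · rw [if_pos h, h])
      exact fun e => this.2 e (by simp [input])
  have hh : HeadsAt O 1 (p.exec (input O k)) := by
    intro e
    rw [hF.2 1 rfl]
    simp [input]
  have h72 : (p.exec (input O k)).var 72 = 0 * m := by
    rw [hF.1 72 rfl]
    simp [input]
  have h3 : (p.exec (input O k)).var 3 = 0 := by
    rw [hF.1 3 rfl]
    simp [input]
  have hex : initialise.exec (input O k) = record.exec (p.exec (input O k)) := rfl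
  rw [hex]
  generalize p.exec (input O k) = s at *
  have hrec := exec_record hb hh h72
  have hF2 : record.Frame s (record.exec s) := Code.frame_exec record s
  refine ⟨hb.of_frame hF2 rfl rfl rfl, hh.of_frame hF2 rfl, (hF2.1 3 rfl).trans h3,
    (hF2.1 72 rfl).trans h72, fun _ => O, rfl, rfl, by simp, by simp, fun i hi e => ?_⟩
  obtain rfl : i = 0 := by omega
  exact hrec.1 e

theorem exec_augment (hn : 2 ≤ n) (hH : H.IsPartitionConnected k) (O : H.Orientation) :
    ∃ (ℓ : ℕ) (S : ℕ → H.Orientation), IsOutput (augment.exec (input O k)) ℓ S ∧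
      O.IsAugmentation k ℓ S := by
  have h0 := exec_initialise O k
  set s := initialise.exec (input O k) with hs
  have := Code.exec_rep (i := 60) (x := 2) (p := level) s (fun j s' => ∃ (O₁ : H.Orientation)
    (ℓ : ℕ), Recorded k O ℓ O₁ s' ∧ O₁.connectivity = max j O.connectivity ∧
    ℓ ≤ (j - O.connectivity) * n ^ 3) rfl
    ⟨O, 0, h0.setVar (by norm_num) (by norm_num), by simp, by simp⟩ (by
    rintro j s' hj hi hF ⟨O₁, ℓ, h1, h2, h3⟩
    rw [h0.base.var2] at hj
    obtain ⟨O₂, ℓ', r1, r2, r3⟩ := exec_level hn h1 hi hj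
      (fun P hP => (Nat.mul_le_mul_right _ hj).trans (hH P hP)) h2 h3
    exact ⟨O₂, ℓ', r1.setVar (by norm_num) (by norm_num), r2, r3⟩)
  rw [h0.base.var2] at this
  obtain ⟨O₁, ℓ, h1, h2, h3⟩ := this
  obtain ⟨S, a1, a2, a3, a4, a5⟩ := h1.seq
  exact ⟨ℓ, S, ⟨h1.var3, a5⟩, a1, a3, a4, by rw [a2, h2], by rwa [Fintype.card_fin]⟩

/-- The program only loops up to `n`, `m` or `k`. -/
theorem wf_augment : augment.wf = true := rfl

end Main

end RAM

namespace MultiHypergraph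

/-- Compare the partition into singletons: `k` is bounded by the size of the hypergraph, so that loops
up to `k` take polynomial time. -/
theorem IsPartitionConnected.le_card {V E : Type*} [Fintype V] [DecidableEq V] [Fintype E]
    {H : MultiHypergraph V E} {k : ℕ} (hV : 2 ≤ Fintype.card V) (h : H.IsPartitionConnected k) :
    k ≤ Fintype.card E := by
  have hbot : (⊥ : Finpartition (Finset.univ : Finset V)).parts.card = Fintype.card V := by
    rw [Finpartition.card_bot, Finset.card_univ]
  have h1 := h ⊥ (by rwa [hbot])
  rw [hbot] at h1
  calc k = k * 1 := (mul_one k).symm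
    _ ≤ k * Fintype.card V := Nat.mul_le_mul_left k (by omega)
    _ ≤ H.crossing ⊥ := h1
    _ ≤ Fintype.card E := Finset.card_le_univ _

end MultiHypergraph

namespace RAM

open MultiHypergraph

theorem exists_program : ∃ (prog : Program) (T : Polynomial ℕ),
    ∀ (n m : ℕ) (H : MultiHypergraph (Fin n) (Fin m)) (k : ℕ),
      2 ≤ n → H.IsPartitionConnected k →
      ∀ O : H.Orientation, ∃ (t : ℕ) (s : Store) (ℓ : ℕ) (S : ℕ → H.Orientation),
        Runs prog (input O k) t s ∧ t ≤ T.eval H.size ∧ IsOutput s ℓ S ∧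
        O.IsAugmentation k ℓ S := by
  refine ⟨augment.compile, augment.time, fun n m H k hn hH O => ?_⟩
  obtain ⟨ℓ, S, h1, h2⟩ := exec_augment hn hH O
  have hk := hH.le_card (by rwa [Fintype.card_fin])
  have hsize : n ≤ H.size ∧ m ≤ H.size ∧ k ≤ H.size := by
    simp only [MultiHypergraph.size, Fintype.card_fin] at hk ⊢
    omega
  obtain ⟨t, ht, htT⟩ := Code.runs_compile augment wf_augment H.size (input O k) (by
    intro y hy
    simp only [input]
    split_ifs
    exacts [hsize.1, hsize.2.1, hsize.2.2, Nat.zero_le _])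
  exact ⟨t, _, ℓ, S, ht, htT, h1, h2⟩

end RAM

namespace MultiHypergraph

/-! ### Relabelling vertices and hyperedges -/

section Relabel

variable {V E V' E' : Type*} (H : MultiHypergraph V E) (a : V ≃ V') (b : E ≃ E')

/-- The hypergraph with vertices and hyperedges renamed by `a` and `b`. -/
def relabel : MultiHypergraph V' E' where
  edge f := (H.edge (b.symm f)).map a.toEmbedding

variable {H}

theorem IsPartitionConnected.relabel [Fintype V] [DecidableEq V] [Fintype E] [Fintype V']
    [DecidableEq V'] [Fintype E'] {k : ℕ} (h : H.IsPartitionConnected k) :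
    (H.relabel a b).IsPartitionConnected k := by
  intro P' hP'
  let e : Finset V' ≃o Finset V :=
    { toEquiv := a.symm.finsetCongr
      map_rel_iff' := by simp }
  have he : e Finset.univ = Finset.univ := by
    ext v
    simp [e]
  set P : Finpartition (Finset.univ : Finset V) := (P'.map e).copy he with hP
  have hparts : ∀ A, A ∈ P.parts ↔ ∃ A' ∈ P'.parts, A'.map a.symm.toEmbedding = A := by
    exact fun A => Finset.mem_map
  have hcard : P.parts.card = P'.parts.card := by
    exact Finset.card_map _
  rw [← hcard] at hP' ⊢
  refine (h P hP').trans (Finset.card_le_card_of_injOn b ?_ b.injective.injOn)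
  intro f hf
  simp only [Finset.coe_filter, Finset.mem_univ, true_and, Set.mem_ofPred_eq] at hf ⊢
  obtain ⟨A, hA, B, hB, hAB, hfA, hfB⟩ := hf
  obtain ⟨A', hA', rfl⟩ := (hparts A).mp hA
  obtain ⟨B', hB', rfl⟩ := (hparts B).mp hB
  have key : ∀ C' : Finset V', (H.edge f ∩ C'.map a.symm.toEmbedding).Nonempty →
      ((H.relabel a b).edge (b f) ∩ C').Nonempty := by
    rintro C' ⟨v, hv⟩
    rw [Finset.mem_inter] at hv
    refine ⟨a v, Finset.mem_inter.mpr ⟨?_, ?_⟩⟩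
    · simpa [MultiHypergraph.relabel] using hv.1
    · obtain ⟨w, hw, hwv⟩ := Finset.mem_map.mp hv.2
      rw [← hwv]
      simpa using hw
  exact ⟨A', hA', B', hB', fun h => hAB (by rw [h]), key A' hfA, key B' hfB⟩

namespace Orientation

variable {a b}

/-- The orientation of the renamed hypergraph that corresponds to `O`. -/
def relabel (a : V ≃ V') (b : E ≃ E') (O : H.Orientation) : (H.relabel a b).Orientation where
  head f := a (O.head (b.symm f))
  head_mem f := by simpa [MultiHypergraph.relabel] using O.head_mem (b.symm f)

/-- The orientation that corresponds to the orientation `O` of the renamed hypergraph. -/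
def unlabel (O : (H.relabel a b).Orientation) : H.Orientation where
  head e := a.symm (O.head (b e))
  head_mem e := by
    obtain ⟨v, hv, hv'⟩ := Finset.mem_map.mp (O.head_mem (b e))
    rw [← hv']
    simpa using hv

theorem unlabel_relabel (O : H.Orientation) : (O.relabel a b).unlabel = O := by
  ext e
  simp [relabel, unlabel]

variable [DecidableEq V] [Fintype E] [DecidableEq V'] [Fintype E']

theorem outDegree_unlabel (O : (H.relabel a b).Orientation) (X : Finset V) :
    O.unlabel.outDegree X = O.outDegree (X.map a.toEmbedding) := by
  refine Finset.card_bijective b b.bijective fun e => ?_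
  simp only [Finset.mem_filter, Finset.mem_univ, true_and]
  refine and_congr ?_ ?_
  · simp [unlabel]
  · constructor
    · rintro ⟨v, hv⟩
      refine ⟨a v, ?_⟩
      simpa [tail, unlabel, MultiHypergraph.relabel, Equiv.eq_symm_apply] using hv
    · rintro ⟨w, hw⟩
      refine ⟨a.symm w, ?_⟩
      simpa [tail, unlabel, MultiHypergraph.relabel] using hw

variable [Fintype V] [Fintype V']

theorem connectivity_unlabel (O : (H.relabel a b).Orientation) :
    O.unlabel.connectivity = O.connectivity := by
  have : ∀ k, O.unlabel.IsHyperarcConnected k ↔ O.IsHyperarcConnected k := by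
    intro k
    refine (Equiv.finsetCongr a).forall_congr fun {X} => ?_
    have hX : X.map a.toEmbedding = Finset.univ ↔ X = Finset.univ := by
      rw [← Finset.map_univ_equiv a, Finset.map_inj]
    rw [outDegree_unlabel, Equiv.finsetCongr_apply, Finset.map_nonempty, Ne, Ne, hX]
  unfold connectivity
  simp only [this]

theorem IsAugmentation.unlabel {O : H.Orientation} {k ℓ : ℕ}
    {S : ℕ → (H.relabel a b).Orientation} (h : (O.relabel a b).IsAugmentation k ℓ S) :
    O.IsAugmentation k ℓ fun i => (S i).unlabel where
  start := by rw [h.start, unlabel_relabel]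
  step i hi := by
    obtain ⟨e, h1, h2⟩ := h.step i hi
    refine ⟨b.symm e, ?_, fun f hf => ?_⟩
    · simpa [Orientation.unlabel] using h1
    · simp [Orientation.unlabel, h2 (b f) (fun h => hf (by simp [← h]))]
  mono i hi := by
    rw [connectivity_unlabel, connectivity_unlabel]
    exact h.mono i hi
  final := by
    rw [connectivity_unlabel, h.final, ← connectivity_unlabel (O.relabel a b), unlabel_relabel]
  length := by
    have := h.length
    rwa [← connectivity_unlabel (O.relabel a b), unlabel_relabel, ← Fintype.card_congr a] at this

end Orientation

end Relabel

end MultiHypergraph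

theorem MultiHypergraph.Orientation.exists_isAugmentation {V E : Type*} [Fintype V] [DecidableEq V]
    [Fintype E] {H : MultiHypergraph V E} {k : ℕ} (hV : 2 ≤ Fintype.card V)
    (hH : H.IsPartitionConnected k) (O : H.Orientation) :
    ∃ (ℓ : ℕ) (S : ℕ → H.Orientation), O.IsAugmentation k ℓ S := by
  obtain ⟨ℓ, S, -, h⟩ := RAM.exec_augment hV
    (hH.relabel (Fintype.equivFin V) (Fintype.equivFin E)) (O.relabel _ _)
  exact ⟨ℓ, _, h.unlabel⟩

theorem mainTheorem1 :
    -- existence of the sequence, from every orientation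
    (∀ (V E : Type*) [Fintype V] [DecidableEq V] [Fintype E] (H : MultiHypergraph V E) (k : ℕ),
      2 ≤ Fintype.card V → H.IsPartitionConnected k →
      ∀ O : H.Orientation, ∃ (ℓ : ℕ) (S : ℕ → H.Orientation), O.IsAugmentation k ℓ S) ∧
    -- one program computes such a sequence in time polynomial in the size of the hypergraph
    (∃ (prog : RAM.Program) (T : Polynomial ℕ),
      ∀ (n m : ℕ) (H : MultiHypergraph (Fin n) (Fin m)) (k : ℕ),
        2 ≤ n → H.IsPartitionConnected k →
        ∀ O : H.Orientation, ∃ (t : ℕ) (s : RAM.Store) (ℓ : ℕ) (S : ℕ → H.Orientation),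
          RAM.Runs prog (RAM.input O k) t s ∧ t ≤ T.eval H.size ∧
          RAM.IsOutput s ℓ S ∧ O.IsAugmentation k ℓ S) ∧
    -- sufficiency in the orientation theorem of Frank, Király and Király
    (∀ (V E : Type*) [Fintype V] [DecidableEq V] [Fintype E] (H : MultiHypergraph V E) (k : ℕ),
      (∀ e, (H.edge e).Nonempty) → H.IsPartitionConnected k →
      ∃ O : H.Orientation, O.IsHyperarcConnected k) := by
  refine ⟨fun V E _ _ _ H k hV hH O => O.exists_isAugmentation hV hH, RAM.exists_program,
    fun V E _ _ _ H k hne hH => ?_⟩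
  let O : H.Orientation := ⟨fun e => (hne e).choose, fun e => (hne e).choose_spec⟩
  by_cases hV : 2 ≤ Fintype.card V
  · obtain ⟨ℓ, S, h⟩ := O.exists_isAugmentation hV hH
    refine ⟨S ℓ, (MultiHypergraph.Orientation.isHyperarcConnected_iff_le _ hV k).mpr ?_⟩
    rw [h.final]
    exact le_max_left _ _
  · -- no set of vertices is both non-empty and proper
    refine ⟨O, fun X hX hX' => absurd ?_ hX'⟩
    refine Finset.eq_univ_of_card X (le_antisymm (Finset.card_le_univ X) ?_)
    have := hX.card_pos
    omega
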